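/- For integers $n,r,k\ge 1$ let $\{0,1\}^{n\times r}_{\le n}$ be the set of Boolean $n\times r$ matrices with at most $n$ entries equal to $1$, and let $\mathrm{ED}_{n,r,k}\colon\{0,1\}^{n\times r}_{\le n}\to\{0,1\}$ be the $k$-element distinctness function: $\mathrm{ED}_{n,r,k}(x)=1$ if $x_{1,j}+x_{2,j}+\cdots+x_{n,j}<k$ for every column $j$, and $\mathrm{ED}_{n,r,k}(x)=0$ otherwise. For $f\colon X\to\mathbb R$ with $X\subset\mathbb R^N$ finite and $\epsilon\ge 0$, let $\deg_\epsilon(f)$ be the least total degree of a real polynomial $p$ with $|f(x)-p(x)|\le\epsilon$ for all $x\in X$. Write $\log$ for the logarithm to base $2$. **Theorem.** Let $k\ge 1$ be a fixed integer. The constants below depend only on $k$. (i) For all integers $n,r\ge 1$, $$\deg_{1/3}(\mathrm{ED}_{n,r,k})=O\left(\sqrt n\,\min\{n,r\}^{\frac12-\frac1{4(1-2^{-k})}}\right).$$ (ii) For all integers $n,r\ge 1$ and all reals $0<\epsilon\le 1/2$, $$\deg_{\epsilon}(\mathrm{ED}_{n,r,k})=O\left(\sqrt n\,\min\{n,r\}^{\frac12-\frac1{4(1-2^{-k})}}\left(\log\frac1\epsilon\right)^{\frac1{4(1-2^{-k})}}\right)+O\left(\sqrt{n\log\frac1\epsilon}\right).$$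 Moreover, in each case the approximating polynomial is given explicitly, in the following sense. There is an algorithm that on input $(n,r)$ outputs a polynomial with rational coefficients, as a list of monomials with their coefficients, that approximates $\mathrm{ED}_{n,r,k}$ on its domain to within $1/3$ and whose degree satisfies the bound in (i). Likewise there is an algorithm that on input $(n,r,a,b)$, where $a,b$ are positive integers with $\epsilon=a/b\le 1/2$, outputs a polynomial with rational coefficients that approximates $\mathrm{ED}_{n,r,k}$ on its domain to within $\epsilon$ and whose degree satisfies the bound in (ii). -/

import Mathlib

/-- The polynomial `p` approximates `f : X → ℝ` pointwise on `X` to within `ε`. -/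
def IsUniformApproximant {ι : Type*} {X : Set (ι → ℝ)} (f : X → ℝ) (ε : ℝ)
    (p : MvPolynomial ι ℝ) : Prop :=
  ∀ x : X, |f x - MvPolynomial.eval x.1 p| ≤ ε

/-- The `ε`-approximate degree: the least `d` such that some real polynomial of total degree at
most `d` approximates `f` pointwise on `X` to within `ε`. -/
noncomputable def approxDegree {ι : Type*} {X : Set (ι → ℝ)} (f : X → ℝ) (ε : ℝ) : ℕ :=
  sInf {d : ℕ | ∃ p : MvPolynomial ι ℝ, p.totalDegree ≤ d ∧ IsUniformApproximant f ε p}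

/-- On a finite domain every function has approximants, so that the minimum defining
`approxDegree` is over a non-empty set for each `ε ≥ 0`. -/
theorem exists_isUniformApproximant {ι : Type*} [Fintype ι] {X : Set (ι → ℝ)} (hX : X.Finite)
    (f : X → ℝ) {ε : ℝ} (hε : 0 ≤ ε) :
    ∃ p : MvPolynomial ι ℝ, IsUniformApproximant f ε p := by
  classical
  have : Fintype X := hX.fintype
  let q : X → MvPolynomial ι ℝ := fun b =>
    ∑ i, (MvPolynomial.X i - MvPolynomial.C (b.1 i)) ^ 2
  have hq : ∀ a b : X, MvPolynomial.eval a.1 (q b) = ∑ i, (a.1 i - b.1 i) ^ 2 := by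
    intro a b
    simp [q, map_sum]
  have hq0 : ∀ a b : X, MvPolynomial.eval a.1 (q b) = 0 ↔ a = b := by
    intro a b
    rw [hq, Finset.sum_eq_zero_iff_of_nonneg (fun i _ => sq_nonneg _)]
    constructor
    · intro h
      apply Subtype.ext
      funext i
      have := h i (Finset.mem_univ i)
      exact sub_eq_zero.mp (pow_eq_zero_iff (two_ne_zero) |>.mp this)
    · rintro rfl i _
      simp
  let w : X → MvPolynomial ι ℝ := fun a => ∏ b ∈ Finset.univ.erase a, q b
  refine ⟨∑ a : X, MvPolynomial.C (f a / MvPolynomial.eval a.1 (w a)) * w a, fun x => ?_⟩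
  have hx : MvPolynomial.eval x.1 (w x) ≠ 0 := by
    simp only [w, map_prod]
    refine Finset.prod_ne_zero_iff.mpr fun b hb h => ?_
    exact (Finset.ne_of_mem_erase hb) ((hq0 x b).mp h).symm
  have : MvPolynomial.eval x.1
      (∑ a : X, MvPolynomial.C (f a / MvPolynomial.eval a.1 (w a)) * w a) = f x := by
    rw [map_sum, Finset.sum_eq_single x]
    · rw [map_mul, MvPolynomial.eval_C, div_mul_cancel₀ _ hx]
    · intro a _ ha
      have : MvPolynomial.eval x.1 (w a) = 0 := by
        simp only [w, map_prod]
        exact Finset.prod_eq_zero (Finset.mem_erase.mpr ⟨ha.symm, Finset.mem_univ x⟩)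
          ((hq0 x x).mpr rfl)
      rw [map_mul, this, mul_zero]
    · intro h
      exact absurd (Finset.mem_univ x) h
  rw [this]
  simpa using hε

/-- The Boolean points of `ℝ^ι` of Hamming weight at most `m`. -/
def boolCubeLE (ι : Type*) [Fintype ι] (m : ℕ) : Set (ι → ℝ) :=
  {x | (∀ i, x i = 0 ∨ x i = 1) ∧ ∑ i, x i ≤ m}

theorem boolCubeLE_finite (ι : Type*) [Fintype ι] (m : ℕ) : (boolCubeLE ι m).Finite := by
  refine (Set.Finite.pi' (t := fun _ : ι => ({0, 1} : Set ℝ)) fun _ => by simp).subset ?_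
  intro x hx i
  simpa using hx.1 i

open Classical in
/-- The `k`-element distinctness function on Boolean `n × r` matrices of Hamming weight at most
`n`: its value is `1` if every column contains fewer than `k` ones, and `0` otherwise. -/
noncomputable def elementDistinctness (n r k : ℕ) : boolCubeLE (Fin n × Fin r) n → ℝ :=
  fun x => if ∀ j : Fin r, ∑ i : Fin n, x.1 (i, j) < k then 1 else 0

/-- The exponent `1 / (4 (1 - 2^{-k}))`. -/
noncomputable def edExponent (k : ℕ) : ℝ := 1 / (4 * (1 - (2 : ℝ) ^ (-(k : ℤ))))

/-- A finite description of a polynomial with rational coefficients: a list of terms, where the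
term `((a, b, c), [(i₁, j₁), …, (i_s, j_s)])` stands for the product of `(a - b) / c` and the
variables at the (zero-based) matrix positions `(i₁, j₁), …, (i_s, j_s)`. -/
abbrev PolyCode : Type := List ((ℕ × ℕ × ℕ) × List (ℕ × ℕ))

/-- The variable at a matrix position; positions outside the matrix are read as `0`. -/
noncomputable def entryVar (n r : ℕ) (s : ℕ × ℕ) : MvPolynomial (Fin n × Fin r) ℝ :=
  if h : s.1 < n ∧ s.2 < r then MvPolynomial.X (⟨s.1, h.1⟩, ⟨s.2, h.2⟩) else 0

/-- The polynomial in the entries of an `n × r` matrix that a code describes. -/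
noncomputable def PolyCode.toPoly (n r : ℕ) (L : PolyCode) : MvPolynomial (Fin n × Fin r) ℝ :=
  (L.map fun t =>
    MvPolynomial.C (((t.1.1 : ℝ) - (t.1.2.1 : ℝ)) / (t.1.2.2 : ℝ)) *
      (t.2.map (entryVar n r)).prod).sum

open Polynomial in
/-- The polynomial whose coefficients are the absolute values of those of `p`. -/
noncomputable def absPoly (p : Polynomial ℝ) : Polynomial ℝ :=
  ∑ i ∈ p.support, Polynomial.monomial i |p.coeff i|

section AbsPoly
open Polynomial

theorem coeff_absPoly (p : ℝ[X]) (i : ℕ) : (absPoly p).coeff i = |p.coeff i| := by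
  classical
  rw [absPoly, finsetSum_coeff]
  simp only [coeff_monomial]
  rw [Finset.sum_ite_eq' p.support i]
  split_ifs with h
  · rfl
  · simp [notMem_support_iff.mp h]

theorem eval_mono_of_coeff_le {p q : ℝ[X]} (h : ∀ i, p.coeff i ≤ q.coeff i) {x : ℝ} (hx : 0 ≤ x) :
    p.eval x ≤ q.eval x := by
  rw [eval_eq_sum_range' (n := max p.natDegree q.natDegree + 1) (by omega),
    eval_eq_sum_range' (p := q) (n := max p.natDegree q.natDegree + 1) (by omega)]
  exact Finset.sum_le_sum fun i _ => mul_le_mul_of_nonneg_right (h i) (by positivity)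

theorem absPoly_eval_nonneg (p : ℝ[X]) {x : ℝ} (hx : 0 ≤ x) : 0 ≤ (absPoly p).eval x := by
  have := eval_mono_of_coeff_le (p := 0) (q := absPoly p)
    (fun i => by rw [coeff_absPoly]; simp) hx
  simpa using this

theorem natDegree_absPoly (p : ℝ[X]) : (absPoly p).natDegree = p.natDegree := by
  apply natDegree_eq_natDegree
  apply le_antisymm
  · exact (degree_le_iff_coeff_zero _ _).mpr fun m hm => by
      rw [coeff_absPoly, coeff_eq_zero_of_degree_lt hm, abs_zero]
  · exact (degree_le_iff_coeff_zero _ _).mpr fun m hm => by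
      have := coeff_eq_zero_of_degree_lt hm
      rw [coeff_absPoly] at this
      exact abs_eq_zero.mp this

theorem absPoly_eval_mul_le (p q : ℝ[X]) {x : ℝ} (hx : 0 ≤ x) :
    (absPoly (p * q)).eval x ≤ (absPoly p).eval x * (absPoly q).eval x := by
  rw [← eval_mul]
  refine eval_mono_of_coeff_le (fun i => ?_) hx
  rw [coeff_absPoly, coeff_mul, coeff_mul]
  refine (Finset.abs_sum_le_sum_abs _ _).trans (le_of_eq ?_)
  exact Finset.sum_congr rfl fun a _ => by rw [abs_mul, coeff_absPoly, coeff_absPoly]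

theorem absPoly_eval_add_le (p q : ℝ[X]) {x : ℝ} (hx : 0 ≤ x) :
    (absPoly (p + q)).eval x ≤ (absPoly p).eval x + (absPoly q).eval x := by
  rw [← eval_add]
  refine eval_mono_of_coeff_le (fun i => ?_) hx
  rw [coeff_absPoly, coeff_add, coeff_add, coeff_absPoly, coeff_absPoly]
  exact abs_add_le _ _

theorem absPoly_neg (p : ℝ[X]) : absPoly (-p) = absPoly p := by
  ext i
  simp [coeff_absPoly]

theorem absPoly_eval_sub_le (p q : ℝ[X]) {x : ℝ} (hx : 0 ≤ x) :
    (absPoly (p - q)).eval x ≤ (absPoly p).eval x + (absPoly q).eval x := by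
  have := absPoly_eval_add_le p (-q) hx
  rwa [absPoly_neg, ← sub_eq_add_neg] at this

theorem absPoly_C (c : ℝ) : absPoly (C c) = C |c| := by
  ext i
  rw [coeff_absPoly, coeff_C, coeff_C]
  split_ifs <;> simp

theorem absPoly_one : absPoly 1 = 1 := by
  simpa using absPoly_C 1

theorem absPoly_X : absPoly X = X := by
  ext i
  rw [coeff_absPoly, coeff_X]
  split_ifs <;> simp

theorem absPoly_C_mul (c : ℝ) (p : ℝ[X]) : absPoly (C c * p) = C |c| * absPoly p := by
  ext i
  rw [coeff_absPoly, coeff_C_mul, coeff_C_mul, coeff_absPoly, abs_mul]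

theorem absPoly_eval_pow_le (p : ℝ[X]) {x : ℝ} (hx : 0 ≤ x) (n : ℕ) :
    (absPoly (p ^ n)).eval x ≤ ((absPoly p).eval x) ^ n := by
  induction n with
  | zero => simp [absPoly_one]
  | succ n ih =>
    rw [pow_succ, pow_succ]
    exact (absPoly_eval_mul_le _ _ hx).trans
      (mul_le_mul_of_nonneg_right ih (absPoly_eval_nonneg _ hx))

theorem absPoly_eval_sum_le {ι : Type*} (s : Finset ι) (p : ι → ℝ[X]) {x : ℝ} (hx : 0 ≤ x) :
    (absPoly (∑ i ∈ s, p i)).eval x ≤ ∑ i ∈ s, (absPoly (p i)).eval x := by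
  classical
  induction s using Finset.induction_on with
  | empty => simp [absPoly]
  | insert a s ha ih =>
    rw [Finset.sum_insert ha, Finset.sum_insert ha]
    exact (absPoly_eval_add_le _ _ hx).trans (by linarith)

theorem absPoly_eval_prod_le {ι : Type*} (s : Finset ι) (p : ι → ℝ[X]) {x : ℝ} (hx : 0 ≤ x) :
    (absPoly (∏ i ∈ s, p i)).eval x ≤ ∏ i ∈ s, (absPoly (p i)).eval x := by
  classical
  induction s using Finset.induction_on with
  | empty => simp [absPoly_one]
  | insert a s ha ih =>
    rw [Finset.prod_insert ha, Finset.prod_insert ha]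
    exact (absPoly_eval_mul_le _ _ hx).trans
      (mul_le_mul_of_nonneg_left ih (absPoly_eval_nonneg _ hx))

theorem absPoly_comp_C_mul_X (p : ℝ[X]) {a : ℝ} (ha : 0 ≤ a) :
    absPoly (p.comp (C a * X)) = (absPoly p).comp (C a * X) := by
  ext i
  rw [coeff_absPoly, comp_C_mul_X_coeff, comp_C_mul_X_coeff, coeff_absPoly, abs_mul,
    abs_of_nonneg (pow_nonneg ha i)]

theorem absPoly_divX_eval_one_le (p : ℝ[X]) : (absPoly p.divX).eval 1 ≤ (absPoly p).eval 1 := by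
  have h : absPoly p = absPoly p.divX * X + C |p.coeff 0| := by
    ext i
    cases i with
    | zero => simp [coeff_absPoly]
    | succ i => simp [coeff_absPoly, coeff_C_succ]
  rw [h]
  simp

theorem abs_eval_le_absPoly (p : ℝ[X]) {x : ℝ} (hx : 0 ≤ x) :
    |p.eval x| ≤ (absPoly p).eval x := by
  rw [eval_eq_sum_range, eval_eq_sum_range, natDegree_absPoly]
  refine (Finset.abs_sum_le_sum_abs _ _).trans (le_of_eq ?_)
  exact Finset.sum_congr rfl fun i _ => by
    rw [abs_mul, coeff_absPoly, abs_of_nonneg (pow_nonneg hx i)]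

theorem absPoly_eval_mono (p : ℝ[X]) {x y : ℝ} (hx : 0 ≤ x) (hxy : x ≤ y) :
    (absPoly p).eval x ≤ (absPoly p).eval y := by
  rw [eval_eq_sum_range, eval_eq_sum_range]
  refine Finset.sum_le_sum fun i _ => mul_le_mul_of_nonneg_left (by gcongr) ?_
  rw [coeff_absPoly]
  exact abs_nonneg _

theorem absPoly_eval_le_pow_mul (p : ℝ[X]) {d : ℕ} (hd : p.natDegree ≤ d) {m t : ℝ} (hm : 0 < m)
    (ht : m ≤ t) : (absPoly p).eval t ≤ (t / m) ^ d * (absPoly p).eval m := by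
  rw [eval_eq_sum_range, eval_eq_sum_range, natDegree_absPoly, Finset.mul_sum]
  refine Finset.sum_le_sum fun i hi => ?_
  have hi' : i ≤ d := by
    have := Finset.mem_range.mp hi
    omega
  have h1 : 1 ≤ t / m := (one_le_div hm).mpr ht
  have h2 : (t / m) ^ i ≤ (t / m) ^ d := pow_le_pow_right₀ h1 hi'
  have h3 : t ^ i = (t / m) ^ i * m ^ i := by rw [← mul_pow, div_mul_cancel₀ _ hm.ne']
  have h4 : 0 ≤ (absPoly p).coeff i := by rw [coeff_absPoly]; exact abs_nonneg _
  rw [h3]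
  calc (absPoly p).coeff i * ((t / m) ^ i * m ^ i)
      = (t / m) ^ i * ((absPoly p).coeff i * m ^ i) := by ring
    _ ≤ _ := by gcongr

end AbsPoly

section Kernel
open Polynomial

/-- The polynomial `(1 - T_e(1 - 2x)) / (2 e² x)`. -/
noncomputable def fejerPoly (e : ℕ) : ℝ[X] :=
  C (1 / (2 * (e : ℝ) ^ 2)) * (1 - (Chebyshev.T ℝ e).comp (1 - 2 * X)).divX

theorem natDegree_cheb_comp (e : ℕ) :
    ((Chebyshev.T ℝ e).comp (1 - 2 * X)).natDegree ≤ e := by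
  refine natDegree_comp_le.trans ?_
  have h1 : (Chebyshev.T ℝ (e : ℤ)).natDegree = e := by simp
  have h2 : (1 - 2 * X : ℝ[X]).natDegree ≤ 1 := by compute_degree
  rw [h1]
  calc e * _ ≤ e * 1 := by gcongr
    _ = e := mul_one e

theorem natDegree_fejerPoly (e : ℕ) : (fejerPoly e).natDegree ≤ e := by
  refine (natDegree_C_mul_le _ _).trans ?_
  rw [natDegree_divX_eq_natDegree_tsub_one]
  have : (1 - (Chebyshev.T ℝ e).comp (1 - 2 * X)).natDegree ≤ e :=
    (natDegree_sub_le _ _).trans (by simpa using natDegree_cheb_comp e)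
  omega

theorem absPoly_cheb_comp_le (e : ℕ) :
    (absPoly ((Chebyshev.T ℝ e).comp (1 - 2 * X))).eval 1 ≤ 7 ^ e := by
  induction e using Nat.strong_induction_on with
  | _ e ih =>
    match e with
    | 0 => simp [absPoly_one]
    | 1 =>
      have h := absPoly_eval_sub_le 1 (C 2 * X) (zero_le_one (α := ℝ))
      rw [absPoly_one, absPoly_C_mul, absPoly_X] at h
      simp only [eval_one, eval_mul, eval_C, eval_X, Nat.abs_ofNat] at h
      simp only [Nat.cast_one, Chebyshev.T_one, X_comp, pow_one]
      have h2 : (1 - 2 * X : ℝ[X]) = 1 - C 2 * X := by rw [map_ofNat C 2]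
      rw [h2]
      linarith
    | e + 2 =>
      have h1 := ih e (by omega)
      have h2 := ih (e + 1) (by omega)
      have h3 : (Chebyshev.T ℝ ((e + 2 : ℕ) : ℤ)).comp (1 - 2 * X) =
          (2 - C 4 * X) * (Chebyshev.T ℝ ((e + 1 : ℕ) : ℤ)).comp (1 - 2 * X) -
            (Chebyshev.T ℝ (e : ℤ)).comp (1 - 2 * X) := by
        push_cast
        rw [Chebyshev.T_add_two]
        simp only [sub_comp, mul_comp, X_comp, ofNat_comp]
        have : (C 4 : ℝ[X]) = 4 := map_ofNat C 4
        rw [this]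
        ring
      have h4 : (absPoly (2 - C 4 * X : ℝ[X])).eval 1 ≤ 6 := by
        have h := absPoly_eval_sub_le (C 2) (C 4 * X) (zero_le_one (α := ℝ))
        rw [absPoly_C, absPoly_C_mul, absPoly_X] at h
        simp only [eval_mul, eval_C, eval_X, Nat.abs_ofNat] at h
        have h2 : (C 2 : ℝ[X]) = 2 := map_ofNat C 2
        rw [h2] at h
        linarith
      rw [h3]
      refine (absPoly_eval_sub_le _ _ zero_le_one).trans ?_
      have h5 := absPoly_eval_mul_le (2 - C 4 * X)
        ((Chebyshev.T ℝ ((e + 1 : ℕ) : ℤ)).comp (1 - 2 * X)) (zero_le_one (α := ℝ))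
      have h6 := mul_le_mul h4 h2 (absPoly_eval_nonneg _ zero_le_one) (by norm_num)
      have h7 : (7 : ℝ) ^ (e + 2) = 49 * 7 ^ e := by ring
      have h8 : (7 : ℝ) ^ (e + 1) = 7 * 7 ^ e := by ring
      have h9 : (0 : ℝ) < 7 ^ e := by positivity
      rw [h8] at h6
      rw [h7]
      linarith

theorem absPoly_fejerPoly_le {e : ℕ} (he : 1 ≤ e) : (absPoly (fejerPoly e)).eval 1 ≤ 7 ^ e := by
  rw [fejerPoly, absPoly_C_mul, eval_mul, eval_C]
  have he' : (1 : ℝ) ≤ e := by exact_mod_cast he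
  have h1 : |1 / (2 * (e : ℝ) ^ 2)| ≤ 1 / 2 := by
    rw [abs_of_nonneg (by positivity), div_le_div_iff₀ (by positivity) (by norm_num)]
    nlinarith
  have h2 := absPoly_divX_eval_one_le (1 - (Chebyshev.T ℝ e).comp (1 - 2 * X))
  have h3 := absPoly_eval_sub_le 1 ((Chebyshev.T ℝ e).comp (1 - 2 * X)) (zero_le_one (α := ℝ))
  have h4 := absPoly_cheb_comp_le e
  rw [absPoly_one, eval_one] at h3
  have h5 : (1 : ℝ) ≤ 7 ^ e := one_le_pow₀ (by norm_num)
  have h6 : 0 ≤ (absPoly (1 - (Chebyshev.T ℝ e).comp (1 - 2 * X)).divX).eval 1 :=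
    absPoly_eval_nonneg _ zero_le_one
  calc _ ≤ 1 / 2 * (absPoly (1 - (Chebyshev.T ℝ e).comp (1 - 2 * X)).divX).eval 1 := by gcongr
    _ ≤ _ := by linarith

theorem fejerPoly_mul_eval (e : ℕ) (x : ℝ) :
    x * (fejerPoly e).eval x = (1 - (Chebyshev.T ℝ e).eval (1 - 2 * x)) / (2 * (e : ℝ) ^ 2) := by
  have h := congrArg (eval x) (divX_mul_X_add (1 - (Chebyshev.T ℝ e).comp (1 - 2 * X)))
  have h0 : (1 - (Chebyshev.T ℝ e).comp (1 - 2 * X)).coeff 0 = 0 := by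
    rw [coeff_zero_eq_eval_zero]
    simp
  rw [h0] at h
  simp only [map_zero, add_zero, eval_mul, eval_X, eval_sub, eval_one, eval_comp, eval_ofNat] at h
  rw [fejerPoly, eval_mul, eval_C, ← h]
  ring

theorem abs_sin_nat_mul_le (e : ℕ) (φ : ℝ) : |Real.sin (e * φ)| ≤ e * |Real.sin φ| := by
  induction e with
  | zero => simp
  | succ e ih =>
    push_cast
    rw [add_mul, one_mul, Real.sin_add]
    refine (abs_add_le _ _).trans ?_
    rw [abs_mul, abs_mul]
    have h1 := Real.abs_cos_le_one φ
    have h2 := Real.abs_cos_le_one (e * φ)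
    have := abs_nonneg (Real.sin φ)
    have := abs_nonneg (Real.sin (e * φ))
    nlinarith

/-- Trigonometric form of the kernel. -/
theorem fejerPoly_eval_eq (e : ℕ) {x φ : ℝ} (hx : x = Real.sin φ ^ 2) :
    x * (fejerPoly e).eval x = Real.sin (e * φ) ^ 2 / (e : ℝ) ^ 2 := by
  have h1 : 1 - 2 * x = Real.cos (2 * φ) := by
    rw [hx, Real.cos_two_mul, Real.cos_sq']
    ring
  rw [fejerPoly_mul_eval, h1, Chebyshev.T_real_cos]
  have h2 : Real.cos ((e : ℤ) * (2 * φ)) = 1 - 2 * Real.sin (e * φ) ^ 2 := by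
    have : ((e : ℤ) : ℝ) * (2 * φ) = 2 * (e * φ) := by push_cast; ring
    rw [this, Real.cos_two_mul, Real.cos_sq']
    ring
  rw [h2]
  by_cases he : (e : ℝ) = 0
  · simp [he]
  · field_simp
    ring

theorem exists_sin_sq {x : ℝ} (hx : 0 ≤ x) (hx1 : x ≤ 1) :
    ∃ φ, 0 ≤ φ ∧ φ ≤ Real.pi / 2 ∧ x = Real.sin φ ^ 2 := by
  refine ⟨Real.arcsin (√x), Real.arcsin_nonneg.mpr (Real.sqrt_nonneg x),
    Real.arcsin_le_pi_div_two _, ?_⟩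
  rw [Real.sin_arcsin (by linarith [Real.sqrt_nonneg x]) (Real.sqrt_le_one.mpr hx1),
    Real.sq_sqrt hx]

theorem fejerPoly_eval_zero {e : ℕ} (he : 1 ≤ e) : (fejerPoly e).eval 0 = 1 := by
  have hd := congrArg derivative (divX_mul_X_add (1 - (Chebyshev.T ℝ e).comp (1 - 2 * X)))
  have h := congrArg (eval 0) hd
  have he' : (e : ℝ) ≠ 0 := by positivity
  have hT := Chebyshev.derivative_T_eval_one (R := ℝ) e
  simp only [derivative_add, derivative_mul, derivative_X, derivative_C, derivative_sub,
    derivative_one, derivative_comp, eval_add, eval_mul, eval_X, eval_sub, eval_one, eval_zero,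
    eval_comp, derivative_ofNat, eval_ofNat, mul_zero, mul_one, zero_add, add_zero, zero_mul,
    sub_zero, hT] at h
  rw [fejerPoly, eval_mul, eval_C, h]
  push_cast
  field_simp
  ring

theorem fejerPoly_eval_nonneg (e : ℕ) {x : ℝ} (hx : 0 < x) (hx1 : x ≤ 1) :
    0 ≤ (fejerPoly e).eval x := by
  obtain ⟨φ, -, -, h⟩ := exists_sin_sq hx.le hx1
  have := fejerPoly_eval_eq e h
  have h2 : 0 ≤ x * (fejerPoly e).eval x := by rw [this]; positivity
  exact nonneg_of_mul_nonneg_right h2 hx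

theorem fejerPoly_eval_le_one (e : ℕ) {x : ℝ} (hx : 0 < x) (hx1 : x ≤ 1) :
    (fejerPoly e).eval x ≤ 1 := by
  obtain ⟨φ, -, -, h⟩ := exists_sin_sq hx.le hx1
  have h1 := fejerPoly_eval_eq e h
  have h2 : Real.sin (e * φ) ^ 2 / (e : ℝ) ^ 2 ≤ x := by
    rcases Nat.eq_zero_or_pos e with rfl | he
    · simpa using hx.le
    · have he' : (0 : ℝ) < e := by exact_mod_cast he
      rw [div_le_iff₀ (by positivity), h]
      have := abs_sin_nat_mul_le e φ
      have h3 := pow_le_pow_left₀ (abs_nonneg _) this 2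
      rw [sq_abs, mul_pow, sq_abs] at h3
      linarith
  rw [← h1] at h2
  exact le_of_mul_le_mul_left (by linarith) hx

theorem fejerPoly_eval_le_inv {e : ℕ} (he : 1 ≤ e) {x : ℝ} (hx : 0 < x) (hx1 : x ≤ 1) :
    (fejerPoly e).eval x ≤ 1 / ((e : ℝ) ^ 2 * x) := by
  obtain ⟨φ, -, -, h⟩ := exists_sin_sq hx.le hx1
  have h1 := fejerPoly_eval_eq e h
  have he' : (0 : ℝ) < e := by exact_mod_cast he
  rw [le_div_iff₀ (by positivity)]
  have h2 : (fejerPoly e).eval x * ((e : ℝ) ^ 2 * x) = Real.sin (e * φ) ^ 2 := by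
    have : (fejerPoly e).eval x * ((e : ℝ) ^ 2 * x) =
      (x * (fejerPoly e).eval x) * (e : ℝ) ^ 2 := by ring
    rw [this, h1]
    field_simp
  rw [h2]
  exact Real.sin_sq_le_one _

theorem fejerPoly_eval_ge {e : ℕ} (he : 1 ≤ e) {x : ℝ} (hx : 0 < x) (hx1 : x ≤ 1)
    (hex : (e : ℝ) ^ 2 * x ≤ 1 / 16) : 7 / 8 ≤ (fejerPoly e).eval x := by
  obtain ⟨φ, h0, hpi, h⟩ := exists_sin_sq hx.le hx1
  have h1 := fejerPoly_eval_eq e h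
  have he' : (0 : ℝ) < e := by exact_mod_cast he
  have hφ : 0 < φ := by
    rcases h0.lt_or_eq with h0 | h0
    · exact h0
    · rw [← h0] at h; simp at h; linarith
  have hs1 := Real.mul_le_sin h0 hpi
  have hs2 : Real.sin φ ≤ φ := Real.sin_le h0
  have hs0 : 0 < Real.sin φ := Real.sin_pos_of_pos_of_lt_pi hφ (by linarith [Real.pi_pos])
  set y := e * φ with hy
  have hy0 : 0 < y := by positivity
  have hpi4 : Real.pi < 3.15 := Real.pi_lt_d2
  have hφs : φ ≤ 1.575 * Real.sin φ := by
    have : 2 / Real.pi * φ * Real.pi = 2 * φ := by field_simp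
    have h3 : 2 * φ ≤ Real.sin φ * Real.pi := by
      rw [← this]; exact mul_le_mul_of_nonneg_right hs1 Real.pi_pos.le
    nlinarith
  have hy2 : y ^ 2 ≤ 0.16 := by
    have h3 : φ ^ 2 ≤ (1.575 * Real.sin φ) ^ 2 := pow_le_pow_left₀ h0 hφs 2
    have h4 : y ^ 2 ≤ (e : ℝ) ^ 2 * (1.575 * Real.sin φ) ^ 2 := by
      rw [hy, mul_pow]; gcongr
    have h5 : (e : ℝ) ^ 2 * (1.575 * Real.sin φ) ^ 2 = 1.575 ^ 2 * ((e : ℝ) ^ 2 * x) := by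
      rw [h]; ring
    rw [h5] at h4
    nlinarith
  have hy1 : y ≤ 1 := by nlinarith
  have hsy := Real.sin_gt_sub_cube hy0
  have hsy0 : y * (1 - y ^ 2 / 4) ≤ Real.sin y := by
    have := pow_pos hy0 3
    linarith [show y * (1 - y ^ 2 / 4) = y - y ^ 3 / 4 by ring]
  have hsq : y ^ 2 * (7 / 8) ≤ Real.sin y ^ 2 := by
    have h3 : 0 ≤ y * (1 - y ^ 2 / 4) := by
      apply mul_nonneg hy0.le; linarith
    have h4 := pow_le_pow_left₀ h3 hsy0 2
    have h5 : (7 / 8 : ℝ) ≤ (1 - y ^ 2 / 4) ^ 2 := by nlinarith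
    rw [mul_pow] at h4
    have : y ^ 2 * (7 / 8) ≤ y ^ 2 * (1 - y ^ 2 / 4) ^ 2 := by gcongr
    linarith
  have hxφ : x ≤ φ ^ 2 := by rw [h]; exact pow_le_pow_left₀ hs0.le hs2 2
  have h6 : x * (7 / 8) ≤ x * (fejerPoly e).eval x := by
    rw [h1, le_div_iff₀ (by positivity)]
    have : x * (7 / 8) * (e : ℝ) ^ 2 ≤ y ^ 2 * (7 / 8) := by
      rw [hy, mul_pow]
      nlinarith [mul_le_mul_of_nonneg_right hxφ (sq_nonneg (e : ℝ))]
    linarith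
  exact le_of_mul_le_mul_left h6 hx

end Kernel

section Threshold
open Polynomial

/-- The probability of at least `h` successes in `2h` trials, as a polynomial in the success
probability. -/
noncomputable def majority (h : ℕ) (s : ℝ) : ℝ :=
  ∑ i ∈ Finset.Ico h (2 * h + 1), ((2 * h).choose i : ℝ) * s ^ i * (1 - s) ^ (2 * h - i)

theorem majority_add_compl (h : ℕ) (s : ℝ) :
    ∑ i ∈ Finset.range h, ((2 * h).choose i : ℝ) * s ^ i * (1 - s) ^ (2 * h - i) +
      majority h s = 1 := by
  rw [majority, Finset.range_eq_Ico, Finset.sum_Ico_consecutive _ (by omega) (by omega)]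
  have := add_pow s (1 - s) (2 * h)
  rw [add_sub_cancel, one_pow, Finset.range_eq_Ico] at this
  refine Eq.trans ?_ this.symm
  exact Finset.sum_congr rfl fun i _ => by ring

theorem majority_nonneg (h : ℕ) {s : ℝ} (hs : 0 ≤ s) (hs1 : s ≤ 1) : 0 ≤ majority h s :=
  Finset.sum_nonneg fun i _ => by
    have : 0 ≤ 1 - s := by linarith
    positivity

theorem majority_le_one (h : ℕ) {s : ℝ} (hs : 0 ≤ s) (hs1 : s ≤ 1) : majority h s ≤ 1 := by
  have h1 := majority_add_compl h s
  have h2 : 0 ≤ ∑ i ∈ Finset.range h, ((2 * h).choose i : ℝ) * s ^ i * (1 - s) ^ (2 * h - i) :=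
    Finset.sum_nonneg fun i _ => by
      have : 0 ≤ 1 - s := by linarith
      positivity
  linarith

theorem sum_choose_subset_le (h : ℕ) {S : Finset ℕ} (hS : S ⊆ Finset.range (2 * h + 1)) :
    ∑ i ∈ S, ((2 * h).choose i : ℝ) ≤ 4 ^ h := by
  calc ∑ i ∈ S, ((2 * h).choose i : ℝ)
      ≤ ∑ i ∈ Finset.range (2 * h + 1), ((2 * h).choose i : ℝ) :=
        Finset.sum_le_sum_of_subset_of_nonneg hS fun i _ _ => by positivity
    _ = 4 ^ h := by
        have := Nat.sum_range_choose (2 * h)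
        rw [pow_mul] at this
        exact_mod_cast this

theorem majority_le_pow (h : ℕ) {s : ℝ} (hs : 0 ≤ s) (hs1 : s ≤ 1) :
    majority h s ≤ (4 * s) ^ h := by
  calc majority h s ≤ ∑ i ∈ Finset.Ico h (2 * h + 1), ((2 * h).choose i : ℝ) * s ^ h := by
        refine Finset.sum_le_sum fun i hi => ?_
        have hi' := Finset.mem_Ico.mp hi
        have h1 : s ^ i ≤ s ^ h := pow_le_pow_of_le_one hs hs1 hi'.1
        have h2 : (1 - s) ^ (2 * h - i) ≤ 1 := pow_le_one₀ (by linarith) (by linarith)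
        have h3 : 0 ≤ (1 - s) ^ (2 * h - i) := pow_nonneg (by linarith) _
        calc ((2 * h).choose i : ℝ) * s ^ i * (1 - s) ^ (2 * h - i)
            ≤ ((2 * h).choose i : ℝ) * s ^ h * 1 := by gcongr
          _ = _ := mul_one _
    _ ≤ _ := by
        rw [← Finset.sum_mul, mul_pow]
        refine mul_le_mul_of_nonneg_right (sum_choose_subset_le h ?_) (by positivity)
        intro i hi
        exact Finset.mem_range.mpr (Finset.mem_Ico.mp hi).2

theorem one_sub_majority_le_pow (h : ℕ) {s : ℝ} (hs : 0 ≤ s) (hs1 : s ≤ 1) :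
    1 - majority h s ≤ (4 * (1 - s)) ^ h := by
  rw [show 1 - majority h s = ∑ i ∈ Finset.range h,
    ((2 * h).choose i : ℝ) * s ^ i * (1 - s) ^ (2 * h - i) by
      linarith [majority_add_compl h s]]
  calc _ ≤ ∑ i ∈ Finset.range h, ((2 * h).choose i : ℝ) * (1 - s) ^ h := by
        refine Finset.sum_le_sum fun i hi => ?_
        have hi' := Finset.mem_range.mp hi
        have h1 : (1 - s) ^ (2 * h - i) ≤ (1 - s) ^ h :=
          pow_le_pow_of_le_one (by linarith) (by linarith) (by omega)
        have h2 : s ^ i ≤ 1 := pow_le_one₀ hs hs1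
        have h3 : 0 ≤ (1 - s) ^ (2 * h - i) := pow_nonneg (by linarith) _
        calc ((2 * h).choose i : ℝ) * s ^ i * (1 - s) ^ (2 * h - i)
            ≤ ((2 * h).choose i : ℝ) * 1 * (1 - s) ^ h := by gcongr
          _ = _ := by ring
    _ ≤ _ := by
        rw [← Finset.sum_mul, mul_pow]
        refine mul_le_mul_of_nonneg_right (sum_choose_subset_le h ?_)
          (pow_nonneg (by linarith) _)
        intro i hi
        have := Finset.mem_range.mp hi
        exact Finset.mem_range.mpr (by omega)

/-- A polynomial that is close to `1` on `[0, m]`, lies in `[0, 1]` on `[0, N]`, and decays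
polynomially beyond `m`. -/
theorem exists_threshold_poly {m N : ℝ} (hm : 0 < m) (hN : 0 ≤ N) (h : ℕ) :
    ∃ (e : ℕ) (u : ℝ[X]), (e : ℝ) ≤ 1 + √(N / m) ∧ u.natDegree ≤ 2 * h * e ∧ u.eval 0 = 1 ∧
      (∀ v, 0 ≤ v → v ≤ N → 0 ≤ u.eval v ∧ u.eval v ≤ 1) ∧
      (∀ v, 0 ≤ v → v ≤ N → v ≤ m → 1 - u.eval v ≤ (1 / 2) ^ h) ∧
      (∀ v, 0 < v → v ≤ N → u.eval v ≤ (256 * m / v) ^ h) ∧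
      (absPoly u).eval N ≤ 7 ^ (4 * h * e) := by
  set N' := N + 16 * m with hN'
  have hN'0 : 0 < N' := by positivity
  set e := ⌊√(N' / (16 * m))⌋₊ with he
  have hq : N' / (16 * m) = N / m / 16 + 1 := by rw [hN']; field_simp
  have hq1 : 1 ≤ N' / (16 * m) := by
    rw [hq]
    have : 0 ≤ N / m := by positivity
    linarith
  have he1 : 1 ≤ e := Nat.le_floor (by simpa using Real.one_le_sqrt.mpr hq1)
  have he1' : (1 : ℝ) ≤ e := by exact_mod_cast he1
  have hle : (e : ℝ) ≤ √(N' / (16 * m)) := Nat.floor_le (Real.sqrt_nonneg _)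
  have hlt : √(N' / (16 * m)) < e + 1 := Nat.lt_floor_add_one _
  have hsq : (e : ℝ) ^ 2 ≤ N' / (16 * m) := (Real.le_sqrt' (by linarith)).mp hle
  have hsq2 : N' / (16 * m) ≤ 4 * (e : ℝ) ^ 2 := by
    have h1 := Real.sqrt_lt' (by linarith : (0 : ℝ) < e + 1) |>.mp hlt
    nlinarith
  set S := (fejerPoly e).comp (C (1 / N') * X) with hS
  have hSev : ∀ v, S.eval v = (fejerPoly e).eval (v / N') := by
    intro v
    rw [hS, eval_comp]
    simp only [eval_mul, eval_C, eval_X]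
    congr 1
    ring
  have hS0 : S.eval 0 = 1 := by rw [hSev, zero_div, fejerPoly_eval_zero he1]
  have hx : ∀ v, 0 < v → v ≤ N → 0 < v / N' ∧ v / N' ≤ 1 := fun v h0 h1 =>
    ⟨by positivity, (div_le_one hN'0).mpr (by rw [hN']; linarith)⟩
  have hS01 : ∀ v, 0 ≤ v → v ≤ N → 0 ≤ S.eval v ∧ S.eval v ≤ 1 := by
    intro v h0 h1
    rcases h0.eq_or_lt with rfl | h0
    · rw [hS0]; norm_num
    · rw [hSev]
      exact ⟨fejerPoly_eval_nonneg e (hx v h0 h1).1 (hx v h0 h1).2,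
        fejerPoly_eval_le_one e (hx v h0 h1).1 (hx v h0 h1).2⟩
  set u : ℝ[X] := ∑ i ∈ Finset.Ico h (2 * h + 1),
    C ((2 * h).choose i : ℝ) * S ^ i * (1 - S) ^ (2 * h - i) with hu
  have huev : ∀ v, u.eval v = majority h (S.eval v) := by
    intro v
    rw [hu, eval_finsetSum, majority]
    simp
  have hSdeg : S.natDegree ≤ e := by
    refine natDegree_comp_le.trans ?_
    have h1 := natDegree_fejerPoly e
    have h2 : (C (1 / N') * X : ℝ[X]).natDegree ≤ 1 :=
      (natDegree_C_mul_le _ _).trans natDegree_X_le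
    calc _ ≤ e * 1 := by gcongr
      _ = e := mul_one e
  have hSdeg1 : (1 - S).natDegree ≤ e := (natDegree_sub_le _ _).trans (by simpa using hSdeg)
  refine ⟨e, u, ?_, ?_, ?_, ?_, ?_, ?_, ?_⟩
  · refine hle.trans (Real.sqrt_le_iff.mpr ⟨by positivity, ?_⟩)
    rw [hq]
    have h1 : √(N / m) ^ 2 = N / m := Real.sq_sqrt (by positivity)
    have h2 := Real.sqrt_nonneg (N / m)
    nlinarith
  · refine natDegree_sum_le_of_forall_le _ _ fun i hi => ?_
    have hi' := Finset.mem_Ico.mp hi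
    refine natDegree_mul_le.trans ?_
    have h1 : (C ((2 * h).choose i : ℝ) * S ^ i).natDegree ≤ i * e :=
      (natDegree_C_mul_le _ _).trans (natDegree_pow_le.trans (by gcongr))
    have h2 : ((1 - S) ^ (2 * h - i)).natDegree ≤ (2 * h - i) * e :=
      natDegree_pow_le.trans (by gcongr)
    calc _ ≤ i * e + (2 * h - i) * e := add_le_add h1 h2
      _ = (i + (2 * h - i)) * e := by ring
      _ = 2 * h * e := by congr 1; omega
  · have h1 := one_sub_majority_le_pow h (s := 1) zero_le_one le_rfl
    rw [huev, hS0, majority, Finset.sum_eq_single (2 * h)]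
    · simp
    · intro i hi hne
      have hi' := Finset.mem_Ico.mp hi
      have : 2 * h - i ≠ 0 := by omega
      simp [this]
    · intro hc
      exact absurd (Finset.mem_Ico.mpr ⟨by omega, by omega⟩) hc
  · intro v h0 h1
    rw [huev]
    exact ⟨majority_nonneg h (hS01 v h0 h1).1 (hS01 v h0 h1).2,
      majority_le_one h (hS01 v h0 h1).1 (hS01 v h0 h1).2⟩
  · intro v h0 h1 h2
    rw [huev]
    have h78 : 7 / 8 ≤ S.eval v := by
      rcases h0.eq_or_lt with rfl | h0
      · rw [hS0]; norm_num
      · rw [hSev]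
        refine fejerPoly_eval_ge he1 (hx v h0 h1).1 (hx v h0 h1).2 ?_
        calc (e : ℝ) ^ 2 * (v / N') ≤ N' / (16 * m) * (m / N') := by gcongr
          _ = 1 / 16 := by field_simp
    refine (one_sub_majority_le_pow h (hS01 v h0 h1).1 (hS01 v h0 h1).2).trans ?_
    refine pow_le_pow_left₀ ?_ (by linarith) h
    linarith [(hS01 v h0 h1).2]
  · intro v h0 h1
    rw [huev]
    have h3 := hS01 v h0.le h1
    refine (majority_le_pow h h3.1 h3.2).trans (pow_le_pow_left₀ (by linarith [h3.1]) ?_ h)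
    have h4 : S.eval v ≤ 64 * m / v := by
      rw [hSev]
      refine (fejerPoly_eval_le_inv he1 (hx v h0 h1).1 (hx v h0 h1).2).trans ?_
      rw [div_le_div_iff₀ (by have := (hx v h0 h1).1; positivity) h0]
      rw [div_le_iff₀ (by positivity)] at hsq2
      have : 64 * m * ((e : ℝ) ^ 2 * (v / N')) = (4 * (e : ℝ) ^ 2 * (16 * m)) / N' * v := by
        ring
      rw [this]
      refine mul_le_mul_of_nonneg_right ?_ h0.le
      rwa [le_div_iff₀ hN'0, one_mul]
    calc 4 * S.eval v ≤ 4 * (64 * m / v) := by linarith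
      _ = _ := by ring
  · have hNN : (absPoly u).eval N ≤ (absPoly u).eval N' :=
      absPoly_eval_mono u hN (by rw [hN']; linarith)
    have hSa : (absPoly S).eval N' ≤ 7 ^ e := by
      rw [hS, absPoly_comp_C_mul_X _ (by positivity), eval_comp]
      have : eval N' (C (1 / N') * X : ℝ[X]) = 1 := by
        simp only [eval_mul, eval_C, eval_X]
        field_simp
      rw [this]
      exact absPoly_fejerPoly_le he1
    set a := (absPoly S).eval N' with ha
    have ha0 : 0 ≤ a := absPoly_eval_nonneg S hN'0.le
    have h1S : (absPoly (1 - S)).eval N' ≤ 1 + a := by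
      have := absPoly_eval_sub_le 1 S hN'0.le
      rwa [absPoly_one, eval_one] at this
    have h2 : (absPoly u).eval N' ≤ (a + (1 + a)) ^ (2 * h) := by
      refine (absPoly_eval_sum_le _ _ hN'0.le).trans ?_
      rw [add_pow]
      calc _ ≤ ∑ i ∈ Finset.Ico h (2 * h + 1), a ^ i * (1 + a) ^ (2 * h - i) *
            ((2 * h).choose i : ℝ) := by
            refine Finset.sum_le_sum fun i _ => ?_
            refine (absPoly_eval_mul_le _ _ hN'0.le).trans ?_
            rw [absPoly_C_mul, eval_mul, eval_C, Nat.abs_cast]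
            have h4 := absPoly_eval_pow_le S hN'0.le i
            have h5 := (absPoly_eval_pow_le (1 - S) hN'0.le (2 * h - i)).trans
              (pow_le_pow_left₀ (absPoly_eval_nonneg _ hN'0.le) h1S _)
            have h6 := absPoly_eval_nonneg ((1 - S) ^ (2 * h - i)) hN'0.le
            calc _ ≤ ((2 * h).choose i : ℝ) * a ^ i * (1 + a) ^ (2 * h - i) := by gcongr
              _ = _ := by ring
        _ ≤ _ := by
            refine Finset.sum_le_sum_of_subset_of_nonneg ?_ fun i _ _ => by positivity
            intro i hi
            exact Finset.mem_range.mpr (Finset.mem_Ico.mp hi).2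
    refine hNN.trans (h2.trans ?_)
    have h3 : a + (1 + a) ≤ 7 ^ (2 * e) := by
      have h4 : (7 : ℝ) ≤ 7 ^ e := by
        calc (7 : ℝ) = 7 ^ 1 := by norm_num
          _ ≤ 7 ^ e := pow_le_pow_right₀ (by norm_num) he1
      have h5 : (7 : ℝ) ^ (2 * e) = 7 ^ e * 7 ^ e := by rw [← pow_add]; congr 1; ring
      rw [h5]
      nlinarith
    calc (a + (1 + a)) ^ (2 * h) ≤ (7 ^ (2 * e)) ^ (2 * h) :=
          pow_le_pow_left₀ (by positivity) h3 _
      _ = _ := by rw [← pow_mul]; congr 1; ring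

theorem prod_Icc_one_eq_factorial (n : ℕ) : ∏ j ∈ Finset.Icc 1 n, j = n.factorial := by
  induction n with
  | zero => simp
  | succ n ih => rw [Finset.prod_Icc_succ_top (by omega), ih, Nat.factorial_succ, mul_comm]

/-- An approximant of the point mass at `0` on `{0, …, N}` with exact zeros at `1, …, D`. -/
theorem exists_nor_poly : ∃ C : ℝ, 1 ≤ C ∧ ∀ D N : ℕ, 1 ≤ D → D ≤ N →
    ∃ ν : ℝ[X], (ν.natDegree : ℝ) ≤ C * √((N : ℝ) * D) ∧ ν.eval 0 = 1 ∧
      (∀ v : ℕ, 1 ≤ v → v ≤ D → ν.eval (v : ℝ) = 0) ∧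
      (∀ v : ℕ, D < v → v ≤ N →
        |ν.eval (v : ℝ)| ≤ (1 / 1500) ^ D * ((D : ℝ) / v) ^ (3 * D)) ∧
      (absPoly ν).eval (N : ℝ) ≤ Real.exp (C * √((N : ℝ) * D)) := by
  refine ⟨1600, by norm_num, fun D N hD hDN => ?_⟩
  have hD0 : (0 : ℝ) < D := by exact_mod_cast hD
  have hDN' : (D : ℝ) ≤ N := by exact_mod_cast hDN
  obtain ⟨e, u, he, hdeg, hu0, hu01, -, hudec, huabs⟩ :=
    exists_threshold_poly (m := (D : ℝ) / 2048) (N := N) (by positivity) (by positivity) (4 * D)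
  set R := √((N : ℝ) * D) with hR
  have hDR : (D : ℝ) ≤ R := Real.le_sqrt_of_sq_le (by nlinarith)
  have hDe : (D : ℝ) * e ≤ 47 * R := by
    have h1 : √((N : ℝ) / (D / 2048)) * D = √2048 * R := by
      have : (N : ℝ) / (D / 2048) = 2048 * ((N * D) / D ^ 2) := by field_simp
      rw [this, Real.sqrt_mul (by norm_num), Real.sqrt_div (by positivity),
        Real.sqrt_sq hD0.le]
      field_simp
      exact hR.symm
    have h2 : √(2048 : ℝ) ≤ 46 := Real.sqrt_le_iff.mpr ⟨by norm_num, by norm_num⟩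
    have h3 : 0 ≤ R := Real.sqrt_nonneg _
    nlinarith [mul_le_mul_of_nonneg_right he hD0.le]
  set P : ℝ[X] := ∏ j ∈ Finset.Icc 1 D, (1 - C (1 / (j : ℝ)) * X) with hP
  have hPev : ∀ v : ℝ, P.eval v = ∏ j ∈ Finset.Icc 1 D, (1 - v / j) := by
    intro v
    rw [hP, eval_prod]
    refine Finset.prod_congr rfl fun j _ => ?_
    simp only [eval_sub, eval_one, eval_mul, eval_C, eval_X]
    ring
  have hPdeg : P.natDegree ≤ D := by
    refine (natDegree_prod_le _ _).trans ?_
    calc _ ≤ ∑ j ∈ Finset.Icc 1 D, 1 := Finset.sum_le_sum fun j _ =>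
          (natDegree_sub_le _ _).trans (by
            rw [natDegree_one, zero_max]
            exact (natDegree_C_mul_le _ _).trans natDegree_X_le)
      _ = D := by simp
  have hprod : ∀ x : ℝ, ∏ j ∈ Finset.Icc 1 D, (x / (j : ℝ)) = x ^ D / D.factorial := by
    intro x
    rw [Finset.prod_div_distrib, Finset.prod_const, Nat.card_Icc, Nat.add_sub_cancel,
      ← Nat.cast_prod, prod_Icc_one_eq_factorial]
  refine ⟨P * u, ?_, ?_, ?_, ?_, ?_⟩
  · have h1 : (P * u).natDegree ≤ D + 2 * (4 * D) * e :=
      natDegree_mul_le.trans (add_le_add hPdeg hdeg)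
    have h2 : ((P * u).natDegree : ℝ) ≤ D + 2 * (4 * D) * e := by exact_mod_cast h1
    nlinarith
  · rw [eval_mul, hu0, hPev]
    simp
  · intro v hv1 hvD
    rw [eval_mul, hPev, Finset.prod_eq_zero (i := v) (Finset.mem_Icc.mpr ⟨hv1, hvD⟩), zero_mul]
    have : (v : ℝ) ≠ 0 := by positivity
    rw [div_self this, sub_self]
  · intro v hvD hvN
    have hv0 : (0 : ℝ) < v := by exact_mod_cast (by omega : 0 < v)
    have hvN' : (v : ℝ) ≤ N := by exact_mod_cast hvN
    rw [eval_mul, abs_mul, abs_of_nonneg (hu01 v hv0.le hvN').1]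
    have h1 : |P.eval (v : ℝ)| ≤ (Real.exp 1 * v / D) ^ D := by
      rw [hPev, Finset.abs_prod]
      calc ∏ j ∈ Finset.Icc 1 D, |1 - (v : ℝ) / j| ≤ ∏ j ∈ Finset.Icc 1 D, ((v : ℝ) / j) := by
            refine Finset.prod_le_prod (fun j _ => abs_nonneg _) fun j hj => ?_
            have hj' := Finset.mem_Icc.mp hj
            have hj0 : (0 : ℝ) < j := by exact_mod_cast hj'.1
            have : 1 ≤ (v : ℝ) / j := by
              rw [le_div_iff₀ hj0, one_mul]
              exact_mod_cast (by omega : j ≤ v)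
            rw [abs_le]
            constructor <;> linarith
        _ = (v : ℝ) ^ D / D.factorial := hprod v
        _ = ((v : ℝ) / D) ^ D * ((D : ℝ) ^ D / D.factorial) := by
            rw [div_pow]; field_simp
        _ ≤ ((v : ℝ) / D) ^ D * Real.exp D := by
            gcongr
            exact Real.pow_div_factorial_le_exp (D : ℝ) hD0.le D
        _ = _ := by
            rw [← mul_one (D : ℝ), Real.exp_nat_mul, mul_one, ← mul_pow]
            congr 1
            ring
    have h2 := hudec v hv0 hvN'
    have h3 : (256 * ((D : ℝ) / 2048) / v) ^ (4 * D) = (1 / 4096) ^ D * (((D : ℝ) / v) ^ (4 * D)) := by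
      have : 256 * ((D : ℝ) / 2048) / v = 1 / 8 * (D / v) := by ring
      rw [this, mul_pow, pow_mul]
      norm_num
    rw [h3] at h2
    have hexp : Real.exp 1 ≤ 2.7182818286 := Real.exp_one_lt_d9.le
    calc |P.eval (v : ℝ)| * u.eval (v : ℝ)
        ≤ (Real.exp 1 * v / D) ^ D * ((1 / 4096) ^ D * (((D : ℝ) / v) ^ (4 * D))) := by
          gcongr
          exact (hu01 v hv0.le hvN').1
      _ = (Real.exp 1 / 4096) ^ D * ((D : ℝ) / v) ^ (3 * D) := by
          rw [show 4 * D = D + 3 * D by ring, pow_add, ← mul_assoc, ← mul_assoc, ← mul_pow,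
            ← mul_pow]
          congr 2
          field_simp
      _ ≤ _ := by
          refine mul_le_mul_of_nonneg_right (pow_le_pow_left₀ (by positivity) ?_ D) (by positivity)
          rw [div_le_div_iff₀ (by norm_num) (by norm_num)]
          linarith
  · have hN0 : (0 : ℝ) ≤ N := by positivity
    refine (absPoly_eval_mul_le P u hN0).trans ?_
    have h1 : (absPoly P).eval (N : ℝ) ≤ Real.exp (2 * R) := by
      refine (absPoly_eval_prod_le _ _ hN0).trans ?_
      calc _ ≤ ∏ j ∈ Finset.Icc 1 D, ((2 * N : ℝ) / (j : ℝ)) := by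
            refine Finset.prod_le_prod (fun j _ => absPoly_eval_nonneg _ hN0) fun j hj => ?_
            have hj' := Finset.mem_Icc.mp hj
            have hj0 : (0 : ℝ) < j := by exact_mod_cast hj'.1
            have := absPoly_eval_sub_le 1 (C (1 / (j : ℝ)) * X) hN0
            rw [absPoly_one, absPoly_C_mul, absPoly_X, eval_one, eval_mul, eval_C, eval_X,
              abs_of_nonneg (by positivity)] at this
            refine this.trans ?_
            rw [le_div_iff₀ hj0]
            have hjN : (j : ℝ) ≤ N := by exact_mod_cast (by omega : j ≤ N)
            have : (1 + 1 / (j : ℝ) * N) * j = j + N := by field_simp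
            linarith
        _ = (2 * N : ℝ) ^ D / D.factorial := hprod _
        _ ≤ (2 * R) ^ (2 * D) / (2 * D).factorial := by
            have h2 : ((2 * D).factorial : ℝ) ≤ D.factorial * (2 * D : ℝ) ^ D := by
              have h3 := Nat.factorial_mul_descFactorial (n := 2 * D) (k := D) (by omega)
              have h4 := Nat.descFactorial_le_pow (2 * D) D
              rw [show 2 * D - D = D by omega] at h3
              calc ((2 * D).factorial : ℝ) = D.factorial * ((2 * D).descFactorial D : ℝ) := by
                    exact_mod_cast h3.symm
                _ ≤ _ := by
                    gcongr
                    exact_mod_cast h4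
            have h5 : (2 * R) ^ (2 * D) = (2 * N : ℝ) ^ D * (2 * D : ℝ) ^ D := by
              rw [pow_mul, mul_pow, hR, Real.sq_sqrt (by positivity), ← mul_pow]
              congr 1
              ring
            rw [h5, div_le_div_iff₀ (by positivity) (by positivity)]
            calc (2 * N : ℝ) ^ D * (2 * D).factorial
                ≤ (2 * N : ℝ) ^ D * (D.factorial * (2 * D : ℝ) ^ D) := by gcongr
              _ = _ := by ring
        _ ≤ _ := Real.pow_div_factorial_le_exp _ (by positivity) _
    have h2 : (absPoly u).eval (N : ℝ) ≤ Real.exp (32 * (D * e)) := by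
      refine huabs.trans ?_
      have h7 : (7 : ℝ) ≤ Real.exp 2 := by
        have h8 : (2.7 : ℝ) ≤ Real.exp 1 := by
          have := Real.exp_one_gt_d9
          linarith
        have h9 : Real.exp 2 = Real.exp 1 * Real.exp 1 := by rw [← Real.exp_add]; norm_num
        rw [h9]
        nlinarith
      calc (7 : ℝ) ^ (4 * (4 * D) * e) ≤ (Real.exp 2) ^ (4 * (4 * D) * e) := by gcongr
        _ = Real.exp (32 * (D * e)) := by
            rw [← Real.exp_nat_mul]
            congr 1
            push_cast
            ring
    calc _ ≤ Real.exp (2 * R) * Real.exp (32 * (D * e)) := by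
          gcongr
          exact absPoly_eval_nonneg u hN0
      _ = Real.exp (2 * R + 32 * (D * e)) := (Real.exp_add _ _).symm
      _ ≤ _ := by
          apply Real.exp_le_exp.mpr
          have h3 : 0 ≤ R := Real.sqrt_nonneg _
          linarith

end Threshold

section DegreeSpaces

variable {ι : Type*} [DecidableEq ι]

/-- The multilinear monomial `∏_{i ∈ a} x_i` as a function of the set of ones. -/
def cubeMonomial (a : Finset ι) : Finset ι → ℝ := fun X => if a ⊆ X then 1 else 0

/-- Real functions of a Boolean vector, given by its set of ones, of degree at most `d`. -/
def degLE (ι : Type*) [DecidableEq ι] (d : ℕ) : Submodule ℝ (Finset ι → ℝ) :=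
  Submodule.span ℝ {f | ∃ a : Finset ι, a.card ≤ d ∧ f = cubeMonomial a}

theorem cubeMonomial_mem {a : Finset ι} {d : ℕ} (h : a.card ≤ d) : cubeMonomial a ∈ degLE ι d :=
  Submodule.subset_span ⟨a, h, rfl⟩

theorem degLE_mono {d e : ℕ} (h : d ≤ e) : degLE ι d ≤ degLE ι e :=
  Submodule.span_mono fun _ ⟨a, ha, hf⟩ => ⟨a, ha.trans h, hf⟩

theorem cubeMonomial_empty : cubeMonomial (∅ : Finset ι) = 1 := by
  funext X
  simp [cubeMonomial]

theorem one_mem_degLE (d : ℕ) : (1 : Finset ι → ℝ) ∈ degLE ι d := by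
  rw [← cubeMonomial_empty]
  exact cubeMonomial_mem (by simp)

theorem const_mem_degLE (c : ℝ) (d : ℕ) : (fun _ => c : Finset ι → ℝ) ∈ degLE ι d := by
  have := (degLE ι d).smul_mem c (one_mem_degLE d)
  convert this using 1
  funext X
  simp

theorem mul_mem_degLE {d e : ℕ} {f g : Finset ι → ℝ} (hf : f ∈ degLE ι d) (hg : g ∈ degLE ι e) :
    f * g ∈ degLE ι (d + e) := by
  unfold degLE at hf
  induction hf using Submodule.span_induction with
  | mem f hf =>
    obtain ⟨a, ha, rfl⟩ := hf
    unfold degLE at hg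
    induction hg using Submodule.span_induction with
    | mem g hg =>
      obtain ⟨b, hb, rfl⟩ := hg
      have : cubeMonomial a * cubeMonomial b = cubeMonomial (a ∪ b) := by
        funext X
        simp only [cubeMonomial, Pi.mul_apply, Finset.union_subset_iff, ite_and]
        split_ifs <;> simp
      rw [this]
      exact cubeMonomial_mem ((Finset.card_union_le _ _).trans (add_le_add ha hb))
    | zero => rw [mul_zero]; exact Submodule.zero_mem _
    | add g g' _ _ h h' => rw [mul_add]; exact Submodule.add_mem _ h h'
    | smul c g _ h => rw [mul_smul_comm]; exact Submodule.smul_mem _ c h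
  | zero => rw [zero_mul]; exact Submodule.zero_mem _
  | add f f' _ _ h h' => rw [add_mul]; exact Submodule.add_mem _ h h'
  | smul c f _ h => rw [smul_mul_assoc]; exact Submodule.smul_mem _ c h

theorem pow_mem_degLE {d : ℕ} {f : Finset ι → ℝ} (hf : f ∈ degLE ι d) (n : ℕ) :
    f ^ n ∈ degLE ι (n * d) := by
  induction n with
  | zero => rw [pow_zero]; exact one_mem_degLE _
  | succ n ih =>
    rw [pow_succ, add_mul, one_mul]
    exact mul_mem_degLE ih hf

theorem comp_filter_mem_degLE {d : ℕ} {f : Finset ι → ℝ} (hf : f ∈ degLE ι d) (p : ι → Prop)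
    [DecidablePred p] : (fun X => f (X.filter p)) ∈ degLE ι d := by
  unfold degLE at hf
  induction hf using Submodule.span_induction with
  | mem f hf =>
    obtain ⟨a, ha, rfl⟩ := hf
    by_cases h : ∀ i ∈ a, p i
    · convert cubeMonomial_mem ha using 1
      funext X
      have : a ⊆ X.filter p ↔ a ⊆ X :=
        ⟨fun h' => h'.trans (Finset.filter_subset _ _),
          fun h' i hi => Finset.mem_filter.mpr ⟨h' hi, h i hi⟩⟩
      simp only [cubeMonomial, this]
    · convert (degLE ι d).zero_mem using 1
      funext X
      have : ¬ a ⊆ X.filter p := fun h' => h fun i hi => (Finset.mem_filter.mp (h' hi)).2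
      simp only [cubeMonomial, this, if_false, Pi.zero_apply]
  | zero => exact Submodule.zero_mem _
  | add f f' _ _ h h' => exact Submodule.add_mem _ h h'
  | smul c f _ h => exact Submodule.smul_mem _ c h

theorem card_mem_degLE [Fintype ι] : (fun X : Finset ι => (X.card : ℝ)) ∈ degLE ι 1 := by
  have h : (fun X : Finset ι => (X.card : ℝ)) = ∑ i : ι, cubeMonomial {i} := by
    funext X
    rw [Finset.sum_apply]
    simp [cubeMonomial]
  rw [h]
  exact Submodule.sum_mem _ fun i _ => cubeMonomial_mem (by simp)

theorem card_filter_mem_degLE [Fintype ι] (p : ι → Prop) [DecidablePred p] :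
    (fun X : Finset ι => ((X.filter p).card : ℝ)) ∈ degLE ι 1 :=
  comp_filter_mem_degLE card_mem_degLE p

theorem eval_mem_degLE {f : Finset ι → ℝ} (hf : f ∈ degLE ι 1) (q : Polynomial ℝ) :
    (fun X => q.eval (f X)) ∈ degLE ι q.natDegree := by
  have h : (fun X => q.eval (f X)) =
      ∑ i ∈ Finset.range (q.natDegree + 1), q.coeff i • f ^ i := by
    funext X
    rw [Finset.sum_apply, Polynomial.eval_eq_sum_range]
    simp
  rw [h]
  refine Submodule.sum_mem _ fun i hi => Submodule.smul_mem _ _ ?_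
  have := pow_mem_degLE hf i
  rw [mul_one] at this
  exact degLE_mono (by have := Finset.mem_range.mp hi; omega) this

/-- Every function agrees with one of degree at most `D` on the sets with at most `D` elements. -/
theorem exists_interpolant [Fintype ι] (F : Finset ι → ℝ) (D : ℕ) :
    ∃ f ∈ degLE ι D, ∀ X : Finset ι, X.card ≤ D → f X = F X := by
  induction D with
  | zero =>
    refine ⟨fun _ => F ∅, const_mem_degLE _ _, fun X hX => ?_⟩
    rw [Finset.card_eq_zero.mp (Nat.le_zero.mp hX)]
  | succ D ih =>
    obtain ⟨f, hf, hfF⟩ := ih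
    refine ⟨f + ∑ a ∈ Finset.univ.filter (fun a : Finset ι => a.card = D + 1),
      (F a - f a) • cubeMonomial a, ?_, fun X hX => ?_⟩
    · refine Submodule.add_mem _ (degLE_mono (by omega) hf) (Submodule.sum_mem _ fun a ha => ?_)
      exact Submodule.smul_mem _ _ (cubeMonomial_mem (Finset.mem_filter.mp ha).2.le)
    · rw [Pi.add_apply, Finset.sum_apply]
      simp only [Pi.smul_apply, smul_eq_mul]
      rcases Nat.lt_or_ge X.card (D + 1) with h | h
      · rw [hfF X (by omega), Finset.sum_eq_zero, add_zero]
        intro a ha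
        have hc := (Finset.mem_filter.mp ha).2
        have : ¬ a ⊆ X := fun h' => by have := Finset.card_le_card h'; omega
        simp [cubeMonomial, this]
      · rw [Finset.sum_eq_single X]
        · simp [cubeMonomial]
        · intro a ha hne
          have hc := (Finset.mem_filter.mp ha).2
          have : ¬ a ⊆ X := fun h' => hne (Finset.eq_of_subset_of_card_le h' (by omega))
          simp [cubeMonomial, this]
        · intro h'
          exact absurd (Finset.mem_filter.mpr ⟨Finset.mem_univ _, by omega⟩) h'

theorem card_filter_subset_powersetCard {a Y : Finset ι} (haY : a ⊆ Y) {i : ℕ} (hi : a.card ≤ i) :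
    ((Y.powersetCard i).filter (a ⊆ ·)).card = (Y.card - a.card).choose (i - a.card) := by
  rw [← Finset.card_sdiff_of_subset haY, ← Finset.card_powersetCard]
  refine Finset.card_nbij' (· \ a) (· ∪ a) ?_ ?_ ?_ ?_
  · intro Z hZ
    simp only [Finset.coe_filter, Finset.mem_powersetCard, Set.mem_ofPred_eq] at hZ
    simp only [Finset.mem_coe, Finset.mem_powersetCard]
    exact ⟨Finset.sdiff_subset_sdiff hZ.1.1 le_rfl, by
      rw [Finset.card_sdiff_of_subset hZ.2, hZ.1.2]⟩
  · intro Z hZ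
    simp only [Finset.mem_coe, Finset.mem_powersetCard] at hZ
    simp only [Finset.coe_filter, Finset.mem_powersetCard, Set.mem_ofPred_eq]
    have hd : Disjoint Z a := (Finset.sdiff_disjoint).mono_left hZ.1
    refine ⟨⟨Finset.union_subset (hZ.1.trans Finset.sdiff_subset) haY, ?_⟩,
      Finset.subset_union_right⟩
    rw [Finset.card_union_of_disjoint hd, hZ.2]
    omega
  · intro Z hZ
    simp only [Finset.coe_filter, Finset.mem_powersetCard, Set.mem_ofPred_eq] at hZ
    exact Finset.sdiff_union_of_subset hZ.2
  · intro Z hZ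
    simp only [Finset.mem_coe, Finset.mem_powersetCard] at hZ
    have hd : Disjoint Z a := (Finset.sdiff_disjoint).mono_left hZ.1
    exact Finset.union_sdiff_cancel_right hd

open Polynomial in
/-- Averages of a function of degree at most `D` over the `i`-subsets of a fixed set are given by
a univariate polynomial in `i` of degree at most `D`. -/
theorem exists_symmetrization {D : ℕ} {f : Finset ι → ℝ} (hf : f ∈ degLE ι D) (Y : Finset ι) :
    ∃ φ : ℝ[X], φ.natDegree ≤ D ∧ ∀ i ≤ Y.card,
      ∑ Z ∈ Y.powersetCard i, f Z = (Y.card.choose i : ℝ) * φ.eval (i : ℝ) := by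
  unfold degLE at hf
  induction hf using Submodule.span_induction with
  | mem f hf =>
    obtain ⟨a, ha, rfl⟩ := hf
    by_cases haY : a ⊆ Y
    · have hav := Finset.card_le_card haY
      refine ⟨C (1 / ((a.card.factorial : ℝ) * Y.card.choose a.card)) * descPochhammer ℝ a.card,
        (natDegree_C_mul_le _ _).trans (by rw [descPochhammer_natDegree]; exact ha),
        fun i hi => ?_⟩
      have h1 : ∑ Z ∈ Y.powersetCard i, cubeMonomial a Z =
          (((Y.powersetCard i).filter (a ⊆ ·)).card : ℝ) := by
        simp [cubeMonomial, Finset.sum_boole]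
      rw [h1, eval_mul, eval_C, descPochhammer_eval_eq_descFactorial,
        Nat.descFactorial_eq_factorial_mul_choose]
      have hc0 : (0 : ℝ) < Y.card.choose a.card := by exact_mod_cast Nat.choose_pos hav
      have hf0 : (0 : ℝ) < a.card.factorial := by exact_mod_cast Nat.factorial_pos _
      rcases Nat.lt_or_ge i a.card with hia | hia
      · rw [Nat.choose_eq_zero_of_lt hia]
        have : (Y.powersetCard i).filter (a ⊆ ·) = ∅ := by
          refine Finset.filter_eq_empty_iff.mpr fun Z hZ h => ?_
          have := Finset.card_le_card h
          have := (Finset.mem_powersetCard.mp hZ).2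
          omega
        rw [this]
        simp
      · rw [card_filter_subset_powersetCard haY hia]
        have := Nat.choose_mul (n := Y.card) hia
        have h2 : (Y.card.choose i : ℝ) * i.choose a.card =
            Y.card.choose a.card * (Y.card - a.card).choose (i - a.card) := by
          exact_mod_cast this
        push_cast
        field_simp
        linarith
    · refine ⟨0, by simp, fun i _ => ?_⟩
      rw [eval_zero, mul_zero]
      refine Finset.sum_eq_zero fun Z hZ => ?_
      have : ¬ a ⊆ Z := fun h => haY (h.trans (Finset.mem_powersetCard.mp hZ).1)
      simp [cubeMonomial, this]
  | zero => exact ⟨0, by simp, fun i _ => by simp⟩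
  | add f g _ _ h h' =>
    obtain ⟨φ, hφ, h⟩ := h
    obtain ⟨ψ, hψ, h'⟩ := h'
    refine ⟨φ + ψ, natDegree_add_le_of_degree_le hφ hψ, fun i hi => ?_⟩
    simp only [Pi.add_apply, Finset.sum_add_distrib, h i hi, h' i hi, eval_add, mul_add]
  | smul c f _ h =>
    obtain ⟨φ, hφ, h⟩ := h
    refine ⟨C c * φ, (natDegree_C_mul_le _ _).trans hφ, fun i hi => ?_⟩
    simp only [Pi.smul_apply, smul_eq_mul, ← Finset.mul_sum, h i hi, eval_mul, eval_C]
    ring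

theorem prod_erase_abs_sub {D i : ℕ} (hi : i ≤ D) :
    ∏ j ∈ (Finset.range (D + 1)).erase i, |(i : ℝ) - j| = i.factorial * (D - i).factorial := by
  have hs : (Finset.range (D + 1)).erase i = Finset.range i ∪ Finset.Ico (i + 1) (D + 1) := by
    ext j
    simp only [Finset.mem_erase, Finset.mem_range, Finset.mem_union, Finset.mem_Ico]
    omega
  have hd : Disjoint (Finset.range i) (Finset.Ico (i + 1) (D + 1)) := by
    rw [Finset.disjoint_left]
    intro j hj hj'
    simp only [Finset.mem_range, Finset.mem_Ico] at hj hj'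
    omega
  rw [hs, Finset.prod_union hd]
  congr 1
  · rw [← Finset.prod_range_reflect, ← Finset.prod_range_add_one_eq_factorial, Nat.cast_prod]
    refine Finset.prod_congr rfl fun j hj => ?_
    have hj' := Finset.mem_range.mp hj
    have : ((i - 1 - j : ℕ) : ℝ) = (i : ℝ) - 1 - j := by
      rw [Nat.cast_sub (by omega), Nat.cast_sub (by omega)]
      simp
    rw [this, abs_of_nonneg] <;> push_cast <;> linarith [Nat.cast_nonneg (α := ℝ) j]
  · rw [Finset.prod_Ico_eq_prod_range, show D + 1 - (i + 1) = D - i by omega,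
      ← Finset.prod_range_add_one_eq_factorial, Nat.cast_prod]
    refine Finset.prod_congr rfl fun j _ => ?_
    have h0 := Nat.cast_nonneg (α := ℝ) j
    rw [abs_of_nonpos] <;> push_cast <;> linarith

open Polynomial in
/-- Extrapolation of a univariate polynomial bounded at equally spaced nodes. -/
theorem abs_eval_le_of_equispaced {D : ℕ} (hD : 1 ≤ D) {q : ℝ[X]} (hq : q.natDegree ≤ D)
    {h M v : ℝ} (hh : 0 < h) (hM : ∀ i ≤ D, |q.eval (i * h)| ≤ M) (hv : D * h ≤ v) :
    |q.eval v| ≤ M * (2 * Real.exp 1 * v / (D * h)) ^ D := by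
  have hD0 : (0 : ℝ) < D := by exact_mod_cast hD
  have hv0 : 0 < v := lt_of_lt_of_le (by positivity) hv
  have hM0 : 0 ≤ M := (abs_nonneg _).trans (hM 0 (Nat.zero_le _))
  have hinj : Set.InjOn (fun i : ℕ => (i : ℝ) * h) (Finset.range (D + 1) : Finset ℕ) := by
    intro a _ b _ hab
    have := mul_right_cancel₀ hh.ne' hab
    exact_mod_cast this
  have hdeg : q.degree < (Finset.range (D + 1)).card := by
    rw [Finset.card_range]
    exact (degree_le_natDegree).trans_lt (by exact_mod_cast Nat.lt_succ_of_le hq)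
  have hint := Lagrange.eq_interpolate hinj hdeg
  have hev := congrArg (eval v) hint
  rw [Lagrange.interpolate_apply, eval_finsetSum] at hev
  rw [hev]
  refine (Finset.abs_sum_le_sum_abs _ _).trans ?_
  have hb : ∀ i ∈ Finset.range (D + 1),
      |(Lagrange.basis (Finset.range (D + 1)) (fun i : ℕ => (i : ℝ) * h) i).eval v| ≤
        (v / h) ^ D / (i.factorial * (D - i).factorial) := by
    intro i hi
    have hi' : i ≤ D := by have := Finset.mem_range.mp hi; omega
    rw [Lagrange.basis, eval_prod, Finset.abs_prod, ← prod_erase_abs_sub hi']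
    have hcard : ((Finset.range (D + 1)).erase i).card = D := by
      rw [Finset.card_erase_of_mem hi, Finset.card_range, Nat.add_sub_cancel]
    have hc : (v / h) ^ D = ∏ _j ∈ (Finset.range (D + 1)).erase i, (v / h) := by
      rw [Finset.prod_const, hcard]
    rw [hc, ← Finset.prod_div_distrib]
    refine Finset.prod_le_prod (fun _ _ => abs_nonneg _) fun j hj => ?_
    have hj' := Finset.mem_erase.mp hj
    have hjD : (j : ℝ) ≤ D := by
      have := Finset.mem_range.mp hj'.2
      exact_mod_cast (by omega : j ≤ D)
    have hne : (i : ℝ) - j ≠ 0 := by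
      rw [sub_ne_zero]
      exact_mod_cast hj'.1.symm
    simp only [Lagrange.basisDivisor, eval_mul, eval_C, eval_sub, eval_X]
    rw [abs_mul, abs_inv, ← sub_mul, abs_mul, abs_of_pos hh, mul_inv, div_div, mul_comm h,
      ← mul_inv, inv_mul_eq_div]
    refine div_le_div_of_nonneg_right ?_ (by positivity)
    have h1 : (j : ℝ) * h ≤ v := le_trans (by gcongr) hv
    rw [abs_of_nonneg (by linarith)]
    have : 0 ≤ (j : ℝ) * h := by positivity
    linarith
  calc _ ≤ ∑ i ∈ Finset.range (D + 1), M * ((v / h) ^ D / (i.factorial * (D - i).factorial)) := by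
        refine Finset.sum_le_sum fun i hi => ?_
        rw [eval_mul, eval_C, abs_mul]
        have hi' : i ≤ D := by have := Finset.mem_range.mp hi; omega
        exact mul_le_mul (hM i hi') (hb i hi) (abs_nonneg _) hM0
    _ = M * ((v / h) ^ D * (2 ^ D / D.factorial)) := by
        rw [← Finset.mul_sum]
        congr 1
        have : ∀ i ∈ Finset.range (D + 1), (v / h) ^ D / (i.factorial * (D - i).factorial) =
            (v / h) ^ D * ((D.choose i : ℝ) / D.factorial) := by
          intro i hi
          have hi' : i ≤ D := by have := Finset.mem_range.mp hi; omega
          rw [Nat.cast_choose ℝ hi']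
          field_simp
        rw [Finset.sum_congr rfl this, ← Finset.mul_sum, ← Finset.sum_div]
        congr 2
        exact_mod_cast Nat.sum_range_choose D
    _ ≤ _ := by
        gcongr
        have h1 := Real.pow_div_factorial_le_exp (D : ℝ) hD0.le D
        have h2 : Real.exp (D : ℝ) = Real.exp 1 ^ D := by rw [← Real.exp_nat_mul, mul_one]
        rw [h2] at h1
        have h3 : (2 * Real.exp 1 * v / (D * h)) ^ D =
            (v / h) ^ D * (2 ^ D * (Real.exp 1 ^ D / (D : ℝ) ^ D)) := by
          rw [← div_pow, ← mul_pow, ← mul_pow]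
          congr 1
          field_simp
        rw [h3]
        have h4 : (1 : ℝ) / D.factorial ≤ Real.exp 1 ^ D / (D : ℝ) ^ D := by
          rw [le_div_iff₀ (by positivity)]
          calc 1 / (D.factorial : ℝ) * (D : ℝ) ^ D = (D : ℝ) ^ D / D.factorial := by ring
            _ ≤ _ := h1
        have h5 : (2 : ℝ) ^ D / D.factorial = 2 ^ D * (1 / D.factorial) := by ring
        rw [h5]
        gcongr

/-- A function of degree at most `D ≤ m` that is bounded on the small subsets of `Y` grows slowly. -/
theorem abs_le_of_bounded_on_small {D m : ℕ} (hm : 1 ≤ m) (hDm : D ≤ m) {f : Finset ι → ℝ}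
    (hf : f ∈ degLE ι D) {Y : Finset ι} (hY : m ≤ Y.card) {M : ℝ}
    (hM : ∀ Z ⊆ Y, Z.card ≤ m → |f Z| ≤ M) : |f Y| ≤ M * (11 * Y.card / m) ^ D := by
  obtain ⟨φ, hφ, hav⟩ := exists_symmetrization hf Y
  have hYφ : f Y = φ.eval (Y.card : ℝ) := by
    have := hav Y.card le_rfl
    rwa [Finset.powersetCard_self, Finset.sum_singleton, Nat.choose_self, Nat.cast_one,
      one_mul] at this
  have hφM : ∀ i ≤ m, |φ.eval (i : ℝ)| ≤ M := by
    intro i hi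
    have hc : (0 : ℝ) < Y.card.choose i := by exact_mod_cast Nat.choose_pos (hi.trans hY)
    have h1 := hav i (hi.trans hY)
    have h2 : |∑ Z ∈ Y.powersetCard i, f Z| ≤ (Y.card.choose i : ℝ) * M := by
      refine (Finset.abs_sum_le_sum_abs _ _).trans ?_
      have := Finset.sum_le_card_nsmul (Y.powersetCard i) (fun Z => |f Z|) M fun Z hZ => by
        have hZ' := Finset.mem_powersetCard.mp hZ
        exact hM Z hZ'.1 (by omega)
      rwa [Finset.card_powersetCard, nsmul_eq_mul] at this
    rw [h1, abs_mul, abs_of_pos hc] at h2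
    exact le_of_mul_le_mul_left h2 hc
  rw [hYφ]
  rcases Nat.eq_zero_or_pos D with rfl | hD
  · rw [Polynomial.eq_C_of_natDegree_le_zero hφ, Polynomial.eval_C, pow_zero, mul_one]
    have := hφM 0 (Nat.zero_le _)
    rwa [Polynomial.eq_C_of_natDegree_le_zero hφ, Polynomial.eval_C] at this
  · have hD0 : (0 : ℝ) < D := by exact_mod_cast hD
    have hm0 : (0 : ℝ) < m := by exact_mod_cast hm
    set h := m / D with hh
    have hh1 : 1 ≤ h := (Nat.one_le_div_iff hD).mpr hDm
    have hDh : D * h ≤ m := Nat.mul_div_le m D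
    have hDh2 : m ≤ 2 * (D * h) := by
      have h1 := Nat.lt_mul_div_succ m hD
      rw [← hh] at h1
      nlinarith
    have hM0 : 0 ≤ M := (abs_nonneg _).trans (hφM 0 (Nat.zero_le _))
    have hYc : (0 : ℝ) < Y.card := lt_of_lt_of_le hm0 (by exact_mod_cast hY)
    have key := abs_eval_le_of_equispaced hD hφ (h := (h : ℝ)) (M := M) (v := (Y.card : ℝ))
      (by exact_mod_cast hh1) (fun i hi => by
        have : i * h ≤ m := (Nat.mul_le_mul_right h hi).trans hDh
        exact_mod_cast hφM (i * h) this) (by exact_mod_cast hDh.trans hY)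
    refine key.trans (mul_le_mul_of_nonneg_left (pow_le_pow_left₀ (by positivity) ?_ D) hM0)
    have h0 : (0 : ℝ) < D * h := by
      have : (0 : ℝ) < h := by exact_mod_cast hh1
      positivity
    have h2 : (m : ℝ) ≤ 2 * (D * h) := by exact_mod_cast hDh2
    rw [div_le_div_iff₀ h0 hm0]
    have he := Real.exp_one_lt_d9
    calc 2 * Real.exp 1 * Y.card * m ≤ 2 * 2.75 * Y.card * (2 * (D * h)) := by
          gcongr
          linarith
      _ = _ := by ring

/-- Extension from small sets to larger ones, at a cost proportional to the square root of the
ratio of the sizes. -/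
theorem exists_extension [Fintype ι] {m D : ℕ} (hm : 1 ≤ m) (hD : D ≤ 4096 * m)
    {f : Finset ι → ℝ} (hf : f ∈ degLE ι D) (N h : ℕ) :
    ∃ (e : ℕ) (g : Finset ι → ℝ), (e : ℝ) ≤ 3 * (D + h) * (1 + √((N : ℝ) / m)) ∧ g ∈ degLE ι e ∧
      (∀ Y : Finset ι, Y.card ≤ N → Y.card ≤ m → |g Y - f Y| ≤ (1 / 2) ^ h * |f Y|) ∧
      (∀ Y : Finset ι, Y.card ≤ N → Y.card ≤ 4096 * m → |g Y| ≤ |f Y|) ∧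
      (∀ Y : Finset ι, Y.card ≤ N → 4096 * m < Y.card → ∀ M : ℝ,
        (∀ Z ⊆ Y, Z.card ≤ 4096 * m → |f Z| ≤ M) → |g Y| ≤ (1 / 2) ^ h * M) := by
  have hm0 : (0 : ℝ) < m := by exact_mod_cast hm
  obtain ⟨e, u, he, hdeg, -, hu01, hu1, hudec, -⟩ :=
    exists_threshold_poly (m := (m : ℝ)) (N := N) hm0 (by positivity) (D + h)
  refine ⟨D + 2 * (D + h) * e, fun Y => f Y * u.eval (Y.card : ℝ), ?_, ?_, ?_, ?_, ?_⟩
  · push_cast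
    have h1 : (0 : ℝ) ≤ √((N : ℝ) / m) := Real.sqrt_nonneg _
    have h2 : (0 : ℝ) ≤ D := by positivity
    have h3 : (0 : ℝ) ≤ h := by positivity
    have h4 : 2 * ((D : ℝ) + h) * e ≤ 2 * (D + h) * (1 + √((N : ℝ) / m)) := by gcongr
    nlinarith
  · refine mul_mem_degLE hf ?_
    exact degLE_mono hdeg (eval_mem_degLE card_mem_degLE u)
  · intro Y hYN hYm
    have hY1 : (Y.card : ℝ) ≤ N := by exact_mod_cast hYN
    have hY2 : (Y.card : ℝ) ≤ m := by exact_mod_cast hYm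
    have h1 := hu1 Y.card (by positivity) hY1 hY2
    have h2 := (hu01 Y.card (by positivity) hY1).2
    have h3 : f Y * u.eval (Y.card : ℝ) - f Y = -(f Y * (1 - u.eval (Y.card : ℝ))) := by ring
    rw [h3, abs_neg, abs_mul, abs_of_nonneg (by linarith : 0 ≤ 1 - u.eval (Y.card : ℝ)), mul_comm]
    refine mul_le_mul_of_nonneg_right (h1.trans ?_) (abs_nonneg _)
    exact pow_le_pow_of_le_one (by norm_num) (by norm_num) (by omega)
  · intro Y hYN _
    have hY1 : (Y.card : ℝ) ≤ N := by exact_mod_cast hYN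
    have h2 := hu01 Y.card (by positivity) hY1
    rw [abs_mul, abs_of_nonneg h2.1]
    exact mul_le_of_le_one_right (abs_nonneg _) h2.2
  · intro Y hYN hYm M hM
    have hY1 : (Y.card : ℝ) ≤ N := by exact_mod_cast hYN
    have hY2 : 4096 * (m : ℝ) < Y.card := by exact_mod_cast hYm
    have hY0 : (0 : ℝ) < Y.card := by linarith
    have hM0 : 0 ≤ M := (abs_nonneg _).trans (hM ∅ (by simp) (by simp))
    have h1 := abs_le_of_bounded_on_small (m := 4096 * m) (by omega) hD hf hYm.le hM
    have h2 := hudec Y.card hY0 hY1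
    have h3 := hu01 Y.card hY0.le hY1
    rw [abs_mul, abs_of_nonneg h3.1]
    push_cast at h1
    calc |f Y| * u.eval (Y.card : ℝ)
        ≤ M * (11 * Y.card / (4096 * m)) ^ D * (256 * m / Y.card) ^ (D + h) := by
          gcongr
          exact h3.1
      _ = M * (11 * 256 / 4096) ^ D * (256 * m / Y.card) ^ h := by
          rw [pow_add, ← mul_assoc, mul_assoc M, ← mul_pow]
          congr 3
          field_simp
      _ ≤ M * 1 * (1 / 2) ^ h := by
          have ha : (256 * (m : ℝ) / Y.card) ^ h ≤ (1 / 2) ^ h := by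
            refine pow_le_pow_left₀ (by positivity) ?_ h
            rw [div_le_div_iff₀ hY0 (by norm_num)]
            linarith
          have hb : (11 * 256 / 4096 : ℝ) ^ D ≤ 1 := pow_le_one₀ (by norm_num) (by norm_num)
          gcongr
      _ = _ := by ring

end DegreeSpaces

section Sampling

variable {ι : Type*}

/-- The probability of the subset `a` of `X` when elements are kept independently with
probability `δ`. -/
noncomputable def keepWeight (δ : ℝ) (X a : Finset ι) : ℝ :=
  δ ^ a.card * (1 - δ) ^ (X.card - a.card)

theorem keepWeight_nonneg {δ : ℝ} (h0 : 0 ≤ δ) (h1 : δ ≤ 1) (X a : Finset ι) :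
    0 ≤ keepWeight δ X a :=
  mul_nonneg (pow_nonneg h0 _) (pow_nonneg (by linarith) _)

theorem sum_keepWeight (δ : ℝ) (X : Finset ι) : ∑ a ∈ X.powerset, keepWeight δ X a = 1 := by
  have := Finset.sum_pow_mul_eq_add_pow δ (1 - δ) X
  rw [add_sub_cancel, one_pow] at this
  exact this

theorem sum_keepWeight_half_pow_single {δ : ℝ} (h0 : 0 ≤ δ) (h1 : δ ≤ 1 / 2) {K : ℕ}
    {A : Finset ι} (hA : A.card = K + 1) :
    ∑ b ∈ A.powerset, keepWeight δ A b * (if b.card = 1 then 1 / 2 else 1) ≤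
      Real.exp (-(δ / 2 ^ (K + 1))) := by
  have hsum := sum_keepWeight δ A
  have h2 : ∑ b ∈ A.powerset, keepWeight δ A b * (if b.card = 1 then 1 / 2 else 1) =
      1 - 1 / 2 * ∑ b ∈ A.powerset, (if b.card = 1 then keepWeight δ A b else 0) := by
    have h4 : ∑ b ∈ A.powerset, keepWeight δ A b * (if b.card = 1 then 1 / 2 else 1) =
        ∑ b ∈ A.powerset, keepWeight δ A b -
          1 / 2 * ∑ b ∈ A.powerset, (if b.card = 1 then keepWeight δ A b else 0) := by
      rw [Finset.mul_sum, ← Finset.sum_sub_distrib]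
      refine Finset.sum_congr rfl fun b _ => ?_
      split_ifs
      · ring
      · rw [mul_one, mul_zero, sub_zero]
    rw [h4, hsum]
  have h3 : δ / 2 ^ K ≤ ∑ b ∈ A.powerset, (if b.card = 1 then keepWeight δ A b else 0) := by
    have hne : A.Nonempty := Finset.card_pos.mp (by omega)
    obtain ⟨x, hx⟩ := hne
    have h4 : (if ({x} : Finset ι).card = 1 then keepWeight δ A {x} else 0) ≤
        ∑ b ∈ A.powerset, (if b.card = 1 then keepWeight δ A b else 0) := by
      refine Finset.single_le_sum (f := fun b : Finset ι =>
        if b.card = 1 then keepWeight δ A b else 0) (fun b _ => ?_)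
        (Finset.mem_powerset.mpr (Finset.singleton_subset_iff.mpr hx))
      split_ifs
      · exact keepWeight_nonneg h0 (by linarith) _ _
      · exact le_rfl
    refine le_trans ?_ h4
    rw [if_pos (Finset.card_singleton x), keepWeight, Finset.card_singleton, hA,
      Nat.add_sub_cancel, pow_one, div_eq_mul_inv, ← inv_pow]
    gcongr
    rw [inv_eq_one_div]
    linarith
  rw [h2]
  have h5 := Real.add_one_le_exp (-(δ / 2 ^ (K + 1)))
  have h6 : δ / 2 ^ (K + 1) = 1 / 2 * (δ / 2 ^ K) := by rw [pow_succ]; ring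
  linarith

variable [DecidableEq ι]

/-- The weight of a subset with `j` elements of a set with `x` elements, when a Bernoulli sample
of `n` slots is truncated to at most `s` slots. -/
noncomputable def slotWeight (n s : ℕ) (δ : ℝ) (x j : ℕ) : ℝ :=
  ∑ i ∈ Finset.Ico j (s + 1), δ ^ i * (1 - δ) ^ (n - i) * ((n - x).choose (i - j) : ℝ)

noncomputable def slotTotal (n s : ℕ) (δ : ℝ) : ℝ :=
  ∑ i ∈ Finset.range (s + 1), δ ^ i * (1 - δ) ^ (n - i) * (n.choose i : ℝ)

theorem slotWeight_nonneg {δ : ℝ} (h0 : 0 ≤ δ) (h1 : δ ≤ 1) (n s x j : ℕ) :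
    0 ≤ slotWeight n s δ x j :=
  Finset.sum_nonneg fun i _ => by
    have : 0 ≤ 1 - δ := by linarith
    positivity

theorem sum_choose_mul_choose_filter {n x : ℕ} (hx : x ≤ n) (i : ℕ) :
    ∑ j ∈ (Finset.range (x + 1)).filter (· ≤ i), (x.choose j : ℝ) * ((n - x).choose (i - j) : ℝ) =
      n.choose i := by
  have h1 := Nat.add_choose_eq x (n - x) i
  rw [Nat.add_sub_cancel' hx, Finset.Nat.sum_antidiagonal_eq_sum_range_succ_mk] at h1
  have h2 : (n.choose i : ℝ) =
      ∑ j ∈ Finset.range i.succ, (x.choose j : ℝ) * ((n - x).choose (i - j) : ℝ) := by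
    exact_mod_cast h1
  rw [h2]
  refine Finset.sum_subset ?_ ?_
  · intro j hj
    have := (Finset.mem_filter.mp hj).2
    exact Finset.mem_range.mpr (by omega)
  · intro j hj hj'
    have h3 := Finset.mem_range.mp hj
    have h4 : x < j := by
      by_contra h
      exact hj' (Finset.mem_filter.mpr ⟨Finset.mem_range.mpr (by omega), by omega⟩)
    rw [Nat.choose_eq_zero_of_lt h4]
    simp

theorem sum_slotWeight {n x : ℕ} (hx : x ≤ n) (s : ℕ) (δ : ℝ) :
    ∑ j ∈ Finset.range (x + 1), (x.choose j : ℝ) * slotWeight n s δ x j = slotTotal n s δ := by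
  simp only [slotWeight, slotTotal, Finset.mul_sum]
  rw [Finset.sum_comm' (t' := Finset.range (s + 1))
    (s' := fun i => (Finset.range (x + 1)).filter (· ≤ i))]
  · refine Finset.sum_congr rfl fun i _ => ?_
    rw [← sum_choose_mul_choose_filter hx i, Finset.mul_sum]
    exact Finset.sum_congr rfl fun j _ => by ring
  · intro j i
    simp only [Finset.mem_range, Finset.mem_Ico, Finset.mem_filter]
    omega

theorem slotWeight_le {δ : ℝ} (h0 : 0 ≤ δ) (h1 : δ ≤ 1) {n x j : ℕ} (hx : x ≤ n) (hj : j ≤ x)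
    (s : ℕ) : slotWeight n s δ x j ≤ δ ^ j * (1 - δ) ^ (x - j) := by
  have h1' : 0 ≤ 1 - δ := by linarith
  rw [slotWeight, Finset.sum_Ico_eq_sum_range]
  simp only [Nat.add_sub_cancel_left]
  have hzero : ∀ l, n - x < l →
      δ ^ (j + l) * (1 - δ) ^ (n - (j + l)) * ((n - x).choose l : ℝ) = 0 := by
    intro l hl
    rw [Nat.choose_eq_zero_of_lt hl]
    simp
  calc ∑ l ∈ Finset.range (s + 1 - j),
        δ ^ (j + l) * (1 - δ) ^ (n - (j + l)) * ((n - x).choose l : ℝ)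
      ≤ ∑ l ∈ Finset.range (s + 1 - j + (n - x + 1)),
        δ ^ (j + l) * (1 - δ) ^ (n - (j + l)) * ((n - x).choose l : ℝ) :=
        Finset.sum_le_sum_of_subset_of_nonneg
          (Finset.range_subset_range.mpr (by omega)) fun l _ _ => by positivity
    _ = ∑ l ∈ Finset.range (n - x + 1),
        δ ^ (j + l) * (1 - δ) ^ (n - (j + l)) * ((n - x).choose l : ℝ) := by
        symm
        refine Finset.sum_subset (Finset.range_subset_range.mpr (by omega)) fun l _ hl => ?_
        exact hzero l (by have := Finset.mem_range.not.mp hl; omega)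
    _ = ∑ l ∈ Finset.range (n - x + 1), δ ^ j * (1 - δ) ^ (x - j) *
        (δ ^ l * (1 - δ) ^ (n - x - l) * ((n - x).choose l : ℝ)) := by
        refine Finset.sum_congr rfl fun l hl => ?_
        have := Finset.mem_range.mp hl
        rw [show n - (j + l) = (x - j) + (n - x - l) by omega, pow_add, pow_add]
        ring
    _ = δ ^ j * (1 - δ) ^ (x - j) := by
        rw [← Finset.mul_sum, ← add_pow, add_sub_cancel, one_pow, mul_one]

theorem half_le_slotTotal {δ : ℝ} (h0 : 0 ≤ δ) (h1 : δ ≤ 1) {n s : ℕ} (hs : s ≤ n)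
    (hδ : 2 * δ * n ≤ s) : 1 / 2 ≤ slotTotal n s δ := by
  have h1' : 0 ≤ 1 - δ := by linarith
  set b : ℕ → ℝ := fun i => δ ^ i * (1 - δ) ^ (n - i) * (n.choose i : ℝ) with hb
  have hb0 : ∀ i, 0 ≤ b i := fun i => by positivity
  have hmean : ∑ i ∈ Finset.range (n + 1), (i : ℝ) * b i = n * δ := by
    have := congrArg (Polynomial.eval δ) (bernsteinPolynomial.sum_smul ℝ n)
    simp only [Polynomial.eval_finsetSum, bernsteinPolynomial, nsmul_eq_mul, Polynomial.eval_mul,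
      Polynomial.eval_natCast, Polynomial.eval_pow, Polynomial.eval_X, Polynomial.eval_sub,
      Polynomial.eval_one] at this
    rw [← this]
    exact Finset.sum_congr rfl fun i _ => by rw [hb]; ring
  have htot : ∑ i ∈ Finset.range (n + 1), b i = 1 := by
    rw [← add_pow, add_sub_cancel, one_pow]
  have hsplit : slotTotal n s δ + ∑ i ∈ Finset.Ico (s + 1) (n + 1), b i = 1 := by
    rw [← htot, slotTotal, Finset.range_eq_Ico, Finset.range_eq_Ico,
      Finset.sum_Ico_consecutive _ (by omega) (by omega)]
  have htail : (s + 1 : ℝ) * ∑ i ∈ Finset.Ico (s + 1) (n + 1), b i ≤ n * δ := by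
    rw [← hmean, Finset.mul_sum]
    calc _ ≤ ∑ i ∈ Finset.Ico (s + 1) (n + 1), (i : ℝ) * b i := by
          refine Finset.sum_le_sum fun i hi => mul_le_mul_of_nonneg_right ?_ (hb0 i)
          exact_mod_cast (Finset.mem_Ico.mp hi).1
      _ ≤ _ := by
          refine Finset.sum_le_sum_of_subset_of_nonneg ?_ fun i _ _ =>
            mul_nonneg (Nat.cast_nonneg i) (hb0 i)
          intro i hi
          exact Finset.mem_range.mpr (Finset.mem_Ico.mp hi).2
  have hs0 : (0 : ℝ) ≤ s := Nat.cast_nonneg s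
  have h3 : 0 ≤ ∑ i ∈ Finset.Ico (s + 1) (n + 1), b i := Finset.sum_nonneg fun i _ => hb0 i
  by_contra hcon
  push Not at hcon
  have h4 : 1 / 2 < ∑ i ∈ Finset.Ico (s + 1) (n + 1), b i := by linarith
  nlinarith

open Polynomial in
/-- A truncated Bernoulli sample of the ones of the input, as an operator on families of functions
of bounded degree. -/
theorem exists_sampling [Fintype ι] {δ : ℝ} (h0 : 0 ≤ δ) (h1 : δ ≤ 1) {n s : ℕ} (hs : s ≤ n)
    (hδ : 2 * δ * n ≤ s) {E : ℕ} {G : Finset ι → Finset ι → ℝ}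
    (hG : ∀ a, a.card ≤ s → G a ∈ degLE ι E) :
    ∃ Q ∈ degLE ι (s + E), ∀ X : Finset ι, X.card ≤ n → ∃ w : Finset ι → ℝ,
      (∀ a, 0 ≤ w a) ∧ (∀ a ∈ X.powerset, w a ≤ 2 * keepWeight δ X a) ∧
      ∑ a ∈ X.powerset, w a = 1 ∧ (∀ a, s < a.card → w a = 0) ∧
      Q X = ∑ a ∈ X.powerset, w a * G a X := by
  have hZ := half_le_slotTotal h0 h1 hs hδ
  set Z := slotTotal n s δ with hZdef
  let P : ℕ → ℝ[X] := fun j => ∑ i ∈ Finset.Ico j (s + 1),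
    C (δ ^ i * (1 - δ) ^ (n - i) / ((i - j).factorial : ℝ)) *
      (descPochhammer ℝ (i - j)).comp (C (n : ℝ) - X)
  have hPdeg : ∀ j, (P j).natDegree ≤ s - j := by
    intro j
    refine natDegree_sum_le_of_forall_le _ _ fun i hi => ?_
    have hi' := Finset.mem_Ico.mp hi
    refine (natDegree_C_mul_le _ _).trans (natDegree_comp_le.trans ?_)
    rw [descPochhammer_natDegree]
    have : (C (n : ℝ) - X : ℝ[X]).natDegree ≤ 1 := by compute_degree
    calc (i - j) * _ ≤ (i - j) * 1 := by gcongr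
      _ ≤ s - j := by omega
  have hPev : ∀ (j : ℕ) {x : ℕ}, x ≤ n → (P j).eval (x : ℝ) = slotWeight n s δ x j := by
    intro j x hx
    simp only [P, eval_finsetSum, eval_mul, eval_C, eval_comp, eval_sub, eval_X, slotWeight]
    refine Finset.sum_congr rfl fun i _ => ?_
    rw [← Nat.cast_sub hx, descPochhammer_eval_eq_descFactorial,
      Nat.descFactorial_eq_factorial_mul_choose]
    have : ((i - j).factorial : ℝ) ≠ 0 := by positivity
    push_cast
    field_simp
  refine ⟨Z⁻¹ • ∑ a ∈ Finset.univ.filter (fun a : Finset ι => a.card ≤ s),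
    cubeMonomial a * (fun X => (P a.card).eval (X.card : ℝ)) * G a, ?_, ?_⟩
  · refine Submodule.smul_mem _ _ (Submodule.sum_mem _ fun a ha => ?_)
    have ha' := (Finset.mem_filter.mp ha).2
    refine mul_mem_degLE (degLE_mono ?_ (mul_mem_degLE (cubeMonomial_mem le_rfl)
      (eval_mem_degLE card_mem_degLE (P a.card)))) (hG a ha')
    have := hPdeg a.card
    omega
  · intro X hX
    have hZ0 : 0 < Z := by linarith
    refine ⟨fun a => Z⁻¹ * slotWeight n s δ X.card a.card, ?_, ?_, ?_, ?_, ?_⟩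
    · intro a
      exact mul_nonneg (inv_nonneg.mpr hZ0.le) (slotWeight_nonneg h0 h1 _ _ _ _)
    · intro a ha
      have hcard := Finset.card_le_card (Finset.mem_powerset.mp ha)
      have h3 := slotWeight_le h0 h1 hX hcard s
      have h4 : Z⁻¹ ≤ 2 := by
        rw [inv_le_comm₀ hZ0 (by norm_num)]
        linarith
      exact mul_le_mul h4 h3 (slotWeight_nonneg h0 h1 _ _ _ _) (by norm_num)
    · rw [← Finset.mul_sum, Finset.sum_powerset_apply_card (fun j => slotWeight n s δ X.card j)]
      simp only [nsmul_eq_mul]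
      rw [sum_slotWeight hX]
      exact inv_mul_cancel₀ hZ0.ne'
    · intro a ha
      simp only [slotWeight]
      rw [Finset.Ico_eq_empty (by omega), Finset.sum_empty, mul_zero]
    · simp only [Pi.smul_apply, Finset.sum_apply, smul_eq_mul, Pi.mul_apply, Finset.mul_sum]
      have h3 : ∀ a : Finset ι, a.card ≤ s → ¬ a ⊆ X →
          Z⁻¹ * (cubeMonomial a X * (P a.card).eval (X.card : ℝ) * G a X) = 0 := by
        intro a _ ha
        simp [cubeMonomial, ha]
      symm
      calc ∑ a ∈ X.powerset, Z⁻¹ * slotWeight n s δ X.card a.card * G a X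
          = ∑ a ∈ X.powerset.filter (fun a => a.card ≤ s),
              Z⁻¹ * slotWeight n s δ X.card a.card * G a X := by
            symm
            refine Finset.sum_subset (Finset.filter_subset _ _) fun a ha ha' => ?_
            have : s < a.card := by
              by_contra h
              exact ha' (Finset.mem_filter.mpr ⟨ha, by omega⟩)
            rw [slotWeight, Finset.Ico_eq_empty (by omega)]
            simp
        _ = ∑ a ∈ X.powerset.filter (fun a => a.card ≤ s),
              Z⁻¹ * (cubeMonomial a X * (P a.card).eval (X.card : ℝ) * G a X) := by
            refine Finset.sum_congr rfl fun a ha => ?_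
            have ha' := Finset.mem_powerset.mp (Finset.mem_filter.mp ha).1
            rw [hPev _ hX]
            simp [cubeMonomial, ha']
            ring
        _ = _ := by
            refine Finset.sum_subset ?_ fun a ha ha' => ?_
            · intro a ha
              exact Finset.mem_filter.mpr ⟨Finset.mem_univ _, (Finset.mem_filter.mp ha).2⟩
            · have h4 := (Finset.mem_filter.mp ha).2
              refine h3 a h4 fun h => ha' ?_
              exact Finset.mem_filter.mpr ⟨Finset.mem_powerset.mpr h, h4⟩

theorem sum_powerset_union_disjoint {A B : Finset ι} (h : Disjoint A B) (f g : Finset ι → ℝ) :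
    ∑ a ∈ (A ∪ B).powerset, f (a ∩ A) * g (a ∩ B) =
      (∑ b ∈ A.powerset, f b) * ∑ c ∈ B.powerset, g c := by
  rw [Finset.sum_mul_sum, ← Finset.sum_product']
  refine Finset.sum_nbij' (fun a => (a ∩ A, a ∩ B)) (fun p => p.1 ∪ p.2) ?_ ?_ ?_ ?_ ?_
  · intro a _
    exact Finset.mem_product.mpr ⟨Finset.mem_powerset.mpr Finset.inter_subset_right,
      Finset.mem_powerset.mpr Finset.inter_subset_right⟩
  · intro p hp
    have hp' := Finset.mem_product.mp hp
    exact Finset.mem_powerset.mpr (Finset.union_subset_union (Finset.mem_powerset.mp hp'.1)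
      (Finset.mem_powerset.mp hp'.2))
  · intro a ha
    simp only
    rw [← Finset.inter_union_distrib_left]
    exact Finset.inter_eq_left.mpr (Finset.mem_powerset.mp ha)
  · intro p hp
    have hp' := Finset.mem_product.mp hp
    have h1 := Finset.mem_powerset.mp hp'.1
    have h2 := Finset.mem_powerset.mp hp'.2
    have h3 : p.2 ∩ A = ∅ := Finset.disjoint_iff_inter_eq_empty.mp (h.symm.mono_left h2)
    have h4 : p.1 ∩ B = ∅ := Finset.disjoint_iff_inter_eq_empty.mp (h.mono_left h1)
    ext1
    · simp only [Finset.union_inter_distrib_right, h3, Finset.union_empty]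
      exact Finset.inter_eq_left.mpr h1
    · simp only [Finset.union_inter_distrib_right, h4, Finset.empty_union]
      exact Finset.inter_eq_left.mpr h2
  · intro a _
    rfl

theorem keepWeight_union_disjoint (δ : ℝ) {A B : Finset ι} (h : Disjoint A B) {a : Finset ι}
    (ha : a ⊆ A ∪ B) :
    keepWeight δ (A ∪ B) a = keepWeight δ A (a ∩ A) * keepWeight δ B (a ∩ B) := by
  have h1 : a.card = (a ∩ A).card + (a ∩ B).card := by
    rw [← Finset.card_union_of_disjoint (h.mono Finset.inter_subset_right Finset.inter_subset_right),
      ← Finset.inter_union_distrib_left, Finset.inter_eq_left.mpr ha]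
  have h2 : (a ∩ A).card ≤ A.card := Finset.card_le_card Finset.inter_subset_right
  have h3 : (a ∩ B).card ≤ B.card := Finset.card_le_card Finset.inter_subset_right
  rw [keepWeight, keepWeight, keepWeight, Finset.card_union_of_disjoint h, h1,
    show A.card + B.card - ((a ∩ A).card + (a ∩ B).card) =
      (A.card - (a ∩ A).card) + (B.card - (a ∩ B).card) by omega, pow_add, pow_add]
  ring

/-- Large deviations for the number of disjoint blocks that contain exactly one sampled element. -/
theorem sum_keepWeight_half_pow {κ : Type*} [DecidableEq κ] {δ : ℝ} (h0 : 0 ≤ δ)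
    (h1 : δ ≤ 1 / 2) {K : ℕ} (T : Finset κ) :
    ∀ (X : Finset ι) (A : κ → Finset ι), (∀ j ∈ T, A j ⊆ X) → (∀ j ∈ T, (A j).card = K + 1) →
      (∀ j ∈ T, ∀ j' ∈ T, j ≠ j' → Disjoint (A j) (A j')) →
      ∑ a ∈ X.powerset, keepWeight δ X a *
        (1 / 2) ^ (T.filter (fun j => (a ∩ A j).card = 1)).card ≤
        Real.exp (-(δ / 2 ^ (K + 1) * T.card)) := by
  induction T using Finset.induction_on with
  | empty =>
    intro X A _ _ _
    simp [sum_keepWeight]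
  | insert j T hj ih =>
    intro X A hAX hAc hAd
    have hjX := hAX j (Finset.mem_insert_self j T)
    have hd : Disjoint (A j) (X \ A j) := Finset.disjoint_sdiff
    have hX : A j ∪ (X \ A j) = X := Finset.union_sdiff_of_subset hjX
    have hsub : ∀ j' ∈ T, A j' ⊆ X \ A j := by
      intro j' hj'
      refine Finset.subset_sdiff.mpr ⟨hAX j' (Finset.mem_insert_of_mem hj'), ?_⟩
      exact hAd j' (Finset.mem_insert_of_mem hj') j (Finset.mem_insert_self j T)
        (fun h => hj (h ▸ hj'))
    have ih' := ih (X \ A j) A hsub (fun j' hj' => hAc j' (Finset.mem_insert_of_mem hj'))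
      (fun i hi i' hi' => hAd i (Finset.mem_insert_of_mem hi) i' (Finset.mem_insert_of_mem hi'))
    have hone := sum_keepWeight_half_pow_single h0 h1 (hAc j (Finset.mem_insert_self j T))
    have hfac : ∀ a ∈ X.powerset, keepWeight δ X a *
        (1 / 2) ^ ((insert j T).filter (fun j => (a ∩ A j).card = 1)).card =
        (fun b => keepWeight δ (A j) b * (if b.card = 1 then 1 / 2 else 1)) (a ∩ A j) *
        (fun c => keepWeight δ (X \ A j) c *
          (1 / 2) ^ (T.filter (fun j' => (c ∩ A j').card = 1)).card) (a ∩ (X \ A j)) := by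
      intro a ha
      have ha' := Finset.mem_powerset.mp ha
      have h2 := keepWeight_union_disjoint δ hd (a := a) (by rw [hX]; exact ha')
      rw [hX] at h2
      have h3 : T.filter (fun j' => (a ∩ (X \ A j) ∩ A j').card = 1) =
          T.filter (fun j' => (a ∩ A j').card = 1) := by
        refine Finset.filter_congr fun j' hj' => ?_
        rw [Finset.inter_assoc, Finset.inter_eq_right.mpr (hsub j' hj')]
      simp only [h3]
      rw [h2, Finset.filter_insert]
      split_ifs with hc
      · rw [Finset.card_insert_of_notMem (fun h => hj (Finset.mem_filter.mp h).1), pow_succ]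
        ring
      · ring
    rw [Finset.sum_congr rfl hfac]
    have hsplit := sum_powerset_union_disjoint hd
      (fun b => keepWeight δ (A j) b * (if b.card = 1 then 1 / 2 else 1))
      (fun c => keepWeight δ (X \ A j) c *
          (1 / 2) ^ (T.filter (fun j' => (c ∩ A j').card = 1)).card)
    rw [hX] at hsplit
    rw [hsplit, Finset.card_insert_of_notMem hj]
    have hexp : Real.exp (-(δ / 2 ^ (K + 1) * ((T.card + 1 : ℕ) : ℝ))) =
        Real.exp (-(δ / 2 ^ (K + 1))) * Real.exp (-(δ / 2 ^ (K + 1) * T.card)) := by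
      rw [← Real.exp_add]
      congr 1
      push_cast
      ring
    rw [hexp]
    refine mul_le_mul hone ih' (Finset.sum_nonneg fun c _ => ?_) (Real.exp_pos _).le
    exact mul_nonneg (keepWeight_nonneg h0 (by linarith) _ _) (by positivity)

end Sampling

section Columns

variable {ι κ : Type*} [Fintype κ] [DecidableEq κ]

/-- The columns that contain at least `K` elements of `X`. -/
def heavyCols (col : ι → κ) (K : ℕ) (X : Finset ι) : Finset κ :=
  Finset.univ.filter fun j => K ≤ (X.filter (col · = j)).card

theorem mem_heavyCols {col : ι → κ} {K : ℕ} {X : Finset ι} {j : κ} :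
    j ∈ heavyCols col K X ↔ K ≤ (X.filter (col · = j)).card := by
  simp [heavyCols]

theorem card_le_of_heavyCols_eq_empty {col : ι → κ} {K : ℕ} {X : Finset ι}
    (hX : heavyCols col (K + 1) X = ∅) (S : Finset κ) (hS : ∀ i ∈ X, col i ∈ S) :
    X.card ≤ K * S.card := by
  refine Finset.card_le_mul_card_image_of_maps_to (f := col) hS K fun j _ => ?_
  by_contra h
  have : j ∈ heavyCols col (K + 1) X := mem_heavyCols.mpr (by omega)
  rw [hX] at this
  simp at this

variable [DecidableEq ι]

/-- The elements outside the sample `a` that lie in a column hit by `a`. -/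
def rest (col : ι → κ) (a X : Finset ι) : Finset ι :=
  X.filter fun i => i ∉ a ∧ col i ∈ a.image col

theorem card_heavyCols_rest_le (col : ι → κ) {K : ℕ} (hK : 1 ≤ K) (a X : Finset ι) :
    (heavyCols col K (rest col a X)).card ≤ a.card := by
  refine (Finset.card_le_card ?_).trans (Finset.card_image_le (s := a) (f := col))
  intro j hj
  have h1 := mem_heavyCols.mp hj
  obtain ⟨i, hi⟩ := Finset.card_pos.mp (by omega : 0 < ((rest col a X).filter (col · = j)).card)
  have h2 := Finset.mem_filter.mp hi
  rw [← h2.2]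
  exact (Finset.mem_filter.mp h2.1).2.2

theorem heavyCols_rest_eq_empty {col : ι → κ} {K : ℕ} (hK : 1 ≤ K) {a X : Finset ι} (ha : a ⊆ X)
    (hX : heavyCols col (K + 1) X = ∅) : heavyCols col K (rest col a X) = ∅ := by
  refine Finset.eq_empty_of_forall_notMem fun j hj => ?_
  have h1 := mem_heavyCols.mp hj
  obtain ⟨i, hi⟩ := Finset.card_pos.mp (by omega : 0 < ((rest col a X).filter (col · = j)).card)
  have h2 := Finset.mem_filter.mp hi
  have h3 := (Finset.mem_filter.mp h2.1).2.2
  rw [h2.2] at h3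
  obtain ⟨i', hi', hij⟩ := Finset.mem_image.mp h3
  have h4 : insert i' ((rest col a X).filter (col · = j)) ⊆ X.filter (col · = j) := by
    intro x hx
    rcases Finset.mem_insert.mp hx with rfl | hx
    · exact Finset.mem_filter.mpr ⟨ha hi', hij⟩
    · have := Finset.mem_filter.mp hx
      exact Finset.mem_filter.mpr ⟨(Finset.mem_filter.mp this.1).1, this.2⟩
  have h5 : i' ∉ (rest col a X).filter (col · = j) := fun h =>
    (Finset.mem_filter.mp (Finset.mem_filter.mp h).1).2.1 hi'
  have h6 := Finset.card_le_card h4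
  rw [Finset.card_insert_of_notMem h5] at h6
  have : j ∈ heavyCols col (K + 1) X := mem_heavyCols.mpr (by omega)
  rw [hX] at this
  simp at this

theorem card_rest_le {col : ι → κ} {K : ℕ} {a X : Finset ι}
    (hX : heavyCols col (K + 1) X = ∅) : (rest col a X).card ≤ K * a.card := by
  have h : heavyCols col (K + 1) (rest col a X) = ∅ := by
    refine Finset.eq_empty_of_forall_notMem fun j hj => ?_
    have h1 := mem_heavyCols.mp hj
    have : j ∈ heavyCols col (K + 1) X := mem_heavyCols.mpr
      (h1.trans (Finset.card_le_card (Finset.filter_subset_filter _ (Finset.filter_subset _ _))))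
    rw [hX] at this
    simp at this
  refine (card_le_of_heavyCols_eq_empty h (a.image col) fun i hi =>
    (Finset.mem_filter.mp hi).2.2).trans ?_
  exact Nat.mul_le_mul_left K Finset.card_image_le

/-- A sample detects a constant fraction of the expected number of heavy columns, except with
exponentially small probability. -/
theorem sum_keepWeight_few_heavyCols (col : ι → κ) {δ : ℝ} (h0 : 0 ≤ δ) (h1 : δ ≤ 1 / 2)
    {K : ℕ} (X : Finset ι) (V : ℝ) :
    ∑ a ∈ X.powerset.filter (fun a => ((heavyCols col K (rest col a X)).card : ℝ) ≤ V),
      keepWeight δ X a ≤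
      2 ^ V * Real.exp (-(δ / 2 ^ (K + 1) * (heavyCols col (K + 1) X).card)) := by
  set T := heavyCols col (K + 1) X with hT
  have hex : ∀ j : κ, ∃ A : Finset ι, j ∈ T → A ⊆ X.filter (col · = j) ∧ A.card = K + 1 := by
    intro j
    by_cases hj : j ∈ T
    · obtain ⟨A, hA⟩ := Finset.exists_subset_card_eq (mem_heavyCols.mp hj)
      exact ⟨A, fun _ => hA⟩
    · exact ⟨∅, fun h => absurd h hj⟩
  choose A hA using hex
  have hcolA : ∀ j ∈ T, ∀ i ∈ A j, i ∈ X ∧ col i = j := fun j hj i hi =>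
    Finset.mem_filter.mp ((hA j hj).1 hi)
  have hmain := sum_keepWeight_half_pow h0 h1 (K := K) T X A
    (fun j hj i hi => (hcolA j hj i hi).1) (fun j hj => (hA j hj).2)
    (fun j hj j' hj' hne => Finset.disjoint_left.mpr fun i hi hi' =>
      hne ((hcolA j hj i hi).2.symm.trans (hcolA j' hj' i hi').2))
  have hle : ∀ a, (T.filter (fun j => (a ∩ A j).card = 1)).card ≤
      (heavyCols col K (rest col a X)).card := by
    intro a
    refine Finset.card_le_card fun j hj => ?_
    obtain ⟨hjT, hj1⟩ := Finset.mem_filter.mp hj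
    rw [mem_heavyCols]
    have h2 : (A j \ a).card = K := by
      have := Finset.card_sdiff_add_card_inter (A j) a
      rw [Finset.inter_comm, hj1, (hA j hjT).2] at this
      omega
    rw [← h2]
    refine Finset.card_le_card fun i hi => ?_
    obtain ⟨hiA, hia⟩ := Finset.mem_sdiff.mp hi
    have h3 := hcolA j hjT i hiA
    refine Finset.mem_filter.mpr ⟨Finset.mem_filter.mpr ⟨h3.1, hia, ?_⟩, h3.2⟩
    obtain ⟨x, hx⟩ := Finset.card_pos.mp (by omega : 0 < (a ∩ A j).card)
    obtain ⟨hxa, hxA⟩ := Finset.mem_inter.mp hx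
    exact Finset.mem_image.mpr ⟨x, hxa, (hcolA j hjT x hxA).2.trans h3.2.symm⟩
  have hV : ∀ a ∈ X.powerset.filter
      (fun a => ((heavyCols col K (rest col a X)).card : ℝ) ≤ V),
      keepWeight δ X a ≤ 2 ^ V * (keepWeight δ X a *
        (1 / 2) ^ (T.filter (fun j => (a ∩ A j).card = 1)).card) := by
    intro a ha
    have haV := (Finset.mem_filter.mp ha).2
    have h2 : ((T.filter (fun j => (a ∩ A j).card = 1)).card : ℝ) ≤ V :=
      le_trans (by exact_mod_cast hle a) haV
    have h3 : (1 : ℝ) ≤ 2 ^ V * (1 / 2) ^ (T.filter (fun j => (a ∩ A j).card = 1)).card := by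
      rw [one_div, inv_pow, ← div_eq_mul_inv, le_div_iff₀ (by positivity), one_mul,
        ← Real.rpow_natCast]
      exact Real.rpow_le_rpow_of_exponent_le (by norm_num) h2
    have h4 := keepWeight_nonneg h0 (by linarith) X a
    nlinarith
  calc _ ≤ ∑ a ∈ X.powerset.filter
        (fun a => ((heavyCols col K (rest col a X)).card : ℝ) ≤ V),
        2 ^ V * (keepWeight δ X a *
          (1 / 2) ^ (T.filter (fun j => (a ∩ A j).card = 1)).card) := Finset.sum_le_sum hV
    _ ≤ ∑ a ∈ X.powerset, 2 ^ V * (keepWeight δ X a *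
          (1 / 2) ^ (T.filter (fun j => (a ∩ A j).card = 1)).card) := by
        refine Finset.sum_le_sum_of_subset_of_nonneg (Finset.filter_subset _ _) fun a _ _ => ?_
        have := keepWeight_nonneg h0 (by linarith) X a
        positivity
    _ ≤ _ := by
        rw [← Finset.mul_sum]
        gcongr

end Columns

section Detector

/-- A rate of decay that interpolates between exponential and polynomial. -/
noncomputable def decay (d : ℕ) (v : ℝ) : ℝ := ((1 + v / d) ^ d)⁻¹

theorem decay_pos {d : ℕ} {v : ℝ} (hv : 0 ≤ v) : 0 < decay d v := by
  unfold decay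
  positivity

theorem decay_le_one {d : ℕ} {v : ℝ} (hv : 0 ≤ v) : decay d v ≤ 1 := by
  refine inv_le_one_of_one_le₀ (one_le_pow₀ ?_)
  have : 0 ≤ v / d := by positivity
  linarith

theorem decay_antitone {d : ℕ} {v w : ℝ} (hv : 0 ≤ v) (hvw : v ≤ w) : decay d w ≤ decay d v := by
  unfold decay
  gcongr

theorem exp_neg_le_decay {d : ℕ} {v : ℝ} (hv : 0 ≤ v) : Real.exp (-v) ≤ decay d v := by
  rw [Real.exp_neg, decay]
  refine inv_anti₀ (by positivity) ?_
  rcases Nat.eq_zero_or_pos d with rfl | hd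
  · simpa using Real.one_le_exp hv
  · have hd0 : (0 : ℝ) < d := by exact_mod_cast hd
    calc (1 + v / d) ^ d ≤ Real.exp (v / d) ^ d := by
          refine pow_le_pow_left₀ (by positivity) ?_ d
          have := Real.add_one_le_exp (v / d)
          linarith
      _ = Real.exp v := by
          rw [← Real.exp_nat_mul]
          congr 1
          field_simp

theorem half_pow_le_decay {d h : ℕ} (hd : 1 ≤ d) {v : ℝ} (hv : 0 ≤ v)
    (hh : 4 * √(v * d) ≤ h) : (1 / 2 : ℝ) ^ h ≤ decay d v := by
  have hd0 : (0 : ℝ) < d := by exact_mod_cast hd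
  rw [one_div, inv_pow, decay]
  refine inv_anti₀ (by positivity) ?_
  have h1 : 1 + v / d ≤ Real.exp (2 * √(v / d)) := by
    have h2 := Real.add_one_le_exp (√(v / d))
    have h3 : √(v / d) ^ 2 = v / d := Real.sq_sqrt (by positivity)
    have h4 := Real.sqrt_nonneg (v / d)
    have h5 : Real.exp (2 * √(v / d)) = Real.exp (√(v / d)) ^ 2 := by
      rw [← Real.exp_nat_mul]
      norm_num
    rw [h5]
    nlinarith
  have h2 : Real.exp (1 / 2) ≤ 2 := by
    have h3 : Real.exp (1 / 2) ^ 2 = Real.exp 1 := by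
      rw [← Real.exp_nat_mul]
      norm_num
    have h4 := Real.exp_one_lt_d9
    nlinarith [Real.exp_pos (1 / 2)]
  calc (1 + v / d) ^ d ≤ Real.exp (2 * √(v / d)) ^ d := by
        exact pow_le_pow_left₀ (by positivity) h1 d
    _ = Real.exp (2 * √(v * d)) := by
        rw [← Real.exp_nat_mul]
        congr 1
        have : v * d = (v / d) * (d : ℝ) ^ 2 := by field_simp
        rw [this, Real.sqrt_mul (by positivity), Real.sqrt_sq hd0.le]
        ring
    _ ≤ Real.exp (h * (1 / 2)) := Real.exp_le_exp.mpr (by linarith)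
    _ = Real.exp (1 / 2) ^ h := Real.exp_nat_mul _ _
    _ ≤ 2 ^ h := pow_le_pow_left₀ (Real.exp_pos _).le h2 h

/-- The exponent `1 - 2^{1-K}` of the sampling density. -/
noncomputable def densityExponent (K : ℕ) : ℝ := 1 - 2 * (1 / 2) ^ K

theorem densityExponent_one : densityExponent 1 = 0 := by
  norm_num [densityExponent]

theorem densityExponent_succ (K : ℕ) :
    densityExponent (K + 1) = 1 / 2 + densityExponent K / 2 := by
  rw [densityExponent, densityExponent, pow_succ]
  ring

theorem densityExponent_nonneg {K : ℕ} (hK : 1 ≤ K) : 0 ≤ densityExponent K := by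
  have : (1 / 2 : ℝ) ^ K ≤ (1 / 2) ^ 1 :=
    pow_le_pow_of_le_one (by norm_num) (by norm_num) hK
  rw [densityExponent]
  linarith

theorem densityExponent_le_one (K : ℕ) : densityExponent K ≤ 1 := by
  have : (0 : ℝ) ≤ (1 / 2) ^ K := by positivity
  rw [densityExponent]
  linarith

/-- Existence of polynomials that are close to `1` when no column contains `K` elements, and that
decay with the number of columns that do. -/
def HasDetectors (K : ℕ) (C A c : ℝ) : Prop :=
  ∀ (ι κ : Type) [Fintype ι] [DecidableEq ι] [Fintype κ] [DecidableEq κ] (col : ι → κ)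
    (d N : ℕ), 1 ≤ d → d ≤ N → ∃ (e : ℕ) (q : Finset ι → ℝ), (e : ℝ) ≤ C * √((N : ℝ) * d) ∧
      q ∈ degLE ι e ∧ ∀ X : Finset ι, X.card ≤ N →
        (heavyCols col K X = ∅ → |q X - 1| ≤ A * (1 / 2) ^ d) ∧
        |q X| ≤ A * decay d (c * ((d : ℝ) / N) ^ densityExponent K * (heavyCols col K X).card)

theorem hasDetectors_one : ∃ C A c : ℝ, 1 ≤ C ∧ 1 ≤ A ∧ 0 < c ∧ c ≤ 1 ∧ HasDetectors 1 C A c := by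
  obtain ⟨C, hC, hν⟩ := exists_nor_poly
  refine ⟨C, 1, 1, hC, le_rfl, one_pos, le_rfl, ?_⟩
  intro ι κ _ _ _ _ col d N hd hdN
  obtain ⟨ν, hdeg, hν0, hνD, hνdec, -⟩ := hν d N hd hdN
  have hd0 : (0 : ℝ) < d := by exact_mod_cast hd
  refine ⟨ν.natDegree, fun X => ν.eval (X.card : ℝ), hdeg, eval_mem_degLE card_mem_degLE ν, ?_⟩
  intro X hX
  constructor
  · intro hXe
    have : X = ∅ := by
      refine Finset.eq_empty_of_forall_notMem fun i hi => ?_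
      have : col i ∈ heavyCols col 1 X := by
        rw [mem_heavyCols]
        exact Finset.card_pos.mpr ⟨i, Finset.mem_filter.mpr ⟨hi, rfl⟩⟩
      rw [hXe] at this
      simp at this
    rw [this]
    simp [hν0]
  · rw [densityExponent_one, Real.rpow_zero, mul_one, one_mul, one_mul]
    have hle : (heavyCols col 1 X).card ≤ X.card := by
      refine (Finset.card_le_card ?_).trans (Finset.card_image_le (s := X) (f := col))
      intro j hj
      obtain ⟨i, hi⟩ := Finset.card_pos.mp (mem_heavyCols.mp hj)
      have := Finset.mem_filter.mp hi
      exact Finset.mem_image.mpr ⟨i, this.1, this.2⟩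
    refine le_trans ?_ (decay_antitone (Nat.cast_nonneg _) (Nat.cast_le.mpr hle))
    change |ν.eval (X.card : ℝ)| ≤ _
    rcases Nat.eq_zero_or_pos X.card with h0 | h0
    · rw [h0]
      simp [hν0, decay]
    · rcases Nat.lt_or_ge d X.card with h1 | h1
      · refine (hνdec X.card h1 hX).trans ?_
        have hx0 : (0 : ℝ) < X.card := by exact_mod_cast h0
        have hdx : (d : ℝ) ≤ X.card := by exact_mod_cast h1.le
        rw [pow_mul, ← mul_pow, decay, ← inv_pow]
        refine pow_le_pow_left₀ (by positivity) ?_ d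
        have h3 : (1 + (X.card : ℝ) / d)⁻¹ = d / (d + X.card) := by field_simp
        rw [h3]
        have h4 : (d : ℝ) / X.card ≤ 1 := (div_le_one hx0).mpr hdx
        have h5 : ((d : ℝ) / X.card) ^ 3 ≤ d / X.card := by
          have := pow_le_pow_of_le_one (by positivity) h4 (by norm_num : 1 ≤ 3)
          simpa using this
        have h6 : 1 / 2 * ((d : ℝ) / X.card) ≤ d / (d + X.card) := by
          rw [div_mul_div_comm, one_mul]
          exact div_le_div_of_nonneg_left hd0.le (by positivity) (by linarith)
        have h7 : (0 : ℝ) ≤ d / X.card := by positivity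
        linarith
      · rw [hνD X.card h0 h1, abs_zero]
        exact (decay_pos (Nat.cast_nonneg _)).le

theorem rpow_densityExponent_succ_le {K : ℕ} (hK : 1 ≤ K) {d N M s : ℝ} (hd0 : 0 < d)
    (hN0 : 0 < N) (hM1 : 1 ≤ M) (hs0 : 0 < s) (hsR : √(N * d) ≤ s) (hs2R : s ≤ 2 * √(N * d)) :
    (d / N) ^ densityExponent (K + 1) / (16384 * M) ≤
      (d / (4096 * (M * s))) ^ densityExponent K * (s / (2 * N)) := by
  set R := √(N * d) with hR
  have hR0 : 0 < R := Real.sqrt_pos.mpr (by positivity)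
  have hR2 : R ^ 2 = N * d := Real.sq_sqrt (by positivity)
  clear_value R
  set ρ := d / N with hρ
  have hρ0 : 0 < ρ := by positivity
  have hθ0 := densityExponent_nonneg hK
  have hθ1 := densityExponent_le_one K
  have hsq : √ρ = R / N := by
    rw [Real.sqrt_eq_iff_mul_self_eq (by positivity) (by positivity)]
    rw [hρ]
    field_simp
    linarith
  have h2 : √ρ / (8192 * M) ≤ d / (4096 * (M * s)) := by
    rw [hsq, div_div, div_le_div_iff₀ (by positivity) (by positivity)]
    have : R * (4096 * (M * s)) ≤ R * (4096 * (M * (2 * R))) := by gcongr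
    calc R * (4096 * (M * s)) ≤ R * (4096 * (M * (2 * R))) := this
      _ = 8192 * M * R ^ 2 := by ring
      _ = d * (N * (8192 * M)) := by rw [hR2]; ring
  have h3 : ρ ^ (densityExponent K / 2) / (8192 * M) ≤ (d / (4096 * (M * s))) ^ densityExponent K := by
    calc ρ ^ (densityExponent K / 2) / (8192 * M)
        ≤ ρ ^ (densityExponent K / 2) / (8192 * M) ^ densityExponent K := by
          gcongr
          have : (1 : ℝ) ≤ 8192 * M := by linarith
          calc (8192 * M) ^ densityExponent K ≤ (8192 * M) ^ (1 : ℝ) :=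
                Real.rpow_le_rpow_of_exponent_le this hθ1
            _ = _ := Real.rpow_one _
      _ = (√ρ / (8192 * M)) ^ densityExponent K := by
          rw [Real.div_rpow (Real.sqrt_nonneg _) (by positivity), Real.sqrt_eq_rpow,
            ← Real.rpow_mul hρ0.le]
          congr 2
          ring
      _ ≤ (d / (4096 * (M * s))) ^ densityExponent K := Real.rpow_le_rpow (by positivity) h2 hθ0
  have h4 : √ρ / 2 ≤ s / (2 * N) := by
    rw [hsq, div_div, mul_comm N 2]
    gcongr
  calc ρ ^ densityExponent (K + 1) / (16384 * M)
      = (ρ ^ (densityExponent K / 2) / (8192 * M)) * (√ρ / 2) := by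
        rw [densityExponent_succ, add_comm, Real.rpow_add hρ0, Real.sqrt_eq_rpow]
        field_simp
        ring
    _ ≤ (d / (4096 * (M * s))) ^ densityExponent K * (s / (2 * N)) :=
           mul_le_mul h3 h4 (by positivity) (by positivity)

theorem abs_sum_mul_le_decay {α : Type*} (S : Finset α) {w kw cnt g : α → ℝ} {A B V : ℝ} {d : ℕ}
    (hA : 0 ≤ A) (hB : 0 ≤ B) (hV : 0 ≤ V) (hcnt : ∀ a, 0 ≤ cnt a) (hw : ∀ a, 0 ≤ w a)
    (hkw : ∀ a ∈ S, w a ≤ 2 * kw a) (hw1 : ∑ a ∈ S, w a = 1)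
    (hg : ∀ a, w a ≠ 0 → |g a| ≤ A * decay d (B * cnt a))
    (hfew : ∑ a ∈ S.filter (fun a => cnt a ≤ V), kw a ≤ decay d (B * V)) :
    |∑ a ∈ S, w a * g a| ≤ 3 * A * decay d (B * V) := by
  have hterm : ∀ a ∈ S, |w a * g a| ≤ w a * (A * decay d (B * V)) +
      (if cnt a ≤ V then 2 * A * kw a else 0) := by
    intro a ha
    have hdec := decay_pos (d := d) (mul_nonneg hB hV)
    have hkw0 : 0 ≤ kw a := by linarith [hkw a ha, hw a]
    rcases eq_or_ne (w a) 0 with h0 | h0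
    · rw [h0, zero_mul, abs_zero, zero_mul, zero_add]
      split_ifs
      · positivity
      · exact le_rfl
    · rw [abs_mul, abs_of_nonneg (hw a)]
      have h1 := hg a h0
      split_ifs with hc
      · have h2 : |g a| ≤ A := h1.trans (mul_le_of_le_one_right hA
          (decay_le_one (mul_nonneg hB (hcnt a))))
        have h3 : w a * |g a| ≤ 2 * kw a * A :=
          mul_le_mul (hkw a ha) h2 (abs_nonneg _) (by positivity)
        have h4 : 0 ≤ w a * (A * decay d (B * V)) := mul_nonneg (hw a) (mul_nonneg hA hdec.le)
        linarith
      · push Not at hc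
        rw [add_zero]
        exact mul_le_mul_of_nonneg_left (h1.trans (mul_le_mul_of_nonneg_left
          (decay_antitone (mul_nonneg hB hV) (by gcongr)) hA)) (hw a)
  calc _ ≤ ∑ a ∈ S, |w a * g a| := Finset.abs_sum_le_sum_abs _ _
    _ ≤ _ := Finset.sum_le_sum hterm
    _ = A * decay d (B * V) + 2 * A * ∑ a ∈ S.filter (fun a => cnt a ≤ V), kw a := by
        rw [Finset.sum_add_distrib, ← Finset.sum_mul, hw1, one_mul, ← Finset.sum_filter,
          Finset.mul_sum]
    _ ≤ A * decay d (B * V) + 2 * A * decay d (B * V) := by gcongr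
    _ = _ := by ring

set_option maxHeartbeats 1600000 in
theorem HasDetectors.succ {K : ℕ} (hK : 1 ≤ K) {C A c : ℝ} (hC : 1 ≤ C) (hA : 1 ≤ A) (hc : 0 < c)
    (hc1 : c ≤ 1) (H : HasDetectors K C A c) :
    ∃ C' A' c' : ℝ, 1 ≤ C' ∧ 1 ≤ A' ∧ 0 < c' ∧ c' ≤ 1 ∧ HasDetectors (K + 1) C' A' c' := by
  set M : ℕ := ⌈C ^ 2⌉₊ + K with hM
  have hM1 : 1 ≤ M := by omega
  have hM1' : (1 : ℝ) ≤ M := by exact_mod_cast hM1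
  have hCM : C ^ 2 ≤ M := by
    rw [hM]
    push_cast
    have := Nat.le_ceil (C ^ 2)
    have : (0 : ℝ) ≤ K := Nat.cast_nonneg K
    linarith
  have hKM : K ≤ M := by omega
  set c1 : ℝ := 1 / 2 ^ (K + 3) with hc1def
  have hc10 : 0 < c1 := by positivity
  have hc11 : c1 ≤ 1 := by
    rw [hc1def]
    exact div_le_one_of_le₀ (one_le_pow₀ (by norm_num)) (by positivity)
  refine ⟨2 + 192 * (C + 2) * (√M + 1), 3 * A, c * c1 / (16384 * M), ?_, by linarith,
    by positivity, ?_, ?_⟩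
  · have : 0 ≤ 192 * (C + 2) * (√M + 1) := by positivity
    linarith
  · rw [div_le_one (by positivity)]
    nlinarith
  intro ι κ _ _ _ _ col d N hd hdN
  have hd1 : (1 : ℝ) ≤ d := by exact_mod_cast hd
  have hd0 : (0 : ℝ) < d := by linarith
  have hdN' : (d : ℝ) ≤ N := by exact_mod_cast hdN
  have hN0 : (0 : ℝ) < N := by linarith
  set R := √((N : ℝ) * d) with hR
  have hRd : (d : ℝ) ≤ R := Real.le_sqrt_of_sq_le (by
    rw [sq]
    exact mul_le_mul_of_nonneg_right hdN' hd0.le)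
  have hRN : R ≤ N := Real.sqrt_le_iff.mpr ⟨hN0.le, by
    rw [sq]
    exact mul_le_mul_of_nonneg_left hdN' hN0.le⟩
  have hR0 : 0 < R := by linarith
  have hR2 : R ^ 2 = N * d := Real.sq_sqrt (by positivity)
  set s := ⌈R⌉₊ with hs
  have hsR : R ≤ s := Nat.le_ceil R
  have hs2R : (s : ℝ) ≤ 2 * R := by
    have := (Nat.ceil_lt_add_one hR0.le).le
    linarith
  have hsN : s ≤ N := Nat.ceil_le.mpr hRN
  have hds : d ≤ s := by exact_mod_cast hRd.trans hsR
  have hs1 : 1 ≤ s := hd.trans hds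
  have hs0 : (0 : ℝ) < s := by exact_mod_cast hs1
  have hsN' : (s : ℝ) ≤ N := by exact_mod_cast hsN
  have hds' : (d : ℝ) ≤ s := by exact_mod_cast hds
  set m := M * s with hm
  have hm1 : 1 ≤ m := Nat.one_le_iff_ne_zero.mpr (Nat.mul_ne_zero (by omega) (by omega))
  have hm' : (m : ℝ) = M * s := by rw [hm]; push_cast; ring
  set N1 := 4096 * m with hN1
  have hsm : s ≤ m := by rw [hm]; exact Nat.le_mul_of_pos_left s (by omega)
  have hdN1 : d ≤ N1 := by omega
  have hN1' : (N1 : ℝ) = 4096 * (M * s) := by rw [hN1]; push_cast; rw [hm']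
  obtain ⟨e1, q, he1, hq, hqX⟩ := H ι κ col d N1 hd hdN1
  set R1 := √((N1 : ℝ) * d) with hR1
  have hR1' : R1 = 64 * √(M * s * d) := by
    rw [hR1, hN1', show (4096 : ℝ) * (M * s) * d = 64 ^ 2 * (M * s * d) by ring,
      Real.sqrt_mul (by norm_num), Real.sqrt_sq (by norm_num)]
  have hR1d : (d : ℝ) ≤ R1 := Real.le_sqrt_of_sq_le (by
    rw [sq]
    exact mul_le_mul_of_nonneg_right (by exact_mod_cast hdN1) hd0.le)
  have he1m : e1 ≤ 4096 * m := by
    have : (e1 : ℝ) ≤ N1 := by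
      refine he1.trans ?_
      rw [← abs_of_nonneg (by linarith : 0 ≤ C), ← Real.sqrt_sq_eq_abs, ← Real.sqrt_mul (by positivity)]
      refine Real.sqrt_le_iff.mpr ⟨by positivity, ?_⟩
      have h1 : C ^ 2 * d ≤ N1 := by
        rw [hN1']
        calc C ^ 2 * d ≤ M * s := by gcongr
          _ ≤ 4096 * (M * s) := le_mul_of_one_le_left (by positivity) (by norm_num)
      calc C ^ 2 * ((N1 : ℝ) * d) = (N1 : ℝ) * (C ^ 2 * d) := by ring
        _ ≤ (N1 : ℝ) * N1 := mul_le_mul_of_nonneg_left h1 (Nat.cast_nonneg _)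
        _ = (N1 : ℝ) ^ 2 := (sq _).symm
    exact_mod_cast this
  set h := ⌈R1⌉₊ with hh
  have hhR : R1 ≤ h := Nat.le_ceil R1
  have hh2 : (h : ℝ) ≤ 2 * R1 := by
    have := (Nat.ceil_lt_add_one (by positivity : 0 ≤ R1)).le
    linarith
  have hdh : d ≤ h := by exact_mod_cast hR1d.trans hhR
  obtain ⟨e2, g, he2, hg, hg1, hg2, hg3⟩ := exists_extension hm1 he1m hq N h
  set δ : ℝ := s / (2 * N) with hδ
  have hδ0 : 0 ≤ δ := by positivity
  have hδ2 : δ ≤ 1 / 2 := by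
    rw [hδ, div_le_div_iff₀ (by positivity) (by norm_num)]
    linarith
  clear_value R1 h δ N1 m s R c1 M
  obtain ⟨Q, hQ, hQX⟩ := exists_sampling (n := N) (s := s) hδ0 (by linarith) hsN
    (by rw [hδ]; field_simp; exact le_rfl) (E := e2) (G := fun a X => g (rest col a X))
    (fun a _ => comp_filter_mem_degLE hg _)
  refine ⟨s + e2, Q, ?_, hQ, ?_⟩
  · push_cast
    have h1 : R1 * (1 + √((N : ℝ) / m)) ≤ 64 * (√M + 1) * R := by
      have h2 : R1 ≤ 64 * √M * R := by
        rw [hR1', hR, mul_assoc 64 (√(M : ℝ)), ← Real.sqrt_mul (by positivity)]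
        refine mul_le_mul_of_nonneg_left (Real.sqrt_le_sqrt ?_) (by norm_num)
        calc (M : ℝ) * s * d ≤ M * N * d := by gcongr
          _ = _ := by ring
      have h3 : R1 * √((N : ℝ) / m) = 64 * R := by
        rw [hR1', mul_assoc, ← Real.sqrt_mul (by positivity), hR, hm']
        congr 2
        field_simp
      calc _ = R1 + R1 * √((N : ℝ) / m) := by ring
        _ ≤ 64 * √M * R + 64 * R := add_le_add h2 h3.le
        _ = _ := by ring
    have h2 : 3 * ((e1 : ℝ) + h) * (1 + √((N : ℝ) / m)) ≤
        3 * (C + 2) * (R1 * (1 + √((N : ℝ) / m))) := by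
      have h3 : (e1 : ℝ) + h ≤ (C + 2) * R1 := by linarith
      have h4 : 0 ≤ 1 + √((N : ℝ) / m) := by positivity
      calc _ ≤ 3 * ((C + 2) * R1) * (1 + √((N : ℝ) / m)) := by gcongr
        _ = _ := by ring
    have h3 : 3 * (C + 2) * (R1 * (1 + √((N : ℝ) / m))) ≤ 3 * (C + 2) * (64 * (√M + 1) * R) := by
      gcongr
    calc (s : ℝ) + e2 ≤ 2 * R + 3 * (C + 2) * (64 * (√M + 1) * R) :=
          add_le_add hs2R (he2.trans (h2.trans h3))
      _ = _ := by ring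
  intro X hXN
  obtain ⟨w, hw0, hw2, hw1, hws, hQeq⟩ := hQX X hXN
  have hrest : ∀ a, (rest col a X).card ≤ N := fun a =>
    (Finset.card_le_card (Finset.filter_subset _ _)).trans hXN
  set δ' := ((d : ℝ) / N1) ^ densityExponent K with hδ'
  have hN10 : (0 : ℝ) < N1 := by rw [hN1']; positivity
  have hδ'0 : 0 < δ' := Real.rpow_pos_of_pos (by positivity) _
  have hδ'1 : δ' ≤ 1 := Real.rpow_le_one (by positivity)
    ((div_le_one hN10).mpr (by exact_mod_cast hdN1)) (densityExponent_nonneg hK)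
  clear_value δ'
  have hqA : ∀ Z : Finset ι, Z.card ≤ N1 → |q Z| ≤ A := fun Z hZ => by
    exact (hqX Z hZ).2.trans
      (mul_le_of_le_one_right (by linarith) (decay_le_one (by positivity)))
  constructor
  · intro hXe
    have hga : ∀ a ∈ X.powerset, w a * |g (rest col a X) - 1| ≤ w a * (3 * A * (1 / 2) ^ d) := by
      intro a ha
      rcases Nat.lt_or_ge s a.card with has | has
      · rw [hws a has, zero_mul, zero_mul]
      · refine mul_le_mul_of_nonneg_left ?_ (hw0 a)
        have hYm : (rest col a X).card ≤ m :=
          (card_rest_le hXe).trans ((Nat.mul_le_mul hKM has).trans hm.ge)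
        have hYe := heavyCols_rest_eq_empty hK (Finset.mem_powerset.mp ha) hXe
        have h1 := hg1 _ (hrest a) hYm
        have h2 := hqA (rest col a X) (by omega)
        have h3 := (hqX (rest col a X) (by omega)).1 hYe
        have h4 : (1 / 2 : ℝ) ^ h ≤ (1 / 2) ^ d :=
          pow_le_pow_of_le_one (by norm_num) (by norm_num) hdh
        have h5 : (1 / 2 : ℝ) ^ h * |q (rest col a X)| ≤ (1 / 2) ^ d * A := by gcongr
        have h6 := abs_sub_le (g (rest col a X)) (q (rest col a X)) 1
        have h7 : 0 ≤ A * (1 / 2 : ℝ) ^ d := by positivity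
        linarith
    have heq : Q X - 1 = ∑ a ∈ X.powerset, w a * (g (rest col a X) - 1) := by
      simp only [mul_sub, Finset.sum_sub_distrib, mul_one]
      rw [hw1, hQeq]
    rw [heq]
    calc _ ≤ ∑ a ∈ X.powerset, |w a * (g (rest col a X) - 1)| := Finset.abs_sum_le_sum_abs _ _
      _ ≤ ∑ a ∈ X.powerset, w a * (3 * A * (1 / 2) ^ d) := by
          refine Finset.sum_le_sum fun a ha => ?_
          rw [abs_mul, abs_of_nonneg (hw0 a)]
          exact hga a ha
      _ = _ := by rw [← Finset.sum_mul, hw1, one_mul]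
  · set t : ℝ := ((heavyCols col (K + 1) X).card : ℝ) with ht
    have ht0 : 0 ≤ t := Nat.cast_nonneg _
    set V := c1 * δ * t with hV
    have hV0 : 0 ≤ V := by positivity
    set B := c * δ' with hB
    have hB0 : 0 ≤ B := by positivity
    have hB1 : B ≤ 1 := mul_le_one₀ hc1 hδ'0.le hδ'1
    clear_value t V B
    have hgY : ∀ a, a.card ≤ s → |g (rest col a X)| ≤
        A * decay d (B * (heavyCols col K (rest col a X)).card) := by
      intro a has
      set Y := rest col a X with hY
      have hvs : ((heavyCols col K Y).card : ℝ) ≤ s := by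
        exact_mod_cast (card_heavyCols_rest_le col hK a X).trans has
      rcases Nat.lt_or_ge (4096 * m) Y.card with h1 | h1
      · have h2 := hg3 Y (hrest a) h1 A fun Z _ hZ => hqA Z (hZ.trans hN1.ge)
        have h3 : B * (heavyCols col K Y).card ≤ s := by
          exact (mul_le_of_le_one_left (Nat.cast_nonneg _) hB1).trans hvs
        have h4 : (1 / 2 : ℝ) ^ h ≤ decay d s := by
          refine half_pow_le_decay hd hs0.le (le_trans ?_ hhR)
          rw [hR1']
          have h5 : √((s : ℝ) * d) ≤ √(M * s * d) := by
            refine Real.sqrt_le_sqrt ?_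
            rw [mul_assoc]
            exact le_mul_of_one_le_left (by positivity) hM1'
          linarith [Real.sqrt_nonneg ((M : ℝ) * s * d)]
        have h5 := decay_antitone (d := d) (by positivity) h3
        have h6 : (1 / 2 : ℝ) ^ h ≤ decay d (B * (heavyCols col K Y).card) := h4.trans h5
        rw [mul_comm] at h2
        exact h2.trans (mul_le_mul_of_nonneg_left h6 (by linarith))
      · exact (hg2 Y (hrest a) h1).trans (hqX Y (h1.trans hN1.ge)).2
    have hfew := sum_keepWeight_few_heavyCols col hδ0 hδ2 (K := K) X V
    have hexp : (2 : ℝ) ^ V * Real.exp (-(δ / 2 ^ (K + 1) * (heavyCols col (K + 1) X).card)) ≤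
        decay d (B * V) := by
      have h1 : (2 : ℝ) ^ V ≤ Real.exp V := by
        rw [← Real.exp_one_rpow]
        refine Real.rpow_le_rpow (by norm_num) ?_ hV0
        have := Real.add_one_le_exp (1 : ℝ)
        linarith
      have h2 : δ / 2 ^ (K + 1) * t = 4 * V := by
        rw [hV, hc1def]
        field_simp
        ring
      calc _ ≤ Real.exp V * Real.exp (-(4 * V)) := by
            rw [← ht, h2]
            gcongr
        _ = Real.exp (V + -(4 * V)) := (Real.exp_add _ _).symm
        _ ≤ Real.exp (-V) := Real.exp_le_exp.mpr (by linarith)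
        _ ≤ decay d V := exp_neg_le_decay hV0
        _ ≤ decay d (B * V) := decay_antitone (by positivity) (mul_le_of_le_one_left hV0 hB1)
    have hsum : |Q X| ≤ 3 * A * decay d (B * V) := by
      rw [hQeq]
      refine abs_sum_mul_le_decay X.powerset (by linarith) hB0 hV0 (fun _ => Nat.cast_nonneg _) hw0
        hw2 hw1 (fun a ha => hgY a ?_) (hfew.trans hexp)
      by_contra has
      exact ha (hws a (by omega))
    refine hsum.trans (mul_le_mul_of_nonneg_left (decay_antitone ?_ ?_) (by linarith))
    · positivity
    · have h1 := rpow_densityExponent_succ_le hK hd0 hN0 hM1' hs0 (hR ▸ hsR) (hR ▸ hs2R)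
      rw [← hN1', ← hδ', ← hδ] at h1
      calc c * c1 / (16384 * M) * ((d : ℝ) / N) ^ densityExponent (K + 1) * t
          = c * c1 * (((d : ℝ) / N) ^ densityExponent (K + 1) / (16384 * M)) * t := by ring
        _ ≤ c * c1 * (δ' * δ) * t :=
            mul_le_mul_of_nonneg_right (mul_le_mul_of_nonneg_left h1 (by positivity)) ht0
        _ = B * V := by rw [hB, hV]; ring

theorem exists_hasDetectors {K : ℕ} (hK : 1 ≤ K) :
    ∃ C A c : ℝ, 1 ≤ C ∧ 1 ≤ A ∧ 0 < c ∧ c ≤ 1 ∧ HasDetectors K C A c := by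
  induction K, hK using Nat.le_induction with
  | base => exact hasDetectors_one
  | succ K hK ih =>
    obtain ⟨C, A, c, hC, hA, hc, hc1, H⟩ := ih
    exact H.succ hK hC hA hc hc1

end Detector

section Patterns

variable {ι : Type*} {κ : Type*} [Fintype κ] [DecidableEq κ]

/-- The choices of `K` elements of `X` in each of the columns `S`. -/
def patterns (col : ι → κ) (K : ℕ) (S : Finset κ) (X : Finset ι) : Finset (κ → Finset ι) :=
  Fintype.piFinset fun j => if j ∈ S then (X.filter (col · = j)).powersetCard K else {∅}

theorem patterns_eq_empty {col : ι → κ} {K : ℕ} {S : Finset κ} {X : Finset ι}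
    (h : ¬ S ⊆ heavyCols col K X) : patterns col K S X = ∅ := by
  obtain ⟨j, hj, hj'⟩ := Finset.not_subset.mp h
  rw [mem_heavyCols] at hj'
  refine Finset.eq_empty_of_forall_notMem fun β hβ => ?_
  have := Fintype.mem_piFinset.mp hβ j
  rw [if_pos hj, Finset.powersetCard_eq_empty.mpr (by omega)] at this
  simp at this

variable [DecidableEq ι]

/-- The elements of `W` outside `b` that precede some element of `b`. -/
def preceding (ord : ι → ℕ) (b W : Finset ι) : Finset ι :=
  W.filter fun e => e ∉ b ∧ ∃ f ∈ b, ord e < ord f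

theorem preceding_empty (ord : ι → ℕ) (W : Finset ι) : preceding ord ∅ W = ∅ := by
  simp [preceding]

/-- The generating function of the number of omitted preceding elements. -/
noncomputable def patternSum (ord : ι → ℕ) (y : ℝ) (K : ℕ) (W : Finset ι) : ℝ :=
  ∑ b ∈ W.powersetCard K, y ^ (preceding ord b W).card

theorem patternSum_zero (ord : ι → ℕ) (y : ℝ) (W : Finset ι) : patternSum ord y 0 W = 1 := by
  simp [patternSum, preceding_empty]

theorem patternSum_insert {ord : ι → ℕ} (y : ℝ) (K : ℕ) {x : ι} {W : Finset ι} (hx : x ∉ W)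
    (hmin : ∀ z ∈ W, ord x < ord z) :
    patternSum ord y (K + 1) (insert x W) =
      y * patternSum ord y (K + 1) W + patternSum ord y K W := by
  have hdisj : Disjoint (W.powersetCard (K + 1)) ((W.powersetCard K).image (insert x)) := by
    refine Finset.disjoint_left.mpr fun b hb hb' => ?_
    obtain ⟨c, -, rfl⟩ := Finset.mem_image.mp hb'
    exact hx ((Finset.mem_powersetCard.mp hb).1 (Finset.mem_insert_self x c))
  rw [patternSum, Finset.powersetCard_succ_insert hx, Finset.sum_union hdisj, patternSum,
    Finset.mul_sum, patternSum, Finset.sum_image]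
  · congr 1
    · refine Finset.sum_congr rfl fun b hb => ?_
      have hb' := Finset.mem_powersetCard.mp hb
      obtain ⟨f, hf⟩ := Finset.card_pos.mp (by omega : 0 < b.card)
      have : preceding ord b (insert x W) = insert x (preceding ord b W) := by
        rw [preceding, Finset.filter_insert, if_pos]
        · rfl
        · exact ⟨fun h => hx (hb'.1 h), f, hf, hmin f (hb'.1 hf)⟩
      rw [this, Finset.card_insert_of_notMem, pow_succ']
      exact fun h => hx (Finset.mem_filter.mp h).1
    · refine Finset.sum_congr rfl fun b hb => ?_
      have hb' := Finset.mem_powersetCard.mp hb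
      congr 2
      ext e
      simp only [preceding, Finset.mem_filter, Finset.mem_insert, not_or, exists_eq_or_imp]
      constructor
      · rintro ⟨h1, ⟨h2, h3⟩, h4⟩
        have he : e ∈ W := h1.resolve_left h2
        refine ⟨he, h3, h4.resolve_left ?_⟩
        have := hmin e he
        omega
      · rintro ⟨h1, h2, h3⟩
        exact ⟨Or.inr h1, ⟨fun h => hx (h ▸ h1), h2⟩, Or.inr h3⟩
  · intro b hb c hc hbc
    have hb' := Finset.mem_powersetCard.mp hb
    have hc' := Finset.mem_powersetCard.mp hc
    have h1 := Finset.erase_insert (fun h => hx (hb'.1 h) : x ∉ b)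
    have h2 := Finset.erase_insert (fun h => hx (hc'.1 h) : x ∉ c)
    rw [← h1, ← h2]
    exact congrArg (Finset.erase · x) hbc

theorem exists_insert_min {ord : ι → ℕ} (hord : Function.Injective ord) {W : Finset ι} {w : ℕ}
    (hW : W.card = w + 1) :
    ∃ x W', x ∉ W' ∧ (∀ z ∈ W', ord x < ord z) ∧ W'.card = w ∧ W = insert x W' := by
  obtain ⟨x, hx, hmin⟩ := Finset.exists_min_image W ord (Finset.card_pos.mp (by omega))
  refine ⟨x, W.erase x, Finset.notMem_erase x W, fun z hz => ?_, ?_, ?_⟩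
  · have hz' := Finset.mem_erase.mp hz
    exact lt_of_le_of_ne (hmin z hz'.2) fun h => hz'.1 (hord h).symm
  · rw [Finset.card_erase_of_mem hx, hW, Nat.add_sub_cancel]
  · exact (Finset.insert_erase hx).symm

theorem patternSum_at_zero {ord : ι → ℕ} (hord : Function.Injective ord) {K : ℕ} :
    ∀ {W : Finset ι}, K ≤ W.card → patternSum ord 0 K W = 1 := by
  induction K with
  | zero => intro W _; exact patternSum_zero ord 0 W
  | succ K ih =>
    intro W hW
    obtain ⟨x, W', hx, hmin, hc, rfl⟩ := exists_insert_min hord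
      (show W.card = (W.card - 1) + 1 by omega)
    rw [patternSum_insert 0 K hx hmin, zero_mul, zero_add]
    exact ih (by omega)

theorem patternSum_le {ord : ι → ℕ} (hord : Function.Injective ord) {y : ℝ} (h0 : 0 ≤ y)
    (h1 : y < 1) (K : ℕ) : ∀ W : Finset ι, patternSum ord y K W ≤ ((1 - y)⁻¹) ^ K := by
  have hy : 0 < 1 - y := by linarith
  induction K with
  | zero => intro W; rw [patternSum_zero, pow_zero]
  | succ K ih =>
    intro W
    obtain ⟨w, hw⟩ : ∃ w, W.card = w := ⟨_, rfl⟩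
    induction w generalizing W with
    | zero =>
      rw [Finset.card_eq_zero.mp hw, patternSum, Finset.powersetCard_eq_empty.mpr (by simp)]
      simp only [Finset.sum_empty]
      positivity
    | succ w ihw =>
      obtain ⟨x, W', hx, hmin, hc, rfl⟩ := exists_insert_min hord hw
      rw [patternSum_insert y K hx hmin]
      calc y * patternSum ord y (K + 1) W' + patternSum ord y K W'
          ≤ y * (1 - y)⁻¹ ^ (K + 1) + (1 - y)⁻¹ ^ K := by
            gcongr
            · exact ihw W' hc
            · exact ih W'
        _ = _ := by
            rw [pow_succ]
            field_simp
            ring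

theorem patternSum_nonneg (ord : ι → ℕ) {y : ℝ} (h0 : 0 ≤ y) (K : ℕ) (W : Finset ι) :
    0 ≤ patternSum ord y K W :=
  Finset.sum_nonneg fun _ _ => pow_nonneg h0 _

/-- The total number of omitted preceding elements of a pattern. -/
def patternGap (ord : ι → ℕ) (col : ι → κ) (β : κ → Finset ι) (X : Finset ι) : ℕ :=
  ∑ j, (preceding ord (β j) (X.filter (col · = j))).card

theorem patternGap_le (ord : ι → ℕ) (col : ι → κ) (β : κ → Finset ι) (X : Finset ι) :
    patternGap ord col β X ≤ X.card := by
  rw [Finset.card_eq_sum_card_fiberwise (f := col) (t := Finset.univ) (by simp)]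
  exact Finset.sum_le_sum fun j _ => Finset.card_le_card (Finset.filter_subset _ _)

theorem sum_patterns_pow (ord : ι → ℕ) (col : ι → κ) (K : ℕ) (S : Finset κ) (X : Finset ι)
    (y : ℝ) : ∑ β ∈ patterns col K S X, y ^ patternGap ord col β X =
      ∏ j ∈ S, patternSum ord y K (X.filter (col · = j)) := by
  simp only [patternGap, ← Finset.prod_pow_eq_pow_sum]
  rw [patterns, ← Finset.prod_univ_sum (fun j => if j ∈ S then
    (X.filter (col · = j)).powersetCard K else {∅})
    (fun j b => y ^ (preceding ord b (X.filter (col · = j))).card),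
    ← Finset.prod_subset (Finset.subset_univ S)]
  · refine Finset.prod_congr rfl fun j hj => ?_
    rw [if_pos hj, patternSum]
  · intro j _ hj
    rw [if_neg hj, Finset.sum_singleton, preceding_empty, Finset.card_empty, pow_zero]

theorem sum_patterns_zero_pow {ord : ι → ℕ} (hord : Function.Injective ord) {col : ι → κ} {K : ℕ}
    {S : Finset κ} {X : Finset ι} (h : S ⊆ heavyCols col K X) :
    ∑ β ∈ patterns col K S X, (0 : ℝ) ^ patternGap ord col β X = 1 := by
  rw [sum_patterns_pow]
  exact Finset.prod_eq_one fun j hj => patternSum_at_zero hord (mem_heavyCols.mp (h hj))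

theorem card_patterns_le {ord : ι → ℕ} (hord : Function.Injective ord) (col : ι → κ) {K D v : ℕ}
    {S : Finset κ} (X : Finset ι) (hD : 1 ≤ D) (hv : D ≤ v) (hS : K * S.card ≤ D) :
    (((patterns col K S X).filter (fun β => patternGap ord col β X = v)).card : ℝ) ≤
      Real.exp D * (2 * v / D) ^ D := by
  have hD0 : (0 : ℝ) < D := by exact_mod_cast hD
  have hvD : (D : ℝ) ≤ v := by exact_mod_cast hv
  have hv0 : (0 : ℝ) < v := by linarith
  set x : ℝ := D / (2 * v) with hx
  have hx0 : 0 < x := by positivity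
  have hx2 : x ≤ 1 / 2 := by
    rw [hx, div_le_div_iff₀ (by positivity) (by norm_num)]
    linarith
  have h1x : 0 ≤ 1 - x := by linarith
  have hexp : Real.exp (-(2 * x)) ≤ 1 - x := by
    rw [Real.exp_neg, inv_le_comm₀ (Real.exp_pos _) (by linarith)]
    refine le_trans ?_ (Real.add_one_le_exp (2 * x))
    rw [inv_le_iff_one_le_mul₀ (by linarith)]
    nlinarith
  have h2 : Real.exp (-D) ≤ (1 - x) ^ v := by
    calc Real.exp (-D) = Real.exp (-(2 * x)) ^ v := by
          rw [← Real.exp_nat_mul]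
          congr 1
          rw [hx]
          field_simp
      _ ≤ (1 - x) ^ v := pow_le_pow_left₀ (Real.exp_pos _).le hexp v
  have h3 : (((patterns col K S X).filter (fun β => patternGap ord col β X = v)).card : ℝ) *
      (1 - x) ^ v ≤ (2 * v / D) ^ D := by
    calc _ = ∑ β ∈ (patterns col K S X).filter (fun β => patternGap ord col β X = v),
          (1 - x) ^ patternGap ord col β X := by
          rw [← nsmul_eq_mul, ← Finset.sum_const]
          exact Finset.sum_congr rfl fun β hβ => by rw [(Finset.mem_filter.mp hβ).2]
      _ ≤ ∑ β ∈ patterns col K S X, (1 - x) ^ patternGap ord col β X :=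
          Finset.sum_le_sum_of_subset_of_nonneg (Finset.filter_subset _ _) fun _ _ _ =>
            pow_nonneg h1x _
      _ = ∏ j ∈ S, patternSum ord (1 - x) K (X.filter (col · = j)) := sum_patterns_pow _ _ _ _ _ _
      _ ≤ ∏ j ∈ S, ((1 - (1 - x))⁻¹) ^ K := Finset.prod_le_prod
          (fun j _ => patternSum_nonneg ord h1x K _)
          (fun j _ => patternSum_le hord h1x (by linarith) K _)
      _ = (2 * v / D) ^ (K * S.card) := by
          rw [Finset.prod_const, ← pow_mul, sub_sub_cancel, hx, inv_div]
      _ ≤ (2 * v / D) ^ D := by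
          refine pow_le_pow_right₀ ?_ hS
          rw [le_div_iff₀ hD0]
          linarith
  have h4 : Real.exp D * Real.exp (-D) = 1 := by rw [← Real.exp_add]; simp
  set c := (((patterns col K S X).filter (fun β => patternGap ord col β X = v)).card : ℝ)
  have hc : 0 ≤ c := Nat.cast_nonneg _
  calc c = Real.exp D * (c * Real.exp (-D)) := by rw [mul_left_comm, h4, mul_one]
    _ ≤ Real.exp D * (c * (1 - x) ^ v) := by gcongr
    _ ≤ _ := by gcongr

theorem sum_sq_inv_Ioc_le {D : ℕ} (hD : 1 ≤ D) (N : ℕ) :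
    ∑ v ∈ Finset.Ioc D N, ((D : ℝ) / v) ^ 2 ≤ D := by
  have hD0 : (0 : ℝ) < D := by exact_mod_cast hD
  rcases Nat.lt_or_ge N D with h | h
  · rw [Finset.Ioc_eq_empty (by omega)]
    simp
  · have key : ∀ M, D ≤ M → ∑ v ∈ Finset.Ioc D M, ((D : ℝ) / v) ^ 2 ≤ D - D ^ 2 / M := by
      intro M hM
      induction M, hM using Nat.le_induction with
      | base =>
        simp only [Finset.Ioc_self, Finset.sum_empty]
        rw [sq, mul_div_assoc, div_self hD0.ne', mul_one, sub_self]
      | succ M hM ih =>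
        rw [← Finset.insert_Ioc_right_eq_Ioc_add_one (by omega), Finset.sum_insert (by simp)]
        have hM0 : (0 : ℝ) < M := by
          have : 0 < M := by omega
          exact_mod_cast this
        have : ((D : ℝ) / (M + 1 : ℕ)) ^ 2 ≤ D ^ 2 / M - D ^ 2 / (M + 1 : ℕ) := by
          push_cast
          rw [div_pow, div_sub_div _ _ hM0.ne' (by positivity), div_le_div_iff₀ (by positivity)
            (by positivity)]
          have : (0 : ℝ) ≤ D ^ 2 * (M + 1) := by positivity
          nlinarith
        linarith
    have : (0 : ℝ) ≤ D ^ 2 / N := by positivity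
    linarith [key N h]

end Patterns

section Conjunction

open Polynomial

variable {ι κ : Type*} [Fintype ι] [DecidableEq ι] [Fintype κ] [DecidableEq κ]

/-- An approximation, based on the polynomial `ν`, to the indicator function of the event that all
columns in `S` contain at least `K` elements. -/
noncomputable def heavyIndicator (ord : ι → ℕ) (col : ι → κ) (K : ℕ) (ν : ℝ[X]) (S : Finset κ) :
    Finset ι → ℝ :=
  ∑ β ∈ patterns col K S Finset.univ,
    cubeMonomial (Finset.univ.biUnion β) * fun X => ν.eval (patternGap ord col β X : ℝ)

theorem heavyIndicator_mem_degLE (ord : ι → ℕ) (col : ι → κ) (K : ℕ) (ν : ℝ[X]) (S : Finset κ) :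
    heavyIndicator ord col K ν S ∈ degLE ι (K * S.card + ν.natDegree) := by
  refine Submodule.sum_mem _ fun β hβ => mul_mem_degLE (cubeMonomial_mem ?_) ?_
  · have hc : ∀ j, (β j).card = if j ∈ S then K else 0 := by
      intro j
      have := Fintype.mem_piFinset.mp hβ j
      split_ifs at this ⊢
      · exact (Finset.mem_powersetCard.mp this).2
      · rw [Finset.mem_singleton.mp this, Finset.card_empty]
    refine Finset.card_biUnion_le.trans (le_of_eq ?_)
    rw [Finset.sum_congr rfl fun j _ => hc j, Finset.sum_ite_mem, Finset.univ_inter,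
      Finset.sum_const, smul_eq_mul, mul_comm]
  · refine eval_mem_degLE ?_ ν
    have : (fun X : Finset ι => (patternGap ord col β X : ℝ)) = ∑ j, fun X : Finset ι =>
        ((preceding ord (β j) (X.filter (col · = j))).card : ℝ) := by
      funext X
      rw [Finset.sum_apply, patternGap, Nat.cast_sum]
    rw [this]
    refine Submodule.sum_mem _ fun j _ => ?_
    exact comp_filter_mem_degLE (card_filter_mem_degLE
      (fun e => e ∉ β j ∧ ∃ f ∈ β j, ord e < ord f)) (col · = j)

theorem heavyIndicator_apply (ord : ι → ℕ) (col : ι → κ) (K : ℕ) (ν : ℝ[X]) (S : Finset κ)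
    (X : Finset ι) : heavyIndicator ord col K ν S X =
      ∑ β ∈ patterns col K S X, ν.eval (patternGap ord col β X : ℝ) := by
  have h : patterns col K S X =
      (patterns col K S Finset.univ).filter (fun β => Finset.univ.biUnion β ⊆ X) := by
    ext β
    simp only [patterns, Finset.mem_filter, Fintype.mem_piFinset, Finset.biUnion_subset,
      Finset.mem_univ, true_imp_iff, ← forall_and]
    refine forall_congr' fun j => ?_
    split_ifs
    · simp only [Finset.mem_powersetCard, Finset.subset_iff, Finset.mem_filter, Finset.mem_univ,
        true_and]
      constructor
      · rintro ⟨h1, h2⟩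
        exact ⟨⟨fun x hx => (h1 hx).2, h2⟩, fun x hx => (h1 hx).1⟩
      · rintro ⟨⟨h1, h2⟩, h3⟩
        exact ⟨fun x hx => ⟨h3 hx, h1 hx⟩, h2⟩
    · simp only [Finset.mem_singleton]
      exact ⟨fun h => ⟨h, h ▸ Finset.empty_subset X⟩, fun h => h.1⟩
  rw [h, Finset.sum_filter, heavyIndicator, Finset.sum_apply]
  refine Finset.sum_congr rfl fun β _ => ?_
  simp [cubeMonomial]

theorem heavyIndicator_eq_zero {ord : ι → ℕ} {col : ι → κ} {K : ℕ} {ν : ℝ[X]} {S : Finset κ}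
    {X : Finset ι} (h : ¬ S ⊆ heavyCols col K X) : heavyIndicator ord col K ν S X = 0 := by
  rw [heavyIndicator_apply, patterns_eq_empty h, Finset.sum_empty]

theorem abs_heavyIndicator_sub_one_le {ord : ι → ℕ} (hord : Function.Injective ord) {col : ι → κ}
    {K D N : ℕ} (hD : 1 ≤ D) {ν : ℝ[X]} (h0 : ν.eval 0 = 1)
    (hz : ∀ v : ℕ, 1 ≤ v → v ≤ D → ν.eval (v : ℝ) = 0)
    (hdec : ∀ v : ℕ, D < v → v ≤ N →
      |ν.eval (v : ℝ)| ≤ (1 / 1500) ^ D * ((D : ℝ) / v) ^ (3 * D))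
    {S : Finset κ} (hS : K * S.card ≤ D) {X : Finset ι} (hX : X.card ≤ N)
    (h : S ⊆ heavyCols col K X) :
    |heavyIndicator ord col K ν S X - 1| ≤ (1 / 2) ^ (7 * D) := by
  have hD0 : (0 : ℝ) < D := by exact_mod_cast hD
  have heq : heavyIndicator ord col K ν S X - 1 = ∑ β ∈ patterns col K S X,
      (ν.eval (patternGap ord col β X : ℝ) - (0 : ℝ) ^ patternGap ord col β X) := by
    rw [Finset.sum_sub_distrib, sum_patterns_zero_pow hord h, heavyIndicator_apply]
  rw [heq]
  set u := fun β => patternGap ord col β X with hu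
  set T := (patterns col K S X).filter (fun β => D < u β) with hT
  have hterm : ∀ β ∈ patterns col K S X, β ∉ T → ν.eval (u β : ℝ) - (0 : ℝ) ^ u β = 0 := by
    intro β hβ hβT
    have hle : u β ≤ D := by
      by_contra hlt
      exact hβT (Finset.mem_filter.mpr ⟨hβ, by omega⟩)
    rcases Nat.eq_zero_or_pos (u β) with h1 | h1
    · rw [h1, Nat.cast_zero, h0, pow_zero, sub_self]
    · rw [hz _ h1 hle, zero_pow (by omega), sub_self]
  rw [← Finset.sum_subset (Finset.filter_subset (fun β => D < u β) _) hterm]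
  have hmaps : ∀ β ∈ T, u β ∈ Finset.Ioc D N := fun β hβ =>
    Finset.mem_Ioc.mpr ⟨(Finset.mem_filter.mp hβ).2, (patternGap_le _ _ _ _).trans hX⟩
  set ω : ℕ → ℝ := fun v => (1 / 1500) ^ D * ((D : ℝ) / v) ^ (3 * D) with hω
  have hω0 : ∀ v, 0 ≤ ω v := fun v => by positivity
  calc |∑ β ∈ T, (ν.eval (u β : ℝ) - (0 : ℝ) ^ u β)|
      ≤ ∑ β ∈ T, |ν.eval (u β : ℝ) - (0 : ℝ) ^ u β| := Finset.abs_sum_le_sum_abs _ _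
    _ ≤ ∑ β ∈ T, ω (u β) := by
        refine Finset.sum_le_sum fun β hβ => ?_
        have h1 := Finset.mem_Ioc.mp (hmaps β hβ)
        rw [zero_pow (by omega), sub_zero]
        exact hdec _ h1.1 h1.2
    _ = ∑ v ∈ Finset.Ioc D N, ∑ β ∈ T with u β = v, ω (u β) :=
        (Finset.sum_fiberwise_of_maps_to hmaps _).symm
    _ ≤ ∑ v ∈ Finset.Ioc D N, (2 * Real.exp 1 / 1500) ^ D * ((D : ℝ) / v) ^ 2 := by
        refine Finset.sum_le_sum fun v hv => ?_
        have hv' := Finset.mem_Ioc.mp hv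
        have hvD : (D : ℝ) ≤ v := by exact_mod_cast hv'.1.le
        have hv0 : (0 : ℝ) < v := by linarith
        have hcard : ((T.filter (fun β => u β = v)).card : ℝ) ≤ Real.exp D * (2 * v / D) ^ D := by
          refine le_trans ?_ (card_patterns_le hord col X hD hv'.1.le hS)
          exact_mod_cast Finset.card_le_card
            (Finset.filter_subset_filter _ (Finset.filter_subset _ _))
        have hr : ((D : ℝ) / v) ^ (2 * D) ≤ (D / v) ^ 2 :=
          pow_le_pow_of_le_one (by positivity) ((div_le_one hv0).mpr hvD) (by omega)
        have hexp : Real.exp D = Real.exp 1 ^ D := by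
          rw [← Real.exp_nat_mul, mul_one]
        calc ∑ β ∈ T with u β = v, ω (u β)
            = (T.filter (fun β => u β = v)).card * ω v := by
              rw [← nsmul_eq_mul, ← Finset.sum_const]
              exact Finset.sum_congr rfl fun β hβ => by rw [(Finset.mem_filter.mp hβ).2]
          _ ≤ (Real.exp D * (2 * v / D) ^ D) * ω v := mul_le_mul_of_nonneg_right hcard (hω0 v)
          _ = (2 * Real.exp 1 / 1500) ^ D * (D / v) ^ (2 * D) := by
              simp only [hω]
              rw [hexp, pow_mul, pow_mul, ← mul_pow, ← mul_pow, ← mul_pow, ← mul_pow]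
              congr 1
              field_simp
          _ ≤ _ := by gcongr
    _ ≤ (2 * Real.exp 1 / 1500) ^ D * 2 ^ D := by
        rw [← Finset.mul_sum]
        refine mul_le_mul_of_nonneg_left ((sum_sq_inv_Ioc_le hD N).trans ?_) (by positivity)
        exact_mod_cast Nat.lt_two_pow_self.le
    _ ≤ (1 / 2) ^ (7 * D) := by
        rw [pow_mul, ← mul_pow]
        refine pow_le_pow_left₀ (by positivity) ?_ D
        have := Real.exp_one_lt_d9
        norm_num
        linarith

/-- A polynomial in the number of heavy columns can be approximated at the cost of additional
degree that depends only on the size of the input. -/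
theorem exists_comp_card_heavyCols : ∃ C : ℝ, 1 ≤ C ∧ ∀ (ι κ : Type) [Fintype ι] [DecidableEq ι]
    [Fintype κ] [DecidableEq κ] (col : ι → κ) (K D N : ℕ) (p : ℝ[X]), 1 ≤ D → D ≤ N →
    K * p.natDegree ≤ D → ∃ (e : ℕ) (P : Finset ι → ℝ), (e : ℝ) ≤ C * √((N : ℝ) * D) ∧
      P ∈ degLE ι e ∧ ∀ X : Finset ι, X.card ≤ N →
        |P X - p.eval ((heavyCols col K X).card : ℝ)| ≤
          (1 / 2) ^ (7 * D) * (absPoly p).eval ((heavyCols col K X).card : ℝ) := by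
  obtain ⟨C, hC, hν⟩ := exists_nor_poly
  refine ⟨C + 1, by linarith, ?_⟩
  intro ι κ _ _ _ _ col K D N p hD hDN hp
  obtain ⟨ν, hdeg, h0, hz, hdec, -⟩ := hν D N hD hDN
  obtain ⟨ord, hord⟩ : ∃ ord : ι → ℕ, Function.Injective ord :=
    ⟨fun i => Fintype.equivFin ι i, fun i j h => (Fintype.equivFin ι).injective (Fin.ext h)⟩
  refine ⟨D + ν.natDegree, ∑ l ∈ Finset.range (p.natDegree + 1), p.coeff l •
    ∑ J : Fin l → κ, heavyIndicator ord col K ν (Finset.univ.image J), ?_, ?_, ?_⟩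
  · push_cast
    have : (D : ℝ) ≤ √((N : ℝ) * D) := Real.le_sqrt_of_sq_le (by
      rw [sq]
      exact mul_le_mul_of_nonneg_right (by exact_mod_cast hDN) (Nat.cast_nonneg _))
    linarith
  · refine Submodule.sum_mem _ fun l hl => Submodule.smul_mem _ _ (Submodule.sum_mem _ fun J _ =>
      degLE_mono (Nat.add_le_add_right ?_ _) (heavyIndicator_mem_degLE ord col K ν _))
    have hl' : l ≤ p.natDegree := Nat.lt_succ_iff.mp (Finset.mem_range.mp hl)
    have hcard : (Finset.univ.image J).card ≤ l := Finset.card_image_le.trans (by simp)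
    exact (Nat.mul_le_mul_left K (hcard.trans hl')).trans hp
  · intro X hX
    set H := heavyCols col K X with hH
    have hpow : ∀ l : ℕ, ((H.card : ℝ)) ^ l =
        ∑ J : Fin l → κ, if Finset.univ.image J ⊆ H then (1 : ℝ) else 0 := by
      intro l
      rw [← Finset.sum_filter, Finset.sum_const, nsmul_eq_mul, mul_one, ← Nat.cast_pow]
      congr 1
      have : (Finset.univ.filter fun J : Fin l → κ => Finset.univ.image J ⊆ H) =
          Fintype.piFinset fun _ => H := by
        ext J
        simp [Finset.image_subset_iff]
      rw [this, Fintype.card_piFinset_const]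
    rw [eval_eq_sum_range, eval_eq_sum_range, natDegree_absPoly, Finset.sum_apply,
      ← Finset.sum_sub_distrib, Finset.mul_sum]
    refine (Finset.abs_sum_le_sum_abs _ _).trans (Finset.sum_le_sum fun l hl => ?_)
    have hl' : l ≤ p.natDegree := Nat.lt_succ_iff.mp (Finset.mem_range.mp hl)
    rw [Pi.smul_apply, smul_eq_mul, ← mul_sub, abs_mul, coeff_absPoly, mul_left_comm]
    refine mul_le_mul_of_nonneg_left ?_ (abs_nonneg _)
    rw [hpow, Finset.sum_apply, ← Finset.sum_sub_distrib, Finset.mul_sum]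
    refine (Finset.abs_sum_le_sum_abs _ _).trans (Finset.sum_le_sum fun J _ => ?_)
    split_ifs with hJ
    · rw [mul_one]
      have hcard : (Finset.univ.image J).card ≤ l := Finset.card_image_le.trans (by simp)
      exact abs_heavyIndicator_sub_one_le hord hD h0 hz hdec
        ((Nat.mul_le_mul_left K (hcard.trans hl')).trans hp) hX hJ
    · rw [heavyIndicator_eq_zero hJ, sub_zero, abs_zero, mul_zero]

end Conjunction

section FixedSize

open Polynomial

theorem edExponent_eq (K : ℕ) : edExponent K = 1 / (2 * (1 + densityExponent K)) := by
  rw [edExponent, densityExponent, zpow_neg, zpow_natCast, one_div_pow, ← one_div]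
  congr 1
  ring

theorem edExponent_pos {K : ℕ} (hK : 1 ≤ K) : 0 < edExponent K := by
  rw [edExponent_eq]
  have := densityExponent_nonneg hK
  positivity

theorem edExponent_le_half {K : ℕ} (hK : 1 ≤ K) : edExponent K ≤ 1 / 2 := by
  rw [edExponent_eq]
  have := densityExponent_nonneg hK
  rw [div_le_div_iff₀ (by positivity) (by norm_num)]
  linarith

/-- The `K`-element distinctness function on sets of ones. -/
noncomputable def distinctness {ι κ : Type*} [Fintype κ] [DecidableEq κ] (col : ι → κ) (K : ℕ)
    (X : Finset ι) : ℝ := if heavyCols col K X = ∅ then 1 else 0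

theorem exp_mul_half_pow_le (d : ℕ) : (1 / 2 : ℝ) ^ (7 * d) * Real.exp d ≤ (1 / 2) ^ (2 * d) := by
  have h1 : Real.exp d = Real.exp 1 ^ d := by rw [← Real.exp_nat_mul, mul_one]
  rw [h1, pow_mul, pow_mul, ← mul_pow]
  refine pow_le_pow_left₀ (by positivity) ?_ d
  have := Real.exp_one_lt_d9
  norm_num
  linarith

/-- The product of an approximation `P` of `p(t)` and a detector `q` approximates the indicator of
`t = 0`. -/
theorem abs_mul_detector_sub_le {d ℓ a m t : ℕ} {A c δ P q : ℝ} {p : ℝ[X]} (hA : 1 ≤ A)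
    (ha : 3 * A ≤ 2 ^ a) (hc : 0 < c) (hδ : 0 < δ) (hd : 1 ≤ d) (hℓ : 1 ≤ ℓ) (hℓd : ℓ + a ≤ d)
    (hm0 : 1 ≤ m) (hm : 6 / c * (d / δ) ≤ m) (hpd : p.natDegree ≤ d) (hp0 : p.eval 0 = 1)
    (hpz : ∀ v : ℕ, 1 ≤ v → v ≤ ℓ + a → p.eval (v : ℝ) = 0)
    (hpdec : ∀ v : ℕ, ℓ + a < v → v ≤ m →
      |p.eval (v : ℝ)| ≤ (1 / 1500) ^ (ℓ + a) * (((ℓ + a : ℕ) : ℝ) / v) ^ (3 * (ℓ + a)))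
    (hpm : (absPoly p).eval (m : ℝ) ≤ Real.exp d)
    (hP : |P - p.eval (t : ℝ)| ≤ (1 / 2) ^ (7 * d) * (absPoly p).eval (t : ℝ))
    (hq0 : t = 0 → |q - 1| ≤ A * (1 / 2) ^ d) (hq : |q| ≤ A * decay d (c * δ * t)) :
    |P * q - if t = 0 then 1 else 0| ≤ (1 / 2) ^ ℓ := by
  have hd0 : (0 : ℝ) < d := by exact_mod_cast hd
  have hm0' : (0 : ℝ) < m := by exact_mod_cast hm0
  have hA0 : 0 ≤ A := by linarith
  have hfin : ∀ x : ℝ, x ≤ 3 * A * (1 / 2) ^ (ℓ + a) → x ≤ (1 / 2) ^ ℓ := by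
    intro x hx
    refine hx.trans ?_
    have : (2 : ℝ) ^ a * (1 / 2) ^ a = 1 := by rw [← mul_pow]; norm_num
    calc 3 * A * (1 / 2) ^ (ℓ + a) ≤ 2 ^ a * (1 / 2) ^ (ℓ + a) := by gcongr
      _ = (1 / 2) ^ ℓ * (2 ^ a * (1 / 2) ^ a) := by rw [pow_add]; ring
      _ = (1 / 2) ^ ℓ := by rw [this, mul_one]
  have hhalf : (1 / 2 : ℝ) ^ d ≤ (1 / 2) ^ (ℓ + a) :=
    pow_le_pow_of_le_one (by norm_num) (by norm_num) hℓd
  have hx0 : (0 : ℝ) ≤ (1 / 2) ^ d := by positivity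
  have hsmall : t ≤ m → |P - p.eval (t : ℝ)| ≤ 1 / 2 * (1 / 2) ^ d := by
    intro htm
    have h1 : (absPoly p).eval (t : ℝ) ≤ Real.exp d :=
      (absPoly_eval_mono p (Nat.cast_nonneg t) (by exact_mod_cast htm)).trans hpm
    calc |P - p.eval (t : ℝ)| ≤ (1 / 2) ^ (7 * d) * Real.exp d := hP.trans (by gcongr)
      _ ≤ (1 / 2) ^ (2 * d) := exp_mul_half_pow_le d
      _ ≤ (1 / 2) ^ (1 + d) := pow_le_pow_of_le_one (by norm_num) (by norm_num) (by omega)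
      _ = _ := by rw [pow_add, pow_one]
  rcases Nat.eq_zero_or_pos t with rfl | ht
  · rw [if_pos rfl]
    have h1 := hsmall (Nat.zero_le m)
    rw [Nat.cast_zero, hp0] at h1
    have h2 := hq0 rfl
    have hx1 : (1 / 2 : ℝ) ^ d ≤ 1 := pow_le_one₀ (by norm_num) (by norm_num)
    have hP2 : |P| ≤ 2 := by
      have := abs_add_le (P - 1) 1
      rw [sub_add_cancel, abs_one] at this
      linarith
    apply hfin
    have h3 : P * q - 1 = P * (q - 1) + (P - 1) := by ring
    rw [h3]
    have hAx : (1 / 2 : ℝ) ^ d ≤ A * (1 / 2) ^ d := le_mul_of_one_le_left hx0 hA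
    calc |P * (q - 1) + (P - 1)| ≤ |P| * |q - 1| + |P - 1| := by
          rw [← abs_mul]
          exact abs_add_le _ _
      _ ≤ 2 * (A * (1 / 2) ^ d) + 1 / 2 * (1 / 2) ^ d := by gcongr
      _ ≤ 3 * A * (1 / 2) ^ d := by linarith
      _ ≤ _ := by gcongr
  · rw [if_neg (by omega), sub_zero, abs_mul]
    have ht0 : (0 : ℝ) < t := by exact_mod_cast ht
    apply hfin
    rcases Nat.lt_or_ge m t with htm | htm
    · have htm' : (m : ℝ) ≤ t := by exact_mod_cast htm.le
      have hpt : (absPoly p).eval (t : ℝ) ≤ (t / m) ^ d * Real.exp 1 ^ d := by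
        refine (absPoly_eval_le_pow_mul p hpd hm0' htm').trans ?_
        rw [← Real.exp_nat_mul, mul_one]
        gcongr
      have hP2 : |P| ≤ 2 * ((t / m) ^ d * Real.exp 1 ^ d) := by
        have h1 := abs_add_le (P - p.eval (t : ℝ)) (p.eval (t : ℝ))
        rw [sub_add_cancel] at h1
        have h2 := abs_eval_le_absPoly p ht0.le
        have h3 : (1 / 2 : ℝ) ^ (7 * d) * (absPoly p).eval (t : ℝ) ≤ (absPoly p).eval (t : ℝ) :=
          mul_le_of_le_one_left (absPoly_eval_nonneg p ht0.le)
            (pow_le_one₀ (by norm_num) (by norm_num))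
        linarith
      have hdec : decay d (c * δ * t) ≤ (d / (c * δ * t)) ^ d := by
        rw [decay, ← inv_pow]
        refine pow_le_pow_left₀ (by positivity) ?_ d
        rw [inv_le_comm₀ (by positivity) (by positivity), inv_div]
        linarith
      have hbase : t / m * Real.exp 1 * (d / (c * δ * t)) ≤ 1 / 2 := by
        have h1 : t / m * Real.exp 1 * (d / (c * δ * t)) = Real.exp 1 * (d / (c * δ)) / m := by
          field_simp
        have h2 := Real.exp_one_lt_d9
        have h3 : 6 / c * (d / δ) = 6 * (d / (c * δ)) := by field_simp
        rw [h3] at hm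
        have h4 : (0 : ℝ) < d / (c * δ) := by positivity
        rw [h1, div_le_iff₀ hm0']
        calc Real.exp 1 * (d / (c * δ)) ≤ 3 * (d / (c * δ)) := by gcongr; linarith
          _ ≤ 1 / 2 * m := by linarith
      calc |P| * |q| ≤ 2 * ((t / m) ^ d * Real.exp 1 ^ d) * (A * (d / (c * δ * t)) ^ d) := by
            refine mul_le_mul hP2 (hq.trans ?_) (abs_nonneg _) (by positivity)
            exact mul_le_mul_of_nonneg_left hdec hA0
        _ = 2 * A * (t / m * Real.exp 1 * (d / (c * δ * t))) ^ d := by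
            rw [mul_pow, mul_pow]
            ring
        _ ≤ 2 * A * (1 / 2) ^ d := by gcongr
        _ ≤ 3 * A * (1 / 2) ^ (ℓ + a) := by
            have := mul_le_mul_of_nonneg_left hhalf (by linarith : 0 ≤ 2 * A)
            have h0 : 0 ≤ A * (1 / 2 : ℝ) ^ (ℓ + a) := by positivity
            linarith
    · have hpt : |p.eval (t : ℝ)| ≤ (1 / 2) ^ (ℓ + a) := by
        rcases Nat.lt_or_ge (ℓ + a) t with h1 | h1
        · refine (hpdec t h1 htm).trans ?_
          have h2 : (((ℓ + a : ℕ) : ℝ) / t) ^ (3 * (ℓ + a)) ≤ 1 :=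
            pow_le_one₀ (by positivity) ((div_le_one ht0).mpr (by exact_mod_cast h1.le))
          calc _ ≤ (1 / 1500 : ℝ) ^ (ℓ + a) * 1 := by gcongr
            _ ≤ (1 / 2) ^ (ℓ + a) := by
              rw [mul_one]
              exact pow_le_pow_left₀ (by norm_num) (by norm_num) _
        · rw [hpz t ht h1, abs_zero]
          positivity
      have hqA : |q| ≤ A := hq.trans (mul_le_of_le_one_right hA0 (decay_le_one (by positivity)))
      have hP2 : |P| ≤ 2 * (1 / 2) ^ (ℓ + a) := by
        have h1 := abs_add_le (P - p.eval (t : ℝ)) (p.eval (t : ℝ))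
        rw [sub_add_cancel] at h1
        have h2 := hsmall htm
        linarith
      calc |P| * |q| ≤ 2 * (1 / 2) ^ (ℓ + a) * A :=
            mul_le_mul hP2 hqA (abs_nonneg _) (by positivity)
        _ ≤ _ := by
            have h0 : 0 ≤ A * (1 / 2 : ℝ) ^ (ℓ + a) := by positivity
            linarith

set_option maxHeartbeats 1000000 in
theorem exists_approx_distinctness {K : ℕ} (hK : 1 ≤ K) : ∃ C : ℝ, 1 ≤ C ∧
    ∀ (ι κ : Type) [Fintype ι] [DecidableEq ι] [Fintype κ] [DecidableEq κ] (col : ι → κ)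
      (n ℓ : ℕ), 1 ≤ n → 1 ≤ ℓ → ∃ (e : ℕ) (f : Finset ι → ℝ),
      (e : ℝ) ≤ C * ((n : ℝ) ^ (1 - edExponent K) * (ℓ : ℝ) ^ edExponent K + √((n : ℝ) * ℓ)) ∧
      f ∈ degLE ι e ∧ ∀ X : Finset ι, X.card ≤ n → |f X - distinctness col K X| ≤ (1 / 2) ^ ℓ := by
  obtain ⟨Cν, hCν, hν⟩ := exists_nor_poly
  obtain ⟨Cp, hCp, hp⟩ := exists_comp_card_heavyCols
  obtain ⟨Cq, A, c, hCq, hA, hc, hc1, hq⟩ := exists_hasDetectors hK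
  obtain ⟨a, ha⟩ := pow_unbounded_of_one_lt (3 * A) (by norm_num : (1 : ℝ) < 2)
  have hK1 : (1 : ℝ) ≤ K := by exact_mod_cast hK
  set θ := densityExponent K with hθ
  have hθ0 : 0 ≤ θ := densityExponent_nonneg hK
  set α := edExponent K with hα
  have hαθ : α = 1 / (2 * (1 + θ)) := edExponent_eq K
  have hα0 : 0 < α := edExponent_pos hK
  have hα2 : α ≤ 1 / 2 := edExponent_le_half hK
  clear_value θ α
  set B : ℝ := (a + 1) + 2 * (6 / c) * (1 + a) * Cν ^ 2 * K ^ 2 with hB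
  have hBa : (a : ℝ) + 1 ≤ B := by
    have : 0 ≤ 2 * (6 / c) * (1 + a) * Cν ^ 2 * (K : ℝ) ^ 2 := by positivity
    linarith
  have hBν : 2 * (6 / c) * (1 + a) * Cν ^ 2 * (K : ℝ) ^ 2 ≤ B := by
    have : 0 ≤ (a : ℝ) := by positivity
    linarith
  have hB1 : 1 ≤ B := by
    have : 0 ≤ (a : ℝ) := by positivity
    linarith
  clear_value B
  refine ⟨2 * (Cp + Cq) * B, by nlinarith, ?_⟩
  intro ι κ _ _ _ _ col n ℓ hn hℓ
  have hn1 : (1 : ℝ) ≤ n := by exact_mod_cast hn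
  have hℓ1 : (1 : ℝ) ≤ ℓ := by exact_mod_cast hℓ
  have hn0 : (0 : ℝ) < n := by linarith
  have hℓ0 : (0 : ℝ) < ℓ := by linarith
  rcases le_or_gt (n : ℝ) (B * ℓ) with hcase | hcase
  · obtain ⟨f, hf, hfX⟩ := exists_interpolant (distinctness col K) n
    refine ⟨n, f, ?_, hf, fun X hX => ?_⟩
    · have h1 : (n : ℝ) ≤ B * √((n : ℝ) * ℓ) := by
        have h2 : (n : ℝ) ≤ √(B ^ 2 * ((n : ℝ) * ℓ)) := by
          refine Real.le_sqrt_of_sq_le ?_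
          calc (n : ℝ) ^ 2 = n * n := sq _
            _ ≤ n * (B * ℓ) := by gcongr
            _ ≤ n * (B ^ 2 * ℓ) := by gcongr; exact le_self_pow₀ hB1 (by norm_num)
            _ = _ := by ring
        rwa [Real.sqrt_mul (by positivity), Real.sqrt_sq (by linarith)] at h2
      have h3 : 0 ≤ (n : ℝ) ^ (1 - α) * (ℓ : ℝ) ^ α := by positivity
      have h4 : 0 ≤ √((n : ℝ) * ℓ) := Real.sqrt_nonneg _
      calc (n : ℝ) ≤ B * √((n : ℝ) * ℓ) := h1
        _ ≤ 2 * (Cp + Cq) * B * √((n : ℝ) * ℓ) := by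
            refine mul_le_mul_of_nonneg_right (le_mul_of_one_le_left (by linarith) ?_) h4
            linarith
        _ ≤ _ := mul_le_mul_of_nonneg_left (by linarith) (by positivity)
    · rw [hfX X hX, sub_self, abs_zero]
      positivity
  · set ρ : ℝ := (B * ℓ / n) ^ (1 / (1 + θ)) with hρ
    have hbase0 : 0 < B * ℓ / n := by positivity
    have hbase1 : B * ℓ / n ≤ 1 := (div_le_one hn0).mpr hcase.le
    have hρ0 : 0 < ρ := Real.rpow_pos_of_pos hbase0 _
    have hρ1 : ρ ≤ 1 := Real.rpow_le_one hbase0.le hbase1 (by positivity)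
    have hρB : B * ℓ ≤ ρ * n := by
      rw [← div_le_iff₀ hn0]
      calc B * ℓ / n = (B * ℓ / n) ^ (1 : ℝ) := (Real.rpow_one _).symm
        _ ≤ ρ := Real.rpow_le_rpow_of_exponent_ge hbase0 hbase1 (by
            rw [div_le_one (by positivity)]; linarith)
    have hρθ : ρ * ρ ^ θ = B * ℓ / n := by
      calc ρ * ρ ^ θ = ρ ^ (1 : ℝ) * ρ ^ θ := by rw [Real.rpow_one]
        _ = ρ ^ (1 + θ) := (Real.rpow_add hρ0 _ _).symm
        _ = B * ℓ / n := by
            rw [hρ, ← Real.rpow_mul hbase0.le, one_div_mul_cancel (by positivity), Real.rpow_one]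
    have hρsqrt : √ρ = (B * ℓ / n) ^ α := by
      rw [Real.sqrt_eq_rpow, hρ, ← Real.rpow_mul hbase0.le, hαθ]
      congr 1
      field_simp
    clear_value ρ
    set d := ⌈ρ * n⌉₊ with hd
    have hρd : ρ * n ≤ d := Nat.le_ceil _
    have hBd : B * ℓ ≤ d := hρB.trans hρd
    have hBℓ1 : 1 ≤ B * ℓ := by nlinarith
    have hd2 : (d : ℝ) ≤ 2 * (ρ * n) := by
      have := (Nat.ceil_lt_add_one (by positivity : 0 ≤ ρ * n)).le
      linarith
    have hdn : d ≤ n := Nat.ceil_le.mpr (mul_le_of_le_one_left hn0.le hρ1)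
    have hd1' : (1 : ℝ) ≤ d := hBℓ1.trans hBd
    have hd1 : 1 ≤ d := by exact_mod_cast hd1'
    have hd0 : (0 : ℝ) < d := by linarith
    clear_value d
    have hℓad : ℓ + a ≤ d := by
      have h1 : ((ℓ + a : ℕ) : ℝ) ≤ d := by
        push_cast
        calc (ℓ : ℝ) + a ≤ (a + 1) * ℓ := by nlinarith [Nat.cast_nonneg (α := ℝ) a]
          _ ≤ B * ℓ := by gcongr
          _ ≤ d := hBd
      exact_mod_cast h1
    set δ : ℝ := ((d : ℝ) / n) ^ θ with hδ
    have hδ0 : 0 < δ := Real.rpow_pos_of_pos (by positivity) _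
    have hδ1 : δ ≤ 1 := Real.rpow_le_one (by positivity)
      ((div_le_one hn0).mpr (by exact_mod_cast hdn)) hθ0
    have hdδ : B * ℓ ≤ d * δ := by
      have h1 : ρ ^ θ ≤ δ := Real.rpow_le_rpow hρ0.le ((le_div_iff₀ hn0).mpr hρd) hθ0
      calc B * ℓ = ρ * n * ρ ^ θ := by
            rw [mul_right_comm, hρθ]
            field_simp
        _ ≤ d * δ := by gcongr
    have hM1 : 1 ≤ 6 / c := by
      rw [le_div_iff₀ hc]
      linarith
    set M := 6 / c with hM
    clear_value M
    have hdδ1 : (d : ℝ) ≤ d / δ := (le_div_iff₀ hδ0).mpr (mul_le_of_le_one_right hd0.le hδ1)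
    set m := ⌈M * (d / δ)⌉₊ with hm
    have hmM : M * (d / δ) ≤ m := Nat.le_ceil _
    have hdM : (d : ℝ) ≤ M * (d / δ) := hdδ1.trans (le_mul_of_one_le_left (by positivity) hM1)
    have hm2 : (m : ℝ) ≤ 2 * (M * (d / δ)) := by
      have := (Nat.ceil_lt_add_one (by positivity : 0 ≤ M * (d / δ))).le
      linarith
    have hdm : d ≤ m := by exact_mod_cast hdM.trans hmM
    clear_value m
    obtain ⟨p, hpdeg, hp0, hpz, hpdec, hpabs⟩ := hν (ℓ + a) m (by omega) (by omega)
    have hmℓ : Cν * √((m : ℝ) * (ℓ + a : ℕ)) ≤ d / K := by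
      have h1 : Cν * √((m : ℝ) * (ℓ + a : ℕ)) = √(Cν ^ 2 * ((m : ℝ) * (ℓ + a : ℕ))) := by
        rw [Real.sqrt_mul (sq_nonneg Cν), Real.sqrt_sq (by linarith)]
      rw [h1]
      refine Real.sqrt_le_iff.mpr ⟨by positivity, ?_⟩
      rw [div_pow, le_div_iff₀ (by positivity)]
      have h2 : ((ℓ + a : ℕ) : ℝ) ≤ (1 + a) * ℓ := by
        push_cast
        nlinarith [Nat.cast_nonneg (α := ℝ) a]
      calc Cν ^ 2 * ((m : ℝ) * (ℓ + a : ℕ)) * K ^ 2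
          ≤ Cν ^ 2 * (2 * (M * (d / δ)) * ((1 + a) * ℓ)) * K ^ 2 := by gcongr
        _ = 2 * M * (1 + a) * Cν ^ 2 * K ^ 2 * ℓ * (d / δ) := by ring
        _ ≤ B * ℓ * (d / δ) := by gcongr
        _ ≤ d * δ * (d / δ) := by gcongr
        _ = (d : ℝ) ^ 2 := by field_simp
    have hKdeg : K * p.natDegree ≤ d := by
      have h1 : (K : ℝ) * p.natDegree ≤ d := by
        calc (K : ℝ) * p.natDegree ≤ K * (d / K) := by gcongr; exact hpdeg.trans hmℓ
          _ = d := by field_simp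
      exact_mod_cast h1
    have hpd : p.natDegree ≤ d := (Nat.le_mul_of_pos_left _ (by omega)).trans hKdeg
    have hpm : (absPoly p).eval (m : ℝ) ≤ Real.exp d :=
      hpabs.trans (Real.exp_le_exp.mpr (hmℓ.trans (div_le_self hd0.le hK1)))
    obtain ⟨e1, P, he1, hP, hPX⟩ := hp ι κ col K d n p hd1 hdn hKdeg
    obtain ⟨e2, q, he2, hqd, hqX⟩ := hq ι κ col d n hd1 hdn
    refine ⟨e1 + e2, P * q, ?_, mul_mem_degLE hP hqd, fun X hX => ?_⟩
    · push_cast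
      have h1 : √((n : ℝ) * d) ≤ 2 * B * ((n : ℝ) ^ (1 - α) * (ℓ : ℝ) ^ α) := by
        calc √((n : ℝ) * d) ≤ √(2 ^ 2 * n ^ 2 * ρ) := by
              refine Real.sqrt_le_sqrt ?_
              calc (n : ℝ) * d ≤ n * (2 * (ρ * n)) := by gcongr
                _ ≤ 2 ^ 2 * n ^ 2 * ρ := by
                  have : 0 ≤ (n : ℝ) ^ 2 * ρ := by positivity
                  linarith
          _ = 2 * n * (B * ℓ / n) ^ α := by
              rw [Real.sqrt_mul (by positivity), ← mul_pow, Real.sqrt_sq (by positivity), hρsqrt]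
          _ = 2 * B ^ α * ((n : ℝ) ^ (1 - α) * (ℓ : ℝ) ^ α) := by
              rw [Real.div_rpow (by positivity) hn0.le, Real.mul_rpow (by linarith) hℓ0.le,
                Real.rpow_sub hn0, Real.rpow_one]
              ring
          _ ≤ _ := by
              gcongr
              calc B ^ α ≤ B ^ (1 : ℝ) := Real.rpow_le_rpow_of_exponent_le hB1 (by linarith)
                _ = B := Real.rpow_one B
      have h2 : 0 ≤ √((n : ℝ) * ℓ) := Real.sqrt_nonneg _
      calc (e1 : ℝ) + e2 ≤ (Cp + Cq) * √((n : ℝ) * d) := by linarith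
        _ ≤ (Cp + Cq) * (2 * B * ((n : ℝ) ^ (1 - α) * (ℓ : ℝ) ^ α)) := by gcongr
        _ = 2 * (Cp + Cq) * B * ((n : ℝ) ^ (1 - α) * (ℓ : ℝ) ^ α) := by ring
        _ ≤ _ := mul_le_mul_of_nonneg_left (by linarith) (by positivity)
    · have h1 := abs_mul_detector_sub_le (t := (heavyCols col K X).card) hA ha.le hc hδ0 hd1 hℓ
        hℓad (by omega) (hM ▸ hmM) hpd hp0 hpz hpdec hpm (hPX X hX)
        (fun h => (hqX X hX).1 (Finset.card_eq_zero.mp h))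
        (by rw [hδ, hθ]; exact (hqX X hX).2)
      simp only [Finset.card_eq_zero] at h1
      exact h1

end FixedSize

section Extension

theorem abs_distinctness_le_one {ι κ : Type*} [Fintype κ] [DecidableEq κ] (col : ι → κ)
    (K : ℕ) (X : Finset ι) : |distinctness col K X| ≤ 1 := by
  rw [distinctness]
  split_ifs <;> simp

variable {ι κ : Type} [Fintype ι] [DecidableEq ι] [Fintype κ] [DecidableEq κ]

/-- An approximation on inputs of size linear in a bound for the size of the positive inputs
extends to larger inputs. -/
theorem exists_extension_distinctness {col : ι → κ} {K m : ℕ} (hm : 1 ≤ m)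
    (hpos : ∀ X, heavyCols col K X = ∅ → X.card ≤ m) {e₀ ℓ : ℕ} (he₀ : e₀ ≤ 4096 * m)
    {f : Finset ι → ℝ} (hf : f ∈ degLE ι e₀)
    (hfX : ∀ X : Finset ι, X.card ≤ 4096 * m → |f X - distinctness col K X| ≤ (1 / 2) ^ (ℓ + 2))
    (n : ℕ) : ∃ (e : ℕ) (g : Finset ι → ℝ),
      (e : ℝ) ≤ 3 * (e₀ + (ℓ + 2 : ℕ)) * (1 + √((n : ℝ) / m)) ∧ g ∈ degLE ι e ∧
      ∀ X : Finset ι, X.card ≤ n → |g X - distinctness col K X| ≤ (1 / 2) ^ ℓ := by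
  obtain ⟨e, g, he, hg, h1, h2, h3⟩ := exists_extension hm he₀ hf n (ℓ + 2)
  refine ⟨e, g, he, hg, fun X hX => ?_⟩
  have hx : (1 / 2 : ℝ) ^ (ℓ + 2) = 1 / 4 * (1 / 2) ^ ℓ := by
    rw [pow_add]
    norm_num
    ring
  have hx0 : (0 : ℝ) ≤ (1 / 2) ^ ℓ := by positivity
  have hx1 : (1 / 2 : ℝ) ^ ℓ ≤ 1 := pow_le_one₀ (by norm_num) (by norm_num)
  have hf2 : ∀ Z : Finset ι, Z.card ≤ 4096 * m → |f Z| ≤ 2 := fun Z hZ => by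
    have h4 := abs_add_le (f Z - distinctness col K Z) (distinctness col K Z)
    rw [sub_add_cancel] at h4
    have h5 := hfX Z hZ
    have h6 := abs_distinctness_le_one col K Z
    rw [hx] at h5
    linarith
  have hzero : m < X.card → distinctness col K X = 0 := fun h =>
    if_neg fun h' => absurd (hpos X h') (by omega)
  rw [hx] at h1 h3 hfX
  rcases Nat.lt_or_ge m X.card with h | h
  · rw [hzero h, sub_zero]
    rcases Nat.lt_or_ge (4096 * m) X.card with h' | h'
    · have := h3 X hX h' 2 fun Z _ hZ => hf2 Z hZ
      linarith
    · have h4 := hfX X h'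
      rw [hzero h, sub_zero] at h4
      have := h2 X hX h'
      linarith
  · have h4 := h1 X hX h
    have h5 := hfX X (by omega)
    have h6 := hf2 X (by omega)
    have h7 := abs_sub_le (g X) (f X) (distinctness col K X)
    have h8 : 1 / 4 * (1 / 2 : ℝ) ^ ℓ * |f X| ≤ 1 / 4 * (1 / 2) ^ ℓ * 2 := by gcongr
    linarith

theorem one_add_sqrt_div_le {n s m : ℝ} (hs : 0 < s) (hsn : s ≤ n) (hsm : s ≤ m) :
    1 + √(n / m) ≤ 2 * √(n / s) := by
  have h1 : 1 ≤ √(n / s) := Real.one_le_sqrt.mpr ((one_le_div hs).mpr hsn)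
  have h2 : √(n / m) ≤ √(n / s) :=
    Real.sqrt_le_sqrt (div_le_div_of_nonneg_left (by linarith) hs hsm)
  linarith

/-- Approximation of `K`-element distinctness on `n × r` matrices to within `2^{-ℓ}`. -/
theorem exists_approx_distinctness_matrix {K : ℕ} (hK : 1 ≤ K) : ∃ C : ℝ, 1 ≤ C ∧
    ∀ n r ℓ : ℕ, 1 ≤ n → 1 ≤ r → 1 ≤ ℓ → ∃ (e : ℕ) (f : Finset (Fin n × Fin r) → ℝ),
      (e : ℝ) ≤ C * (√(n : ℝ) * (min (n : ℝ) (r : ℝ)) ^ (1 / 2 - edExponent K) *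
        (ℓ : ℝ) ^ edExponent K + √((n : ℝ) * ℓ)) ∧
      f ∈ degLE (Fin n × Fin r) e ∧
      ∀ X, X.card ≤ n → |f X - distinctness Prod.snd K X| ≤ (1 / 2) ^ ℓ := by
  obtain ⟨C₁, hC₁, H⟩ := exists_approx_distinctness hK
  have hK1 : (1 : ℝ) ≤ K := by exact_mod_cast hK
  have hα0 : 0 < edExponent K := edExponent_pos hK
  have hα2 : edExponent K ≤ 1 / 2 := edExponent_le_half hK
  set α := edExponent K
  clear_value α
  set C : ℝ := 6 * (12288 * K * C₁ + 3) with hC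
  have hKC : (K : ℝ) ≤ K * C₁ := le_mul_of_one_le_right (by linarith) hC₁
  have hCC : C₁ ≤ K * C₁ := le_mul_of_one_le_left (by linarith) hK1
  refine ⟨C, by linarith, fun n r ℓ hn hr hℓ => ?_⟩
  have hn0 : (0 : ℝ) < n := by exact_mod_cast hn
  have hr0 : (0 : ℝ) < r := by exact_mod_cast hr
  have hℓ1 : (1 : ℝ) ≤ ℓ := by exact_mod_cast hℓ
  have hℓ0 : (0 : ℝ) < ℓ := by linarith
  have hC0 : 0 ≤ C := by linarith
  have hT0 : 0 ≤ √(n : ℝ) * (min (n : ℝ) (r : ℝ)) ^ (1 / 2 - α) * (ℓ : ℝ) ^ α := by positivity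
  have hS0 : 0 ≤ √((n : ℝ) * ℓ) := Real.sqrt_nonneg _
  rcases Nat.lt_or_ge n ℓ with hnℓ | hnℓ
  · obtain ⟨f, hf, hfX⟩ := exists_interpolant (distinctness (Prod.snd : Fin n × Fin r → Fin r) K) n
    refine ⟨n, f, ?_, hf, fun X hX => ?_⟩
    · have h1 : (n : ℝ) ≤ √((n : ℝ) * ℓ) := Real.le_sqrt_of_sq_le (by
        rw [sq]
        exact mul_le_mul_of_nonneg_left (by exact_mod_cast hnℓ.le) hn0.le)
      calc (n : ℝ) ≤ 1 * (0 + √((n : ℝ) * ℓ)) := by linarith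
        _ ≤ _ := by gcongr; linarith
    · rw [hfX X hX, sub_self, abs_zero]
      positivity
  have hnℓ' : (ℓ : ℝ) ≤ n := by exact_mod_cast hnℓ
  rcases Nat.lt_or_ge r n with hrn | hrn
  · have hrn' : (r : ℝ) ≤ n := by exact_mod_cast hrn.le
    have hcard : ∀ X : Finset (Fin n × Fin r), heavyCols Prod.snd K X = ∅ → X.card ≤ K * r := by
      intro X hX
      have := card_le_of_heavyCols_eq_empty (col := (Prod.snd : Fin n × Fin r → Fin r))
        (K := K - 1) (X := X) (by rwa [Nat.sub_add_cancel hK]) Finset.univ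
        fun _ _ => Finset.mem_univ _
      rw [Finset.card_univ, Fintype.card_fin] at this
      exact this.trans (Nat.mul_le_mul_right r (Nat.sub_le K 1))
    rcases Nat.lt_or_ge r ℓ with hrℓ | hrℓ
    · obtain ⟨f, hf, hfX⟩ := exists_interpolant
        (distinctness (Prod.snd : Fin n × Fin r → Fin r) K) (4096 * (K * ℓ))
      obtain ⟨e, g, he, hg, hgX⟩ := exists_extension_distinctness
        (col := (Prod.snd : Fin n × Fin r → Fin r)) (m := K * ℓ) (ℓ := ℓ)
        (Nat.mul_pos hK hℓ) (fun X hX => (hcard X hX).trans (Nat.mul_le_mul_left K hrℓ.le)) le_rfl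
        hf (fun X hX => by rw [hfX X hX, sub_self, abs_zero]; positivity) n
      refine ⟨e, g, he.trans ?_, hg, hgX⟩
      have h1 : 1 + √((n : ℝ) / (K * ℓ : ℕ)) ≤ 2 * √((n : ℝ) / ℓ) :=
        one_add_sqrt_div_le hℓ0 hnℓ' (by
          push_cast
          exact le_mul_of_one_le_left hℓ0.le hK1)
      have h2 : (ℓ : ℝ) * √((n : ℝ) / ℓ) = √((n : ℝ) * ℓ) := by
        rw [← Real.sqrt_sq hℓ0.le, ← Real.sqrt_mul (by positivity), Real.sqrt_sq hℓ0.le]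
        congr 1
        field_simp
      have h3 : ((4096 * (K * ℓ) : ℕ) : ℝ) + (ℓ + 2 : ℕ) ≤ (4096 * K + 3) * ℓ := by
        push_cast
        linarith
      calc _ ≤ 3 * ((4096 * K + 3) * ℓ) * (2 * √((n : ℝ) / ℓ)) := by gcongr
        _ = 6 * (4096 * K + 3) * (ℓ * √((n : ℝ) / ℓ)) := by ring
        _ ≤ C * (ℓ * √((n : ℝ) / ℓ)) := by
            refine mul_le_mul_of_nonneg_right ?_ (by positivity)
            rw [hC]
            linarith
        _ ≤ _ := by
            rw [h2]
            refine mul_le_mul_of_nonneg_left ?_ hC0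
            linarith
    · have hrℓ' : (ℓ : ℝ) ≤ r := by exact_mod_cast hrℓ
      set n' := 4096 * (K * r) with hn'
      have hm1 : 1 ≤ K * r := Nat.mul_pos hK hr
      obtain ⟨e₀, f, he₀, he₀n, hf, hfX⟩ : ∃ (e₀ : ℕ) (f : Finset (Fin n × Fin r) → ℝ),
          (e₀ : ℝ) ≤ C₁ * ((n' : ℝ) ^ (1 - α) * ((ℓ + 2 : ℕ) : ℝ) ^ α +
            √((n' : ℝ) * (ℓ + 2 : ℕ))) ∧ e₀ ≤ n' ∧ f ∈ degLE _ e₀ ∧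
          ∀ X, X.card ≤ n' → |f X - distinctness Prod.snd K X| ≤ (1 / 2) ^ (ℓ + 2) := by
        obtain ⟨e₀, f, he₀, hf, hfX⟩ := H (Fin n × Fin r) (Fin r) Prod.snd n' (ℓ + 2)
          (by omega) (by omega)
        rcases Nat.lt_or_ge n' e₀ with h | h
        · obtain ⟨f', hf', hfX'⟩ := exists_interpolant
            (distinctness (Prod.snd : Fin n × Fin r → Fin r) K) n'
          refine ⟨n', f', le_trans (by exact_mod_cast h.le) he₀, le_rfl, hf', fun X hX => ?_⟩
          rw [hfX' X hX, sub_self, abs_zero]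
          positivity
        · exact ⟨e₀, f, he₀, h, hf, hfX⟩
      obtain ⟨e, g, he, hg, hgX⟩ := exists_extension_distinctness
        (col := (Prod.snd : Fin n × Fin r → Fin r)) hm1 hcard he₀n hf hfX n
      refine ⟨e, g, he.trans ?_, hg, hgX⟩
      have h1 : 1 + √((n : ℝ) / (K * r : ℕ)) ≤ 2 * √((n : ℝ) / r) :=
        one_add_sqrt_div_le hr0 hrn' (by
          push_cast
          exact le_mul_of_one_le_left hr0.le hK1)
      have h2 : ((ℓ + 2 : ℕ) : ℝ) ≤ 3 * ℓ := by
        push_cast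
        linarith
      have hn'r : (n' : ℝ) = 4096 * K * r := by
        rw [hn']
        push_cast
        ring
      have h3 : (n' : ℝ) ^ (1 - α) ≤ 4096 * K * (r : ℝ) ^ (1 - α) := by
        rw [hn'r, Real.mul_rpow (by positivity) hr0.le]
        gcongr
        calc (4096 * (K : ℝ)) ^ (1 - α) ≤ (4096 * K) ^ (1 : ℝ) :=
              Real.rpow_le_rpow_of_exponent_le (by linarith) (by linarith)
          _ = _ := Real.rpow_one _
      have h4 : ((ℓ + 2 : ℕ) : ℝ) ^ α ≤ 3 * (ℓ : ℝ) ^ α := by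
        calc ((ℓ + 2 : ℕ) : ℝ) ^ α ≤ (3 * ℓ) ^ α := by gcongr
          _ = 3 ^ α * (ℓ : ℝ) ^ α := Real.mul_rpow (by norm_num) hℓ0.le
          _ ≤ 3 ^ (1 : ℝ) * (ℓ : ℝ) ^ α := by
              gcongr
              · norm_num
              · linarith
          _ = _ := by rw [Real.rpow_one]
      have h5 : √((n' : ℝ) * (ℓ + 2 : ℕ)) ≤ 12288 * K * √((r : ℝ) * ℓ) := by
        have h6 : (n' : ℝ) * (ℓ + 2 : ℕ) ≤ (12288 * K) ^ 2 * (r * ℓ) := by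
          calc (n' : ℝ) * (ℓ + 2 : ℕ) ≤ 4096 * K * r * (3 * ℓ) := by rw [hn'r]; gcongr
            _ = (12288 * K) * (r * ℓ) := by ring
            _ ≤ _ := by
                gcongr
                exact le_self_pow₀ (by linarith) (by norm_num)
        refine (Real.sqrt_le_sqrt h6).trans (le_of_eq ?_)
        rw [Real.sqrt_mul (by positivity), Real.sqrt_sq (by positivity)]
      have h6 : (ℓ : ℝ) ≤ √((r : ℝ) * ℓ) := Real.le_sqrt_of_sq_le (by
        rw [sq]
        exact mul_le_mul_of_nonneg_right hrℓ' hℓ0.le)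
      have h7 : √((n : ℝ) / r) * √((r : ℝ) * ℓ) = √((n : ℝ) * ℓ) := by
        rw [← Real.sqrt_mul (by positivity)]
        congr 1
        field_simp
      have h8 : √((n : ℝ) / r) * (r : ℝ) ^ (1 - α) = √(n : ℝ) * (r : ℝ) ^ (1 / 2 - α) := by
        rw [Real.sqrt_div hn0.le, show 1 - α = 1 / 2 + (1 / 2 - α) by ring, Real.rpow_add hr0,
          Real.sqrt_eq_rpow (r : ℝ)]
        field_simp
      have h9 : (e₀ : ℝ) + (ℓ + 2 : ℕ) ≤ (12288 * K * C₁ + 3) *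
          ((r : ℝ) ^ (1 - α) * (ℓ : ℝ) ^ α + √((r : ℝ) * ℓ)) := by
        have h10 : (n' : ℝ) ^ (1 - α) * ((ℓ + 2 : ℕ) : ℝ) ^ α ≤
            12288 * K * ((r : ℝ) ^ (1 - α) * (ℓ : ℝ) ^ α) := by
          calc _ ≤ (4096 * K * (r : ℝ) ^ (1 - α)) * (3 * (ℓ : ℝ) ^ α) := by gcongr
            _ = _ := by ring
        have h11 : 0 ≤ (r : ℝ) ^ (1 - α) * (ℓ : ℝ) ^ α := by positivity
        calc (e₀ : ℝ) + (ℓ + 2 : ℕ) ≤ C₁ * (12288 * K * ((r : ℝ) ^ (1 - α) * (ℓ : ℝ) ^ α) +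
              12288 * K * √((r : ℝ) * ℓ)) + 3 * √((r : ℝ) * ℓ) := by
              refine add_le_add (he₀.trans ?_) (h2.trans (by linarith))
              gcongr
          _ ≤ _ := by linarith
      rw [min_eq_right hrn']
      calc _ ≤ 3 * ((12288 * K * C₁ + 3) * ((r : ℝ) ^ (1 - α) * (ℓ : ℝ) ^ α + √((r : ℝ) * ℓ))) *
            (2 * √((n : ℝ) / r)) := by gcongr
        _ = C * (√((n : ℝ) / r) * (r : ℝ) ^ (1 - α) * (ℓ : ℝ) ^ α +
            √((n : ℝ) / r) * √((r : ℝ) * ℓ)) := by rw [hC]; ring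
        _ = _ := by rw [h7, h8]
  · have hrn' : (n : ℝ) ≤ r := by exact_mod_cast hrn
    obtain ⟨e, f, he, hf, hfX⟩ := H (Fin n × Fin r) (Fin r) Prod.snd n ℓ hn hℓ
    refine ⟨e, f, he.trans ?_, hf, hfX⟩
    have h1 : √(n : ℝ) * (n : ℝ) ^ (1 / 2 - α) = (n : ℝ) ^ (1 - α) := by
      rw [Real.sqrt_eq_rpow, ← Real.rpow_add hn0]
      congr 1
      ring
    rw [min_eq_left hrn', h1]
    exact mul_le_mul_of_nonneg_right (by linarith) (by positivity)

end Extension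

section Codes

theorem totalDegree_toPoly_le {n r e : ℕ} {L : PolyCode} (h : ∀ t ∈ L, t.2.length ≤ e) :
    (PolyCode.toPoly n r L).totalDegree ≤ e := by
  induction L with
  | nil => simp [PolyCode.toPoly]
  | cons t L ih =>
    rw [PolyCode.toPoly, List.map_cons, List.sum_cons]
    refine (MvPolynomial.totalDegree_add _ _).trans (max_le ?_
      (ih fun t' ht' => h t' (List.mem_cons_of_mem t ht')))
    refine (MvPolynomial.totalDegree_mul _ _).trans ?_
    rw [MvPolynomial.totalDegree_C, zero_add]
    refine le_trans ?_ (h t List.mem_cons_self)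
    refine (MvPolynomial.totalDegree_list_prod _).trans ?_
    rw [List.map_map]
    refine (List.sum_le_card_nsmul _ 1 ?_).trans (by simp)
    intro d hd
    obtain ⟨s, -, rfl⟩ := List.mem_map.mp hd
    simp only [Function.comp, entryVar]
    split_ifs
    · rw [MvPolynomial.totalDegree_X]
    · simp

/-- The entry of a Boolean matrix with `r` columns whose entries are the binary digits of `x`. -/
def entryBit (r x i j : ℕ) : ℕ := x / 2 ^ (i * r + j) % 2

theorem entryBit_eq_ite (r x i j : ℕ) : entryBit r x i j = if entryBit r x i j = 1 then 1 else 0 := by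
  rcases Nat.mod_two_eq_zero_or_one (x / 2 ^ (i * r + j)) with h | h <;> simp [entryBit, h]

/-- The positions of the ones in the matrix with binary digits `x`. -/
def maskSet (n r x : ℕ) : Finset (Fin n × Fin r) :=
  Finset.univ.filter fun p => entryBit r x p.1 p.2 = 1

/-- The number of ones in the matrix with binary digits `x`. -/
def maskWeight (n r x : ℕ) : ℕ := ∑ i ∈ Finset.range n, ∑ j ∈ Finset.range r, entryBit r x i j

/-- The number of ones in a column of the matrix with binary digits `x`. -/
def maskColumn (n r x j : ℕ) : ℕ := ∑ i ∈ Finset.range n, entryBit r x i j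

theorem card_maskSet (n r x : ℕ) : (maskSet n r x).card = maskWeight n r x := by
  rw [maskSet, Finset.card_filter, Fintype.sum_prod_type, maskWeight, Finset.sum_range]
  refine Finset.sum_congr rfl fun i _ => ?_
  rw [Finset.sum_range]
  exact Finset.sum_congr rfl fun j _ => (entryBit_eq_ite r x i j).symm

theorem card_maskSet_column (n r x : ℕ) (j : Fin r) :
    ((maskSet n r x).filter (fun p => p.2 = j)).card = maskColumn n r x j := by
  rw [maskSet, Finset.filter_filter, Finset.card_filter, Fintype.sum_prod_type, maskColumn,
    Finset.sum_range]
  refine Finset.sum_congr rfl fun i _ => ?_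
  rw [entryBit_eq_ite, Finset.sum_eq_single j]
  · simp
  · intro j' _ hj'
    exact if_neg fun h => hj' h.2
  · simp

theorem distinctness_maskSet (n r k x : ℕ) : distinctness Prod.snd k (maskSet n r x) =
    if ∀ j < r, maskColumn n r x j < k then 1 else 0 := by
  rw [distinctness]
  congr 1
  rw [Finset.eq_empty_iff_forall_notMem]
  simp only [mem_heavyCols, card_maskSet_column, not_le, Fin.forall_iff]

theorem exists_maskSet {n r : ℕ} (S : Finset (Fin n × Fin r)) :
    ∃ x < 2 ^ (n * r), maskSet n r x = S := by
  refine ⟨Nat.ofBits fun p : Fin (n * r) => decide (finProdFinEquiv.symm p ∈ S),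
    Nat.ofBits_lt_two_pow _, ?_⟩
  ext p
  have h1 : (p.1 : ℕ) * r + p.2 = finProdFinEquiv p := by
    rw [finProdFinEquiv_apply_val]
    ring
  have h2 := Nat.testBit_ofBits_lt (fun p : Fin (n * r) => decide (finProdFinEquiv.symm p ∈ S))
    (finProdFinEquiv p) (finProdFinEquiv p).2
  rw [Nat.testBit_eq_decide_div_mod_eq] at h2
  simp only [Fin.eta, Equiv.symm_apply_apply, decide_eq_decide] at h2
  rw [maskSet, Finset.mem_filter, entryBit, h1]
  simpa using h2

/-- A monomial takes the value `1` at the matrix with binary digits `x`. -/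
def MonomialOn (n r x : ℕ) (s : List (ℕ × ℕ)) : Prop :=
  ∀ p ∈ s, p.1 < n ∧ p.2 < r ∧ entryBit r x p.1 p.2 = 1

instance (n r x : ℕ) (s : List (ℕ × ℕ)) : Decidable (MonomialOn n r x s) := by
  unfold MonomialOn
  infer_instance

/-- The sum of the coefficients, as selected by `w`, of the monomials with value `1`. -/
def coeffSum (w : ℕ × ℕ × ℕ → ℕ) (n r x : ℕ) (L : PolyCode) : ℕ :=
  (L.map fun t => if MonomialOn n r x t.2 then w t.1 else 0).sum

/-- The value of a code with common denominator `q` is within `a / b` of the value of the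
`k`-element distinctness function. -/
def ApproximatesAt (k n r a b q : ℕ) (L : PolyCode) (x : ℕ) : Prop :=
  coeffSum Prod.fst n r x L * b ≤ (coeffSum (fun c => c.2.1) n r x L +
      if ∀ j < r, maskColumn n r x j < k then q else 0) * b + a * q ∧
    (coeffSum (fun c => c.2.1) n r x L +
      if ∀ j < r, maskColumn n r x j < k then q else 0) * b ≤
      coeffSum Prod.fst n r x L * b + a * q

theorem approximatesAt_iff {k n r a b q : ℕ} (hb : 1 ≤ b) (hq : 1 ≤ q) (L : PolyCode) (x : ℕ) :
    ApproximatesAt k n r a b q L x ↔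
      |distinctness Prod.snd k (maskSet n r x) -
        ((coeffSum Prod.fst n r x L : ℝ) - coeffSum (fun c => c.2.1) n r x L) / q| ≤ a / b := by
  have hb0 : (0 : ℝ) < b := by exact_mod_cast hb
  have hq0 : (0 : ℝ) < q := by exact_mod_cast hq
  rw [distinctness_maskSet, ApproximatesAt]
  set P := coeffSum Prod.fst n r x L
  set N := coeffSum (fun c => c.2.1) n r x L
  set E : ℕ := if ∀ j < r, maskColumn n r x j < k then q else 0 with hE
  have hE' : (if ∀ j < r, maskColumn n r x j < k then (1 : ℝ) else 0) = E / q := by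
    rw [hE]
    split_ifs
    · rw [div_self hq0.ne']
    · rw [Nat.cast_zero, zero_div]
  rw [hE', ← sub_div, abs_div, abs_of_pos hq0, div_le_div_iff₀ hq0 hb0, ← abs_of_pos hb0,
    ← abs_mul, abs_le, and_comm, ← Nat.cast_le (α := ℝ), ← Nat.cast_le (α := ℝ)]
  push_cast
  constructor
  · rintro ⟨h1, h2⟩
    constructor <;> linarith
  · rintro ⟨h1, h2⟩
    constructor <;> linarith

theorem eval_entryVar {n r x : ℕ} {z : Fin n × Fin r → ℝ}
    (hz : ∀ p, z p = if p ∈ maskSet n r x then 1 else 0) (s : ℕ × ℕ) :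
    MvPolynomial.eval z (entryVar n r s) =
      if s.1 < n ∧ s.2 < r ∧ entryBit r x s.1 s.2 = 1 then 1 else 0 := by
  rw [entryVar]
  split_ifs with h1 h2 h2
  · rw [MvPolynomial.eval_X, hz, if_pos]
    exact Finset.mem_filter.mpr ⟨Finset.mem_univ _, h2.2.2⟩
  · rw [MvPolynomial.eval_X, hz, if_neg]
    exact fun h => h2 ⟨h1.1, h1.2, (Finset.mem_filter.mp h).2⟩
  · exact absurd ⟨h2.1, h2.2.1⟩ h1
  · rw [map_zero]

theorem eval_monomial {n r x : ℕ} {z : Fin n × Fin r → ℝ}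
    (hz : ∀ p, z p = if p ∈ maskSet n r x then 1 else 0) (s : List (ℕ × ℕ)) :
    MvPolynomial.eval z (s.map (entryVar n r)).prod = if MonomialOn n r x s then 1 else 0 := by
  induction s with
  | nil => simp [MonomialOn]
  | cons p s ih =>
    have h : MonomialOn n r x (p :: s) ↔
        (p.1 < n ∧ p.2 < r ∧ entryBit r x p.1 p.2 = 1) ∧ MonomialOn n r x s := List.forall_mem_cons
    rw [List.map_cons, List.prod_cons, map_mul, ih, eval_entryVar hz, if_congr h rfl rfl]
    split_ifs <;> first | simp; done | (exfalso; tauto)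

theorem eval_toPoly {n r x q : ℕ} {z : Fin n × Fin r → ℝ}
    (hz : ∀ p, z p = if p ∈ maskSet n r x then 1 else 0) {L : PolyCode}
    (hL : ∀ t ∈ L, t.1.2.2 = q) : MvPolynomial.eval z (PolyCode.toPoly n r L) =
      ((coeffSum Prod.fst n r x L : ℝ) - coeffSum (fun c => c.2.1) n r x L) / q := by
  induction L with
  | nil => simp [PolyCode.toPoly, coeffSum]
  | cons t L ih =>
    have ih' := ih fun t' ht' => hL t' (List.mem_cons_of_mem t ht')
    rw [PolyCode.toPoly] at ih' ⊢
    rw [List.map_cons, List.sum_cons, map_add, ih', map_mul, MvPolynomial.eval_C, eval_monomial hz,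
      hL t List.mem_cons_self]
    simp only [coeffSum, List.map_cons, List.sum_cons]
    split_ifs
    · push_cast
      ring
    · push_cast
      ring

theorem isUniformApproximant_toPoly {k n r a b q : ℕ} (hb : 1 ≤ b) (hq : 1 ≤ q) {L : PolyCode}
    (hL : ∀ t ∈ L, t.1.2.2 = q)
    (h : ∀ x < 2 ^ (n * r), maskWeight n r x ≤ n → ApproximatesAt k n r a b q L x) :
    IsUniformApproximant (elementDistinctness n r k) (a / b) (PolyCode.toPoly n r L) := by
  rintro ⟨z, hz01, hzn⟩
  obtain ⟨x, hx, hxS⟩ := exists_maskSet (Finset.univ.filter fun p => z p = 1)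
  have hz : ∀ p, z p = if p ∈ maskSet n r x then 1 else 0 := by
    intro p
    rw [hxS]
    rcases hz01 p with h | h <;> simp [h]
  have hcard : maskWeight n r x ≤ n := by
    have h1 : ∑ p, z p = (maskSet n r x).card := by
      rw [Finset.sum_congr rfl fun p _ => hz p]
      simp
    rw [h1] at hzn
    rw [← card_maskSet]
    exact_mod_cast hzn
  have hED : elementDistinctness n r k ⟨z, hz01, hzn⟩ =
      distinctness Prod.snd k (maskSet n r x) := by
    rw [elementDistinctness, distinctness_maskSet]
    congr 1
    simp only [eq_iff_iff]
    have hcol : ∀ j : Fin r, ∑ i : Fin n, z (i, j) = maskColumn n r x j := by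
      intro j
      rw [maskColumn, Finset.sum_range, Nat.cast_sum]
      refine Finset.sum_congr rfl fun i _ => ?_
      rw [hz, entryBit_eq_ite]
      simp [maskSet]
    simp only [hcol, Nat.cast_lt, Fin.forall_iff]
  rw [hED, eval_toPoly hz hL]
  exact (approximatesAt_iff hb hq L x).mp (h x hx hcard)

theorem exists_coeff_of_mem_degLE {ι : Type*} [Fintype ι] [DecidableEq ι] {e : ℕ}
    {f : Finset ι → ℝ} (hf : f ∈ degLE ι e) : ∃ c : Finset ι → ℝ, ∀ X,
      f X = ∑ s ∈ Finset.univ.filter (fun s : Finset ι => s.card ≤ e), c s * cubeMonomial s X := by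
  unfold degLE at hf
  induction hf using Submodule.span_induction with
  | mem f hf =>
    obtain ⟨s, hs, rfl⟩ := hf
    refine ⟨fun s' => if s' = s then 1 else 0, fun X => ?_⟩
    simp only [ite_mul, one_mul, zero_mul]
    rw [Finset.sum_ite_eq', if_pos]
    exact Finset.mem_filter.mpr ⟨Finset.mem_univ _, hs⟩
  | zero => exact ⟨0, by simp⟩
  | add f g _ _ hf hg =>
    obtain ⟨c, hc⟩ := hf
    obtain ⟨c', hc'⟩ := hg
    refine ⟨c + c', fun X => ?_⟩
    rw [Pi.add_apply, hc, hc', ← Finset.sum_add_distrib]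
    exact Finset.sum_congr rfl fun s _ => by rw [Pi.add_apply, add_mul]
  | smul t f _ hf =>
    obtain ⟨c, hc⟩ := hf
    refine ⟨t • c, fun X => ?_⟩
    rw [Pi.smul_apply, hc, smul_eq_mul, Finset.mul_sum]
    exact Finset.sum_congr rfl fun s _ => by rw [Pi.smul_apply, smul_eq_mul, mul_assoc]

theorem exists_code {k n r a b e : ℕ} (ha : 1 ≤ a) (hb : 1 ≤ b)
    {f : Finset (Fin n × Fin r) → ℝ} (hf : f ∈ degLE _ e)
    (hfX : ∀ X, X.card ≤ n → |f X - distinctness Prod.snd k X| ≤ a / (2 * b)) :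
    ∃ (L : PolyCode) (q : ℕ), 1 ≤ q ∧ (∀ t ∈ L, t.1.2.2 = q ∧ t.2.length ≤ e) ∧
      ∀ x, maskWeight n r x ≤ n → ApproximatesAt k n r a b q L x := by
  have ha0 : (1 : ℝ) ≤ a := by exact_mod_cast ha
  have hb0 : (0 : ℝ) < b := by exact_mod_cast hb
  obtain ⟨c, hc⟩ := exists_coeff_of_mem_degLE hf
  set F := Finset.univ.filter (fun s : Finset (Fin n × Fin r) => s.card ≤ e) with hF
  have hF1 : 1 ≤ F.card := Finset.card_pos.mpr ⟨∅, by simp [hF]⟩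
  set q := 2 * b * F.card with hqdef
  have hq : 1 ≤ q := Nat.mul_pos (by omega) hF1
  have hq0 : (0 : ℝ) < q := by exact_mod_cast hq
  let z : Finset (Fin n × Fin r) → ℤ := fun s => ⌊c s * q⌋
  let term : Finset (Fin n × Fin r) → (ℕ × ℕ × ℕ) × List (ℕ × ℕ) := fun s =>
    (((z s).toNat, (-z s).toNat, q), s.toList.map fun p => ((p.1 : ℕ), (p.2 : ℕ)))
  have hon : ∀ x s, MonomialOn n r x (term s).2 ↔ s ⊆ maskSet n r x := by
    intro x s
    simp only [MonomialOn, term, List.forall_mem_map, Finset.mem_toList]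
    constructor
    · intro h p hp
      exact Finset.mem_filter.mpr ⟨Finset.mem_univ p, (h p hp).2.2⟩
    · intro h p hp
      exact ⟨p.1.2, p.2.2, (Finset.mem_filter.mp (h hp)).2⟩
  have hsum : ∀ (w : ℕ × ℕ × ℕ → ℕ) (x : ℕ), coeffSum w n r x (F.toList.map term) =
      ∑ s ∈ F, if s ⊆ maskSet n r x then w (term s).1 else 0 := by
    intro w x
    rw [coeffSum, List.map_map, Finset.sum_map_toList]
    exact Finset.sum_congr rfl fun s _ => by simp only [Function.comp, hon]
  refine ⟨F.toList.map term, q, hq, ?_, fun x hx => ?_⟩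
  · intro t ht
    obtain ⟨s, hs, rfl⟩ := List.mem_map.mp ht
    refine ⟨rfl, ?_⟩
    simp only [term, List.length_map, Finset.length_toList]
    exact (Finset.mem_filter.mp (Finset.mem_toList.mp hs)).2
  · rw [approximatesAt_iff hb hq]
    set X := maskSet n r x with hX
    have h1 := hfX X (by rwa [card_maskSet])
    have h2 : ((coeffSum Prod.fst n r x (F.toList.map term) : ℝ) -
        coeffSum (fun c => c.2.1) n r x (F.toList.map term)) =
        ∑ s ∈ F, (z s : ℝ) * cubeMonomial s X := by
      rw [hsum, hsum]
      push_cast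
      rw [← Finset.sum_sub_distrib]
      refine Finset.sum_congr rfl fun s _ => ?_
      simp only [cubeMonomial, ← hX]
      split_ifs
      · rw [mul_one]
        have h3 := Int.toNat_sub_toNat_neg (z s)
        simp only [term]
        exact_mod_cast h3
      · simp
    have h3 : |f X - (∑ s ∈ F, (z s : ℝ) * cubeMonomial s X) / q| ≤ F.card / q := by
      rw [hc, le_div_iff₀ hq0, ← abs_of_pos hq0, ← abs_mul, abs_of_pos hq0, sub_mul,
        div_mul_cancel₀ _ hq0.ne', Finset.sum_mul, ← Finset.sum_sub_distrib]
      refine (Finset.abs_sum_le_sum_abs _ _).trans ?_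
      rw [Finset.cast_card]
      refine Finset.sum_le_sum fun s _ => ?_
      have h4 : c s * cubeMonomial s X * q - z s * cubeMonomial s X =
          Int.fract (c s * q) * cubeMonomial s X := by
        rw [Int.fract]
        ring
      rw [h4, abs_mul, abs_of_nonneg (Int.fract_nonneg _)]
      have h5 : |cubeMonomial s X| ≤ 1 := by
        rw [cubeMonomial]
        split_ifs <;> simp
      exact mul_le_one₀ (Int.fract_lt_one _).le (abs_nonneg _) h5
    have h4 : (F.card : ℝ) / q ≤ a / (2 * b) := by
      have hF0 : (0 : ℝ) < F.card := by exact_mod_cast hF1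
      have : (F.card : ℝ) / q = 1 / (2 * b) := by
        rw [hqdef]
        push_cast
        field_simp
      rw [this]
      gcongr
    have h5 : (a : ℝ) / b = a / (2 * b) + a / (2 * b) := by
      field_simp
      norm_num
    rw [h2, h5]
    rw [abs_sub_comm] at h1
    exact (abs_sub_le _ (f X) _).trans (add_le_add h1 (h3.trans h4))

end Codes

section Computability

theorem Primrec.nat_pow : Primrec₂ ((· ^ ·) : ℕ → ℕ → ℕ) := Primrec₂.unpaired'.1 Nat.Primrec.pow

variable {α β : Type*} [Primcodable α] [Primcodable β]

theorem Primrec.sum_range {f : α → ℕ → ℕ} {g : α → ℕ} (hf : Primrec₂ f) (hg : Primrec g) :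
    Primrec fun a => ∑ i ∈ Finset.range (g a), f a i := by
  have h : Primrec₂ fun (a : α) (p : ℕ × ℕ) => p.2 + f a p.1 :=
    Primrec.nat_add.comp (Primrec.snd.comp Primrec.snd)
      (hf.comp Primrec.fst (Primrec.fst.comp Primrec.snd))
  refine (Primrec.nat_rec' hg (Primrec.const 0) h).of_eq fun a => ?_
  induction g a with
  | zero => rfl
  | succ m ih => rw [Finset.sum_range_succ, ← ih]

theorem Primrec.sum_list {f : α → β → ℕ} {g : α → List β} (hf : Primrec₂ f) (hg : Primrec g) :
    Primrec fun a => ((g a).map (f a)).sum := by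
  have h : Primrec₂ fun (a : α) (p : β × ℕ) => f a p.1 + p.2 :=
    Primrec.nat_add.comp (hf.comp Primrec.fst (Primrec.fst.comp Primrec.snd))
      (Primrec.snd.comp Primrec.snd)
  refine (Primrec.list_foldr hg (Primrec.const 0) h).of_eq fun a => ?_
  induction g a with
  | nil => rfl
  | cons b l ih => rw [List.foldr_cons, ih, List.map_cons, List.sum_cons]

theorem PrimrecPred.forall_mem_comp {p : α → β → Prop} {g : α → List β} (hp : PrimrecRel p)
    (hg : Primrec g) : PrimrecPred fun a => ∀ x ∈ g a, p a x :=
  (PrimrecRel.forall_mem_list (R := fun x a => p a x) hp.swap).comp hg Primrec.id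

theorem PrimrecPred.forall_lt_comp {p : α → ℕ → Prop} {g : α → ℕ} (hp : PrimrecRel p)
    (hg : Primrec g) : PrimrecPred fun a => ∀ x < g a, p a x := by
  have h := PrimrecPred.forall_mem_comp hp (Primrec.list_range.comp hg)
  simpa only [List.mem_range] using h

theorem primrec_entryBit {r x i j : α → ℕ} (hr : Primrec r) (hx : Primrec x) (hi : Primrec i)
    (hj : Primrec j) : Primrec fun a => entryBit (r a) (x a) (i a) (j a) :=
  Primrec.nat_mod.comp (Primrec.nat_div.comp hx (Primrec.nat_pow.comp (Primrec.const 2)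
    (Primrec.nat_add.comp (Primrec.nat_mul.comp hi hr) hj))) (Primrec.const 2)

theorem primrec_maskColumn {n r x j : α → ℕ} (hn : Primrec n) (hr : Primrec r) (hx : Primrec x)
    (hj : Primrec j) : Primrec fun a => maskColumn (n a) (r a) (x a) (j a) :=
  Primrec.sum_range (primrec_entryBit (hr.comp Primrec.fst) (hx.comp Primrec.fst) Primrec.snd
    (hj.comp Primrec.fst)) hn

theorem primrec_maskWeight {n r x : α → ℕ} (hn : Primrec n) (hr : Primrec r) (hx : Primrec x) :
    Primrec fun a => maskWeight (n a) (r a) (x a) :=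
  Primrec.sum_range (Primrec.sum_range (primrec_entryBit (hr.comp (Primrec.fst.comp Primrec.fst))
    (hx.comp (Primrec.fst.comp Primrec.fst)) (Primrec.snd.comp Primrec.fst) Primrec.snd)
    (hr.comp Primrec.fst)) hn

theorem primrecPred_monomialOn {n r x : α → ℕ} {s : α → List (ℕ × ℕ)} (hn : Primrec n)
    (hr : Primrec r) (hx : Primrec x) (hs : Primrec s) :
    PrimrecPred fun a => MonomialOn (n a) (r a) (x a) (s a) := by
  have h1 : Primrec fun p : α × ℕ × ℕ => p.2.1 := Primrec.fst.comp Primrec.snd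
  have h2 : Primrec fun p : α × ℕ × ℕ => p.2.2 := Primrec.snd.comp Primrec.snd
  refine PrimrecPred.forall_mem_comp (p := fun a p =>
    p.1 < n a ∧ p.2 < r a ∧ entryBit (r a) (x a) p.1 p.2 = 1) ?_ hs
  exact (Primrec.nat_lt.comp h1 (hn.comp Primrec.fst)).and
    ((Primrec.nat_lt.comp h2 (hr.comp Primrec.fst)).and (Primrec.eq.comp
      (primrec_entryBit (hr.comp Primrec.fst) (hx.comp Primrec.fst) h1 h2) (Primrec.const 1)))

theorem primrec_coeffSum {w : ℕ × ℕ × ℕ → ℕ} (hw : Primrec w) {n r x : α → ℕ} {L : α → PolyCode}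
    (hn : Primrec n) (hr : Primrec r) (hx : Primrec x) (hL : Primrec L) :
    Primrec fun a => coeffSum w (n a) (r a) (x a) (L a) :=
  Primrec.sum_list (f := fun a (t : (ℕ × ℕ × ℕ) × List (ℕ × ℕ)) =>
      if MonomialOn (n a) (r a) (x a) t.2 then w t.1 else 0)
    (Primrec.ite (primrecPred_monomialOn (hn.comp Primrec.fst) (hr.comp Primrec.fst)
      (hx.comp Primrec.fst) (Primrec.snd.comp Primrec.snd))
      (hw.comp (Primrec.fst.comp Primrec.snd)) (Primrec.const 0)) hL

theorem primrecPred_approximatesAt (k : ℕ) {n r a b q x : α → ℕ} {L : α → PolyCode}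
    (hn : Primrec n) (hr : Primrec r) (ha : Primrec a) (hb : Primrec b) (hq : Primrec q)
    (hL : Primrec L) (hx : Primrec x) :
    PrimrecPred fun s => ApproximatesAt k (n s) (r s) (a s) (b s) (q s) (L s) (x s) := by
  have hP := Primrec.nat_mul.comp (primrec_coeffSum Primrec.fst hn hr hx hL) hb
  have hcol : PrimrecPred fun s => ∀ j < r s, maskColumn (n s) (r s) (x s) j < k :=
    PrimrecPred.forall_lt_comp (p := fun s j => maskColumn (n s) (r s) (x s) j < k)
      (Primrec.nat_lt.comp (primrec_maskColumn (hn.comp Primrec.fst) (hr.comp Primrec.fst)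
        (hx.comp Primrec.fst) Primrec.snd) (Primrec.const k)) hr
  have hN := Primrec.nat_mul.comp (Primrec.nat_add.comp
    (primrec_coeffSum (Primrec.fst.comp Primrec.snd) hn hr hx hL)
    (Primrec.ite hcol hq (Primrec.const 0))) hb
  have haq := Primrec.nat_mul.comp ha hq
  exact (Primrec.nat_le.comp hP (Primrec.nat_add.comp hN haq)).and
    (Primrec.nat_le.comp hN (Primrec.nat_add.comp hP haq))

end Computability

section Search

theorem exists_computable_choice {α β : Type*} [Primcodable α] [Primcodable β] {R : α → β → Prop}
    (hR : PrimrecRel R) (h : ∀ a, ∃ b, R a b) : ∃ F : α → β, Computable F ∧ ∀ a, R a (F a) := by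
  classical
  let f : α → ℕ → Option β := fun a w =>
    (Encodable.decode (α := β) w).bind fun b => if R a b then some b else none
  have hf : Primrec₂ f := by
    refine Primrec.option_bind (Primrec.decode.comp Primrec.snd) ?_
    refine Primrec.ite (hR.comp (Primrec.fst.comp Primrec.fst) Primrec.snd)
      (Primrec.option_some.comp Primrec.snd) (Primrec.const none)
  have hdom : ∀ a, (Nat.rfindOpt (f a)).Dom := by
    intro a
    obtain ⟨b, hb⟩ := h a
    exact Nat.rfindOpt_dom.mpr ⟨Encodable.encode b, b, by simp [f, hb]⟩
  refine ⟨fun a => (Nat.rfindOpt (f a)).get (hdom a),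
    (Partrec.rfindOpt hf.to_comp).of_eq_tot fun a => Part.get_mem _, fun a => ?_⟩
  obtain ⟨w, hw⟩ := Nat.rfindOpt_spec (Part.get_mem (hdom a))
  obtain ⟨b, -, hb⟩ := Option.bind_eq_some_iff.mp hw
  split_ifs at hb with hab
  rwa [Option.some.inj hb] at hab

/-- The growth of the degree of approximations to within `2^{-Λ}`. -/
noncomputable def degreeBound (k n r : ℕ) (Λ : ℝ) : ℝ :=
  √(n : ℝ) * (min (n : ℝ) (r : ℝ)) ^ (1 / 2 - edExponent k) * Λ ^ edExponent k + √((n : ℝ) * Λ)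

theorem degreeBound_le_mul {k : ℕ} (hk : 1 ≤ k) (n r : ℕ) {s Λ Λ' : ℝ} (hs : 1 ≤ s)
    (hΛ' : 0 ≤ Λ') (h : Λ' ≤ s * Λ) : degreeBound k n r Λ' ≤ s * degreeBound k n r Λ := by
  have hα0 := edExponent_pos hk
  have hα2 := edExponent_le_half hk
  have hΛ : 0 ≤ Λ := nonneg_of_mul_nonneg_right (hΛ'.trans h) (by linarith)
  have h1 : Λ' ^ edExponent k ≤ s * Λ ^ edExponent k := by
    calc Λ' ^ edExponent k ≤ (s * Λ) ^ edExponent k := by gcongr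
      _ = s ^ edExponent k * Λ ^ edExponent k := Real.mul_rpow (by linarith) hΛ
      _ ≤ s ^ (1 : ℝ) * Λ ^ edExponent k := by
          gcongr
          linarith
      _ = _ := by rw [Real.rpow_one]
  have h2 : √((n : ℝ) * Λ') ≤ s * √((n : ℝ) * Λ) := by
    have h3 : (n : ℝ) * Λ' ≤ s ^ 2 * (n * Λ) := by
      calc (n : ℝ) * Λ' ≤ n * (s * Λ) := by gcongr
        _ = s * (n * Λ) := by ring
        _ ≤ _ := by gcongr; exact le_self_pow₀ hs (by norm_num)
    refine (Real.sqrt_le_sqrt h3).trans (le_of_eq ?_)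
    rw [Real.sqrt_mul (by positivity), Real.sqrt_sq (by linarith)]
  rw [degreeBound, degreeBound, mul_add]
  refine add_le_add ?_ h2
  calc _ ≤ √(n : ℝ) * (min (n : ℝ) (r : ℝ)) ^ (1 / 2 - edExponent k) *
        (s * Λ ^ edExponent k) := by gcongr
    _ = _ := by ring

theorem degree_term_pow {k : ℕ} (hk : 1 ≤ k) {n m ℓ : ℕ} (hm : 1 ≤ m) :
    (√(n : ℝ) * (m : ℝ) ^ (1 / 2 - edExponent k) * (ℓ : ℝ) ^ edExponent k) ^ (4 * (2 ^ k - 1)) =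
      ((n ^ (2 * (2 ^ k - 1)) * m ^ (2 ^ k - 2) * ℓ ^ 2 ^ k : ℕ) : ℝ) := by
  have hm0 : (0 : ℝ) < m := by exact_mod_cast hm
  have hN : 2 ≤ 2 ^ k := by
    calc 2 = 2 ^ 1 := rfl
      _ ≤ 2 ^ k := Nat.pow_le_pow_right (by norm_num) hk
  have hα : edExponent k = (2 ^ k : ℕ) / ((4 * (2 ^ k - 1) : ℕ) : ℝ) := by
    have hN' : (2 : ℝ) ≤ 2 ^ k := by exact_mod_cast hN
    have h1 : (2 : ℝ) ^ k - 1 ≠ 0 := by linarith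
    rw [edExponent, zpow_neg, zpow_natCast]
    push_cast [Nat.cast_sub (by omega : 1 ≤ 2 ^ k)]
    field_simp
  generalize 2 ^ k = N at hN hα ⊢
  have hP0 : ((4 * (N - 1) : ℕ) : ℝ) ≠ 0 := by
    have : 4 * (N - 1) ≠ 0 := by omega
    exact_mod_cast this
  have hN1 : ((N - 1 : ℕ) : ℝ) = N - 1 := by push_cast [Nat.cast_sub (by omega : 1 ≤ N)]; ring
  have hN2 : ((N - 2 : ℕ) : ℝ) = N - 2 := by push_cast [Nat.cast_sub hN]; ring
  rw [mul_pow, mul_pow]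
  push_cast
  congr 1
  · congr 1
    · rw [show 4 * (N - 1) = 2 * (2 * (N - 1)) by ring, pow_mul, Real.sq_sqrt (Nat.cast_nonneg n)]
    · rw [← Real.rpow_mul_natCast hm0.le, ← Real.rpow_natCast, hα]
      congr 1
      rw [sub_mul, div_mul_cancel₀ _ hP0, hN2]
      push_cast
      rw [hN1]
      ring
  · rw [← Real.rpow_mul_natCast (Nat.cast_nonneg ℓ), hα, div_mul_cancel₀ _ hP0, Real.rpow_natCast]

/-- The parameters `(n, r, a, b)` are admissible. -/
def IsInput (p : ℕ × ℕ × ℕ × ℕ) : Prop :=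
  1 ≤ p.1 ∧ 1 ≤ p.2.1 ∧ 1 ≤ p.2.2.1 ∧ 2 * p.2.2.1 ≤ p.2.2.2

/-- The code of an approximation of low degree, together with its precision, its common denominator
and a decomposition of its degree. -/
def IsGoodCode (k C₀ : ℕ) (p : ℕ × ℕ × ℕ × ℕ) (c : PolyCode × ℕ × ℕ × ℕ × ℕ) : Prop :=
  1 ≤ c.2.1 ∧ 2 ^ c.2.1 * p.2.2.1 ≤ 4 * p.2.2.2 ∧
  c.2.2.2.1 ^ (4 * (2 ^ k - 1)) ≤ C₀ ^ (4 * (2 ^ k - 1)) *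
    (p.1 ^ (2 * (2 ^ k - 1)) * min p.1 p.2.1 ^ (2 ^ k - 2) * c.2.1 ^ 2 ^ k) ∧
  c.2.2.2.2 ^ 2 ≤ C₀ ^ 2 * (p.1 * c.2.1) ∧ 1 ≤ c.2.2.1 ∧
  (∀ t ∈ c.1, t.1.2.2 = c.2.2.1 ∧ t.2.length ≤ c.2.2.2.1 + c.2.2.2.2) ∧
  ∀ x < 2 ^ (p.1 * p.2.1), maskWeight p.1 p.2.1 x ≤ p.1 →
    ApproximatesAt k p.1 p.2.1 p.2.2.1 p.2.2.2 c.2.2.1 c.1 x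

theorem primrecPred_isInput : PrimrecPred IsInput := by
  have hn : Primrec fun p : ℕ × ℕ × ℕ × ℕ => p.1 := Primrec.fst
  have hr : Primrec fun p : ℕ × ℕ × ℕ × ℕ => p.2.1 := Primrec.fst.comp Primrec.snd
  have ha : Primrec fun p : ℕ × ℕ × ℕ × ℕ => p.2.2.1 :=
    Primrec.fst.comp (Primrec.snd.comp Primrec.snd)
  have hb : Primrec fun p : ℕ × ℕ × ℕ × ℕ => p.2.2.2 :=
    Primrec.snd.comp (Primrec.snd.comp Primrec.snd)
  exact (Primrec.nat_le.comp (Primrec.const 1) hn).and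
    ((Primrec.nat_le.comp (Primrec.const 1) hr).and
    ((Primrec.nat_le.comp (Primrec.const 1) ha).and
    (Primrec.nat_le.comp (Primrec.nat_mul.comp (Primrec.const 2) ha) hb)))

theorem primrecRel_isGoodCode (k C₀ : ℕ) : PrimrecRel (IsGoodCode k C₀) := by
  have hn : Primrec fun s : (ℕ × ℕ × ℕ × ℕ) × (PolyCode × ℕ × ℕ × ℕ × ℕ) => s.1.1 :=
    Primrec.fst.comp Primrec.fst
  have hr : Primrec fun s : (ℕ × ℕ × ℕ × ℕ) × (PolyCode × ℕ × ℕ × ℕ × ℕ) => s.1.2.1 :=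
    Primrec.fst.comp (Primrec.snd.comp Primrec.fst)
  have ha : Primrec fun s : (ℕ × ℕ × ℕ × ℕ) × (PolyCode × ℕ × ℕ × ℕ × ℕ) => s.1.2.2.1 :=
    Primrec.fst.comp (Primrec.snd.comp (Primrec.snd.comp Primrec.fst))
  have hb : Primrec fun s : (ℕ × ℕ × ℕ × ℕ) × (PolyCode × ℕ × ℕ × ℕ × ℕ) => s.1.2.2.2 :=
    Primrec.snd.comp (Primrec.snd.comp (Primrec.snd.comp Primrec.fst))
  have hL : Primrec fun s : (ℕ × ℕ × ℕ × ℕ) × (PolyCode × ℕ × ℕ × ℕ × ℕ) => s.2.1 :=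
    Primrec.fst.comp Primrec.snd
  have hℓ : Primrec fun s : (ℕ × ℕ × ℕ × ℕ) × (PolyCode × ℕ × ℕ × ℕ × ℕ) => s.2.2.1 :=
    Primrec.fst.comp (Primrec.snd.comp Primrec.snd)
  have hq : Primrec fun s : (ℕ × ℕ × ℕ × ℕ) × (PolyCode × ℕ × ℕ × ℕ × ℕ) => s.2.2.2.1 :=
    Primrec.fst.comp (Primrec.snd.comp (Primrec.snd.comp Primrec.snd))
  have he₁ : Primrec fun s : (ℕ × ℕ × ℕ × ℕ) × (PolyCode × ℕ × ℕ × ℕ × ℕ) => s.2.2.2.2.1 :=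
    Primrec.fst.comp (Primrec.snd.comp (Primrec.snd.comp (Primrec.snd.comp Primrec.snd)))
  have he₂ : Primrec fun s : (ℕ × ℕ × ℕ × ℕ) × (PolyCode × ℕ × ℕ × ℕ × ℕ) => s.2.2.2.2.2 :=
    Primrec.snd.comp (Primrec.snd.comp (Primrec.snd.comp (Primrec.snd.comp Primrec.snd)))
  have hpow : ∀ {f : (ℕ × ℕ × ℕ × ℕ) × (PolyCode × ℕ × ℕ × ℕ × ℕ) → ℕ}, Primrec f → ∀ m : ℕ,
      Primrec fun s => f s ^ m := fun hf m => Primrec.nat_pow.comp hf (Primrec.const m)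
  have h1 : PrimrecPred fun s : (ℕ × ℕ × ℕ × ℕ) × (PolyCode × ℕ × ℕ × ℕ × ℕ) =>
      2 ^ s.2.2.1 * s.1.2.2.1 ≤ 4 * s.1.2.2.2 :=
    Primrec.nat_le.comp (Primrec.nat_mul.comp (Primrec.nat_pow.comp (Primrec.const 2) hℓ) ha)
      (Primrec.nat_mul.comp (Primrec.const 4) hb)
  have h2 : ∀ u v w y z : ℕ, PrimrecPred fun s : (ℕ × ℕ × ℕ × ℕ) × (PolyCode × ℕ × ℕ × ℕ × ℕ) =>
      s.2.2.2.2.1 ^ u ≤ v * (s.1.1 ^ w * min s.1.1 s.1.2.1 ^ y * s.2.2.1 ^ z) := fun u v w y z =>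
    Primrec.nat_le.comp (hpow he₁ u) (Primrec.nat_mul.comp (Primrec.const v)
      (Primrec.nat_mul.comp (Primrec.nat_mul.comp (hpow hn w) (hpow (Primrec.nat_min.comp hn hr) y))
        (hpow hℓ z)))
  have h3 : ∀ v : ℕ, PrimrecPred fun s : (ℕ × ℕ × ℕ × ℕ) × (PolyCode × ℕ × ℕ × ℕ × ℕ) =>
      s.2.2.2.2.2 ^ 2 ≤ v * (s.1.1 * s.2.2.1) := fun v =>
    Primrec.nat_le.comp (hpow he₂ 2) (Primrec.nat_mul.comp (Primrec.const v)
      (Primrec.nat_mul.comp hn hℓ))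
  have h4 : PrimrecPred fun s : (ℕ × ℕ × ℕ × ℕ) × (PolyCode × ℕ × ℕ × ℕ × ℕ) =>
      ∀ t ∈ s.2.1, t.1.2.2 = s.2.2.2.1 ∧ t.2.length ≤ s.2.2.2.2.1 + s.2.2.2.2.2 := by
    refine PrimrecPred.forall_mem_comp
      (p := fun (s : (ℕ × ℕ × ℕ × ℕ) × (PolyCode × ℕ × ℕ × ℕ × ℕ))
        (t : (ℕ × ℕ × ℕ) × List (ℕ × ℕ)) =>
        t.1.2.2 = s.2.2.2.1 ∧ t.2.length ≤ s.2.2.2.2.1 + s.2.2.2.2.2) ?_ hL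
    exact (Primrec.eq.comp (Primrec.snd.comp (Primrec.snd.comp (Primrec.fst.comp Primrec.snd)))
      (hq.comp Primrec.fst)).and (Primrec.nat_le.comp
      (Primrec.list_length.comp (Primrec.snd.comp Primrec.snd))
      (Primrec.nat_add.comp (he₁.comp Primrec.fst) (he₂.comp Primrec.fst)))
  have h5 : PrimrecPred fun s : (ℕ × ℕ × ℕ × ℕ) × (PolyCode × ℕ × ℕ × ℕ × ℕ) =>
      ∀ x < 2 ^ (s.1.1 * s.1.2.1), maskWeight s.1.1 s.1.2.1 x ≤ s.1.1 →
        ApproximatesAt k s.1.1 s.1.2.1 s.1.2.2.1 s.1.2.2.2 s.2.2.2.1 s.2.1 x := by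
    refine PrimrecPred.forall_lt_comp
      (p := fun (s : (ℕ × ℕ × ℕ × ℕ) × (PolyCode × ℕ × ℕ × ℕ × ℕ)) (x : ℕ) =>
        maskWeight s.1.1 s.1.2.1 x ≤ s.1.1 →
        ApproximatesAt k s.1.1 s.1.2.1 s.1.2.2.1 s.1.2.2.2 s.2.2.2.1 s.2.1 x) ?_
      (Primrec.nat_pow.comp (Primrec.const 2) (Primrec.nat_mul.comp hn hr))
    have hn' := hn.comp (Primrec.fst (β := ℕ))
    have hr' := hr.comp (Primrec.fst (β := ℕ))
    have h6 := (Primrec.nat_le.comp (primrec_maskWeight hn' hr' Primrec.snd) hn').not.or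
      (primrecPred_approximatesAt k hn' hr' (ha.comp Primrec.fst) (hb.comp Primrec.fst)
        (hq.comp Primrec.fst) (hL.comp Primrec.fst) Primrec.snd)
    exact h6.of_eq fun s => imp_iff_not_or.symm
  exact (Primrec.nat_le.comp (Primrec.const 1) hℓ).and (h1.and ((h2 _ _ _ _ _).and ((h3 _).and
    ((Primrec.nat_le.comp (Primrec.const 1) hq).and (h4.and h5)))))

theorem exists_precision {a b : ℕ} (ha : 1 ≤ a) (hab : 2 * a ≤ b) :
    ∃ ℓ : ℕ, 1 ≤ ℓ ∧ 2 * b ≤ 2 ^ ℓ * a ∧ 2 ^ ℓ * a ≤ 4 * b := by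
  have hex : ∃ ℓ : ℕ, 2 * b ≤ 2 ^ ℓ * a :=
    ⟨2 * b, (Nat.lt_two_pow_self.le).trans (Nat.le_mul_of_pos_right _ ha)⟩
  classical
  have hspec := Nat.find_spec hex
  have hpos : 1 ≤ Nat.find hex := by
    by_contra h
    rw [show Nat.find hex = 0 by omega, pow_zero] at hspec
    omega
  refine ⟨Nat.find hex, hpos, hspec, ?_⟩
  have hmin := Nat.find_min hex (show Nat.find hex - 1 < Nat.find hex by omega)
  obtain ⟨ℓ, hℓ⟩ : ∃ ℓ, Nat.find hex = ℓ + 1 := ⟨Nat.find hex - 1, by omega⟩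
  rw [hℓ, Nat.add_sub_cancel] at hmin
  rw [hℓ, pow_succ]
  linarith

theorem exists_isGoodCode {k : ℕ} (hk : 1 ≤ k) :
    ∃ C₀ : ℕ, 1 ≤ C₀ ∧ ∀ p, IsInput p → ∃ c, IsGoodCode k C₀ p c := by
  obtain ⟨C, hC, H⟩ := exists_approx_distinctness_matrix hk
  have hα0 := edExponent_pos hk
  have hα2 := edExponent_le_half hk
  refine ⟨⌈2 * C⌉₊, Nat.one_le_ceil_iff.mpr (by linarith), ?_⟩
  have hC₀ := Nat.le_ceil (2 * C)
  set C₀ := ⌈2 * C⌉₊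
  clear_value C₀
  rintro ⟨n, r, a, b⟩ ⟨hn, hr, ha, hab⟩
  simp only at hn hr ha hab
  obtain ⟨ℓ, hℓ, hℓ2, hℓ4⟩ := exists_precision ha hab
  obtain ⟨e, f, he, hf, hfX⟩ := H n r ℓ hn hr hℓ
  have hn1 : (1 : ℝ) ≤ n := by exact_mod_cast hn
  have hr1 : (1 : ℝ) ≤ r := by exact_mod_cast hr
  have hℓ1 : (1 : ℝ) ≤ ℓ := by exact_mod_cast hℓ
  have ha0 : (0 : ℝ) < a := by exact_mod_cast ha
  have hb0 : (0 : ℝ) < b := by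
    have : 0 < b := by omega
    exact_mod_cast this
  obtain ⟨L, q, hq, hL, happ⟩ := exists_code (k := k) (a := a) (b := b) ha (by omega) hf
    fun X hX => (hfX X hX).trans (by
      have h1 : (2 : ℝ) * b ≤ 2 ^ ℓ * a := by exact_mod_cast hℓ2
      rw [one_div_pow, div_le_div_iff₀ (by positivity) (by positivity)]
      linarith)
  set T := √(n : ℝ) * (min (n : ℝ) (r : ℝ)) ^ (1 / 2 - edExponent k) * (ℓ : ℝ) ^ edExponent k
    with hT
  have hT1 : 1 ≤ T := by
    refine one_le_mul_of_one_le_of_one_le (one_le_mul_of_one_le_of_one_le ?_ ?_) ?_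
    · exact Real.one_le_sqrt.mpr hn1
    · exact Real.one_le_rpow (le_min hn1 hr1) (by linarith)
    · exact Real.one_le_rpow hℓ1 hα0.le
  have hS1 : 1 ≤ √((n : ℝ) * ℓ) :=
    Real.one_le_sqrt.mpr (one_le_mul_of_one_le_of_one_le hn1 hℓ1)
  have hceil : ∀ {y : ℝ}, 1 ≤ y → (⌈C * y⌉₊ : ℝ) ≤ C₀ * y := by
    intro y hy
    have h1 : 1 ≤ C * y := one_le_mul_of_one_le_of_one_le hC hy
    have h2 := (Nat.ceil_lt_add_one (by linarith : 0 ≤ C * y)).le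
    have h3 : 2 * C * y ≤ C₀ * y := by gcongr
    linarith
  have hTP := degree_term_pow hk (n := n) (ℓ := ℓ) (m := min n r) (le_min hn hr)
  rw [Nat.cast_min, ← hT] at hTP
  refine ⟨(L, ℓ, q, ⌈C * T⌉₊, ⌈C * √((n : ℝ) * ℓ)⌉₊), hℓ, hℓ4, ?_, ?_, hq, ?_, ?_⟩
  · rw [← Nat.cast_le (α := ℝ), Nat.cast_mul, ← hTP]
    push_cast
    rw [← mul_pow]
    exact pow_le_pow_left₀ (Nat.cast_nonneg _) (hceil hT1) _
  · have h1 := pow_le_pow_left₀ (Nat.cast_nonneg _) (hceil hS1) 2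
    rw [mul_pow, Real.sq_sqrt (by positivity)] at h1
    exact_mod_cast h1
  · intro t ht
    refine ⟨(hL t ht).1, (hL t ht).2.trans ?_⟩
    have h1 := Nat.le_ceil (C * T)
    have h2 := Nat.le_ceil (C * √((n : ℝ) * ℓ))
    have h3 : (e : ℝ) ≤ ((⌈C * T⌉₊ + ⌈C * √((n : ℝ) * ℓ)⌉₊ : ℕ) : ℝ) := by
      push_cast
      linarith
    exact_mod_cast h3
  · exact fun x _ hx => happ x hx

theorem one_le_logb_of_le_half {ε : ℝ} (h0 : 0 < ε) (h2 : ε ≤ 1 / 2) :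
    1 ≤ Real.logb 2 (1 / ε) := by
  rw [Real.le_logb_iff_rpow_le (by norm_num) (by positivity), Real.rpow_one, le_div_iff₀ h0]
  linarith

theorem IsGoodCode.totalDegree_le {k C₀ : ℕ} (hk : 1 ≤ k) {n r a b : ℕ}
    {c : PolyCode × ℕ × ℕ × ℕ × ℕ} (hp : IsInput (n, r, a, b)) (h : IsGoodCode k C₀ (n, r, a, b) c) :
    ((PolyCode.toPoly n r c.1).totalDegree : ℝ) ≤
      3 * C₀ * degreeBound k n r (Real.logb 2 (1 / ((a : ℝ) / b))) := by
  obtain ⟨L, ℓ, q, e₁, e₂⟩ := c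
  obtain ⟨hn, hr, ha, hab⟩ := hp
  obtain ⟨hℓ, hℓ4, he₁, he₂, -, hL, -⟩ := h
  simp only at hn hr ha hab hℓ hℓ4 he₁ he₂ hL ⊢
  have ha0 : (0 : ℝ) < a := by exact_mod_cast ha
  have hb0 : (0 : ℝ) < b := by
    have : 0 < b := by omega
    exact_mod_cast this
  have hab' : (2 : ℝ) * a ≤ b := by exact_mod_cast hab
  set Λ := Real.logb 2 (1 / ((a : ℝ) / b)) with hΛ
  have hΛ1 : 1 ≤ Λ := one_le_logb_of_le_half (by positivity) (by
    rw [div_le_div_iff₀ hb0 (by norm_num)]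
    linarith)
  have hℓΛ : (ℓ : ℝ) ≤ 3 * Λ := by
    have h1 : (2 : ℝ) ^ (ℓ : ℝ) ≤ 4 * (1 / ((a : ℝ) / b)) := by
      rw [Real.rpow_natCast, one_div_div, mul_div_assoc', le_div_iff₀ ha0]
      exact_mod_cast hℓ4
    rw [← Real.le_logb_iff_rpow_le (by norm_num) (by positivity),
      Real.logb_mul (by norm_num) (by positivity), show (4 : ℝ) = 2 ^ (2 : ℝ) by norm_num,
      Real.logb_rpow (by norm_num) (by norm_num)] at h1
    linarith
  have hdeg : (PolyCode.toPoly n r L).totalDegree ≤ e₁ + e₂ :=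
    totalDegree_toPoly_le fun t ht => (hL t ht).2
  have h1 : (e₁ : ℝ) ≤ C₀ * (√(n : ℝ) * (min (n : ℝ) (r : ℝ)) ^ (1 / 2 - edExponent k) *
      (ℓ : ℝ) ^ edExponent k) := by
    have hP : 4 * (2 ^ k - 1) ≠ 0 := by
      have : 2 ^ 1 ≤ 2 ^ k := Nat.pow_le_pow_right (by norm_num) hk
      omega
    refine (pow_le_pow_iff_left₀ (Nat.cast_nonneg _) (by positivity) hP).mp ?_
    rw [mul_pow, ← Nat.cast_min, degree_term_pow hk (le_min hn hr)]
    exact_mod_cast he₁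
  have h2 : (e₂ : ℝ) ≤ C₀ * √((n : ℝ) * ℓ) := by
    refine (pow_le_pow_iff_left₀ (Nat.cast_nonneg _) (by positivity) two_ne_zero).mp ?_
    rw [mul_pow, Real.sq_sqrt (by positivity)]
    exact_mod_cast he₂
  calc ((PolyCode.toPoly n r L).totalDegree : ℝ) ≤ e₁ + e₂ := by exact_mod_cast hdeg
    _ ≤ C₀ * degreeBound k n r ℓ := by
        rw [degreeBound, mul_add]
        exact add_le_add h1 h2
    _ ≤ C₀ * (3 * degreeBound k n r Λ) := by
        gcongr
        exact degreeBound_le_mul hk n r (by norm_num) (Nat.cast_nonneg ℓ) hℓΛ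
    _ = _ := by ring

theorem exists_algorithm {k : ℕ} (hk : 1 ≤ k) :
    ∃ C : ℝ, 0 < C ∧ ∃ A : ℕ × ℕ × ℕ × ℕ → PolyCode, Computable A ∧
      ∀ n r a b : ℕ, 1 ≤ n → 1 ≤ r → 1 ≤ a → 2 * a ≤ b →
        IsUniformApproximant (elementDistinctness n r k) ((a : ℝ) / b)
          (PolyCode.toPoly n r (A (n, r, a, b))) ∧
        ((PolyCode.toPoly n r (A (n, r, a, b))).totalDegree : ℝ) ≤
          C * degreeBound k n r (Real.logb 2 (1 / ((a : ℝ) / b))) := by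
  obtain ⟨C₀, hC₀, H⟩ := exists_isGoodCode hk
  have hC₀' : (1 : ℝ) ≤ C₀ := by exact_mod_cast hC₀
  have hR : PrimrecRel fun p c => ¬ IsInput p ∨ IsGoodCode k C₀ p c :=
    (primrecPred_isInput.comp Primrec.fst).not.or (primrecRel_isGoodCode k C₀)
  obtain ⟨F, hF, hFR⟩ := exists_computable_choice hR fun p => by
    by_cases hp : IsInput p
    · obtain ⟨c, hc⟩ := H p hp
      exact ⟨c, Or.inr hc⟩
    · exact ⟨default, Or.inl hp⟩
  refine ⟨3 * C₀, by positivity, fun p => (F p).1, Computable.fst.comp hF, ?_⟩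
  intro n r a b hn hr ha hab
  have hp : IsInput (n, r, a, b) := ⟨hn, hr, ha, hab⟩
  have hgood := (hFR (n, r, a, b)).resolve_left (not_not_intro hp)
  refine ⟨?_, hgood.totalDegree_le hk hp⟩
  obtain ⟨-, -, -, -, hq, hL, happ⟩ := hgood
  exact isUniformApproximant_toPoly (by omega) hq (fun t ht => (hL t ht).1) happ

theorem approxDegree_le_totalDegree {ι : Type*} {X : Set (ι → ℝ)} {f : X → ℝ} {ε : ℝ}
    {p : MvPolynomial ι ℝ} (hp : IsUniformApproximant f ε p) : approxDegree f ε ≤ p.totalDegree :=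
  Nat.sInf_le ⟨p, le_rfl, hp⟩

end Search

theorem theorem1p1 (k : ℕ) (hk : 1 ≤ k) :
    -- error 1/3
    (∃ C : ℝ, 0 < C ∧ ∃ A : ℕ × ℕ → PolyCode, Computable A ∧
      ∀ n r : ℕ, 1 ≤ n → 1 ≤ r →
        (approxDegree (elementDistinctness n r k) (1 / 3) : ℝ) ≤
            C * (√(n : ℝ) * (min (n : ℝ) (r : ℝ)) ^ (1 / 2 - edExponent k)) ∧
        IsUniformApproximant (elementDistinctness n r k) (1 / 3)
            (PolyCode.toPoly n r (A (n, r))) ∧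
        ((PolyCode.toPoly n r (A (n, r))).totalDegree : ℝ) ≤
            C * (√(n : ℝ) * (min (n : ℝ) (r : ℝ)) ^ (1 / 2 - edExponent k))) ∧
    -- arbitrary error
    (∃ C : ℝ, 0 < C ∧ ∃ A : ℕ × ℕ × ℕ × ℕ → PolyCode, Computable A ∧
      ∀ n r : ℕ, 1 ≤ n → 1 ≤ r →
        (∀ ε : ℝ, 0 < ε → ε ≤ 1 / 2 →
          (approxDegree (elementDistinctness n r k) ε : ℝ) ≤
            C * (√(n : ℝ) * (min (n : ℝ) (r : ℝ)) ^ (1 / 2 - edExponent k) *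
                (Real.logb 2 (1 / ε)) ^ edExponent k) +
              C * √((n : ℝ) * Real.logb 2 (1 / ε))) ∧
        -- explicit approximants, for rational errors `ε = a / b`
        (∀ (a b : ℕ) (ε : ℝ), ε = (a : ℝ) / (b : ℝ) → 0 < ε → ε ≤ 1 / 2 →
          IsUniformApproximant (elementDistinctness n r k) ε
            (PolyCode.toPoly n r (A (n, r, a, b))) ∧
          ((PolyCode.toPoly n r (A (n, r, a, b))).totalDegree : ℝ) ≤
            C * (√(n : ℝ) * (min (n : ℝ) (r : ℝ)) ^ (1 / 2 - edExponent k) *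
                (Real.logb 2 (1 / ε)) ^ edExponent k) +
              C * √((n : ℝ) * Real.logb 2 (1 / ε)))) := by
  obtain ⟨C, hC, A, hA, H⟩ := exists_algorithm hk
  have hα2 := edExponent_le_half hk
  constructor
  · refine ⟨4 * C, by positivity, fun p => A (p.1, p.2, 1, 3), hA.comp (Computable.pair Computable.fst
      (Computable.pair Computable.snd (Computable.const (1, 3)))), fun n r hn hr => ?_⟩
    obtain ⟨happ, hdeg⟩ := H n r 1 3 hn hr le_rfl (by norm_num)
    have hn1 : (1 : ℝ) ≤ n := by exact_mod_cast hn
    have hr1 : (1 : ℝ) ≤ r := by exact_mod_cast hr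
    have hlog : Real.logb 2 (1 / (((1 : ℕ) : ℝ) / (3 : ℕ))) ≤ 2 * 1 := by
      rw [Real.logb_le_iff_le_rpow (by norm_num) (by norm_num)]
      norm_num
    have hlog0 : 0 ≤ Real.logb 2 (1 / (((1 : ℕ) : ℝ) / (3 : ℕ))) :=
      zero_le_one.trans (one_le_logb_of_le_half (by norm_num) (by norm_num))
    have hbound : degreeBound k n r 1 ≤
        2 * (√(n : ℝ) * (min (n : ℝ) (r : ℝ)) ^ (1 / 2 - edExponent k)) := by
      have h1 : 1 ≤ (min (n : ℝ) (r : ℝ)) ^ (1 / 2 - edExponent k) :=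
        Real.one_le_rpow (le_min hn1 hr1) (by linarith)
      have h2 := mul_le_mul_of_nonneg_left h1 (Real.sqrt_nonneg (n : ℝ))
      rw [degreeBound, Real.one_rpow, mul_one, mul_one]
      linarith
    have hdeg' : ((PolyCode.toPoly n r (A (n, r, 1, 3))).totalDegree : ℝ) ≤
        4 * C * (√(n : ℝ) * (min (n : ℝ) (r : ℝ)) ^ (1 / 2 - edExponent k)) := by
      calc _ ≤ C * (2 * (2 * (√(n : ℝ) * (min (n : ℝ) (r : ℝ)) ^ (1 / 2 - edExponent k)))) := by
            refine hdeg.trans (mul_le_mul_of_nonneg_left ?_ hC.le)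
            exact (degreeBound_le_mul hk n r (by norm_num) hlog0 hlog).trans (by gcongr)
        _ = _ := by ring
    have happ' : IsUniformApproximant (elementDistinctness n r k) (1 / 3)
        (PolyCode.toPoly n r (A (n, r, 1, 3))) := by
      simpa using happ
    exact ⟨(Nat.cast_le.mpr (approxDegree_le_totalDegree happ')).trans hdeg', happ', hdeg'⟩
  · refine ⟨2 * C, by positivity, A, hA, fun n r hn hr => ⟨fun ε hε hε2 => ?_, ?_⟩⟩
    · set Λ := Real.logb 2 (1 / ε) with hΛ
      have hΛ1 : 1 ≤ Λ := one_le_logb_of_le_half hε hε2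
      set ℓ := ⌈Λ⌉₊ with hℓ
      have hΛℓ : Λ ≤ ℓ := Nat.le_ceil Λ
      have hℓ2 : (ℓ : ℝ) ≤ 2 * Λ := by
        have := (Nat.ceil_lt_add_one (by linarith : 0 ≤ Λ)).le
        linarith
      have hℓ1 : 1 ≤ ℓ := Nat.one_le_ceil_iff.mpr (by linarith)
      obtain ⟨happ, hdeg⟩ := H n r 1 (2 ^ ℓ) hn hr le_rfl (by
        calc 2 * 1 = 2 ^ 1 := rfl
          _ ≤ 2 ^ ℓ := Nat.pow_le_pow_right (by norm_num) hℓ1)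
      have hεℓ : ((1 : ℕ) : ℝ) / ((2 ^ ℓ : ℕ) : ℝ) ≤ ε := by
        have h1 : 1 / ε ≤ 2 ^ (ℓ : ℝ) := by
          rw [← Real.logb_le_iff_le_rpow (by norm_num) (by positivity)]
          exact hΛℓ
        rw [Real.rpow_natCast, div_le_iff₀ hε] at h1
        push_cast
        rw [div_le_iff₀ (by positivity)]
        linarith
      have hlog : Real.logb 2 (1 / (((1 : ℕ) : ℝ) / ((2 ^ ℓ : ℕ) : ℝ))) = ℓ := by
        push_cast
        rw [one_div_one_div, Real.logb_pow, Real.logb_self_eq_one (by norm_num), mul_one]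
      rw [hlog] at hdeg
      have happ' : IsUniformApproximant (elementDistinctness n r k) ε
          (PolyCode.toPoly n r (A (n, r, 1, 2 ^ ℓ))) := fun x => (happ x).trans hεℓ
      calc (approxDegree (elementDistinctness n r k) ε : ℝ)
          ≤ C * degreeBound k n r ℓ :=
            (Nat.cast_le.mpr (approxDegree_le_totalDegree happ')).trans hdeg
        _ ≤ C * (2 * degreeBound k n r Λ) := by
            gcongr
            exact degreeBound_le_mul hk n r (by norm_num) (Nat.cast_nonneg ℓ) hℓ2
        _ = _ := by rw [degreeBound]; ring
    · rintro a b ε rfl hε hε2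
      have hb : 0 < b := by
        rcases Nat.eq_zero_or_pos b with rfl | hb
        · simp at hε
        · exact hb
      have hb0 : (0 : ℝ) < b := by exact_mod_cast hb
      have ha : 1 ≤ a := by
        rcases Nat.eq_zero_or_pos a with rfl | ha
        · simp at hε
        · exact ha
      have hab : 2 * a ≤ b := by
        rw [div_le_div_iff₀ hb0 (by norm_num)] at hε2
        have : (2 : ℝ) * a ≤ b := by linarith
        exact_mod_cast this
      obtain ⟨happ, hdeg⟩ := H n r a b hn hr ha hab
      refine ⟨happ, hdeg.trans ?_⟩
      have hΛ1 := one_le_logb_of_le_half hε hε2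
      have h0 : 0 ≤ degreeBound k n r (Real.logb 2 (1 / ((a : ℝ) / b))) := by
        unfold degreeBound
        positivity
      calc C * degreeBound k n r (Real.logb 2 (1 / ((a : ℝ) / b)))
          ≤ 2 * C * degreeBound k n r (Real.logb 2 (1 / ((a : ℝ) / b))) := by
            have := mul_nonneg hC.le h0
            linarith
        _ = _ := by rw [degreeBound]; ring
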